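/- **Setting.** Let $K\ge 2$ and let $\nu=(\nu_1,\dots,\nu_K)$ be probability distributions on $\mathbb R$ with means $\mu_i>0$ that are $1$-sub-Gaussian: $\mathbb E_{X\sim\nu_i}[e^{\lambda(X-\mu_i)}]\le e^{\lambda^2/2}$ for all $\lambda\in\mathbb R$. Put $\mu_\star=\max_i\mu_i$, $i^\star(\mu)=\arg\max_i\mu_i$, and let $\mathcal I^{\mathrm m}_{\epsilon}(\mu)=\{i:\mu_\star-\mu_i\le\epsilon\mu_\star\}=\{i:\mu_i\ge(1-\epsilon)\mu_\star\}$ be the set of multiplicatively $\epsilon$-good arms. In round $n=1,2,\dots$ an arm $I_n$, depending only on the past (and possibly on extra randomness for breaking ties), is pulled, and $X_n$ is observed, whose conditional law given the past is $\nu_{I_n}$. Let $N_{n,i}$ be the number of pulls of arm $i$ before round $n$ and $\mu_{n,i}$ the empirical mean of arm $i$ before round $n$. **Characteristic times.** For $\epsilon,\beta\in(0,1)$ and $i\in\mathcal I^{\mathrm m}_\epsilon(\mu)$, define $T^{\mathrm m}_{\epsilon,\beta}(\mu,i)\in(0,\infty]$ by $$\frac{2}{T^{\mathrm m}_{\epsilon,\beta}(\mu,i)}=\max_{w\in\triangle_K,\;w_i=\beta}\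 \min_{j\ne i}\ \frac{(\mu_i-(1-\epsilon)\mu_j)^2}{1/\beta+(1-\epsilon)^2/w_j},$$ where $\triangle_K$ is the probability simplex, and put $T^{\mathrm m}_{\epsilon,\beta}(\mu)=\min_{i\in\mathcal I^{\mathrm m}_\epsilon(\mu)}T^{\mathrm m}_{\epsilon,\beta}(\mu,i)$ and $T^{\mathrm m}_{\epsilon}(\mu)=\min_{i\in\mathcal I^{\mathrm m}_\epsilon(\mu)}\,\inf_{\beta\in(0,1)}T^{\mathrm m}_{\epsilon,\beta}(\mu,i)$. **Algorithm EB-TC$^{\mathrm m}_{\epsilon_0}$**, with slack $\epsilon_0\in(0,1)$. Pull each arm once in the rounds $1,\dots,K$. In every round $n>K$, ties being broken arbitrarily, let the recommendation and leader be $\hat\imath_n=B_n\in\arg\max_i\mu_{n,i}$ and let the challenger be $$C_n\in\arg\min_{i\ne B_n}\frac{\mu_{n,B_n}-(1-\epsilon_0)\mu_{n,i}}{\sqrt{1/N_{n,B_n}+(1-\epsilon_0)^2/N_{n,i}}}.$$ Let $T_n(i,j)$ be the number of rounds $t$ with $K<t<n$ and $(B_t,C_t)=(i,j)$, and let $N^i_{n,j}$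 be the number of those rounds with $I_t=j$. Set $\bar\beta_n(i,j)=\beta$ (*fixed* proportions, $\beta\in(0,1)$), or $\bar\beta_n(i,j)=T_n(i,j)^{-1}\sum_{K<t<n,\,(B_t,C_t)=(i,j)}\beta_t(i,j)$ with $\beta_t(i,j)=\dfrac{N_{t,j}}{(1-\epsilon_0)^2N_{t,i}+N_{t,j}}$ (*IDS* proportions). Pull $I_n=C_n$ if $N^{B_n}_{n,C_n}\le(1-\bar\beta_{n+1}(B_n,C_n))\,T_{n+1}(B_n,C_n)$, and $I_n=B_n$ otherwise. **Stopping rule.** For $\delta\in(0,1)$ let $$\tau_{\epsilon_0,\delta}=\inf\Big\{n>K:\ \min_{i\ne\hat\imath_n}\frac{\mu_{n,\hat\imath_n}-(1-\epsilon_0)\mu_{n,i}}{\sqrt{1/N_{n,\hat\imath_n}+(1-\epsilon_0)^2/N_{n,i}}}\ge\sqrt{2c(n-1,\delta)}\Big\},$$ with $c(n,\delta)=2\,\mathcal C_G\big(\tfrac12\log\tfrac{K-1}{\delta}\big)+4\log\big(4+\log\tfrac n2\big)$, $\mathcal C_G(x)=\min_{\lambda\in(1/2,1)}\frac{g_G(\lambda)+x}{\lambda}$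 and $g_G(\lambda)=2\lambda-2\lambda\log(4\lambda)+\log\zeta(2\lambda)-\tfrac12\log(1-\lambda)$, where $\zeta$ is the Riemann zeta function. **Theorem.** Let $\epsilon_0\in(0,1)$. 1. With IDS proportions, and with fixed proportions $\beta$ for every $\beta\in(0,1)$, the algorithm is $(\epsilon_0,\delta)$-PAC for every $\delta\in(0,1)$: for all $\nu$ as above, $\mathbb P_\nu\big(\tau_{\epsilon_0,\delta}<\infty,\ \hat\imath_{\tau_{\epsilon_0,\delta}}\notin\mathcal I^{\mathrm m}_{\epsilon_0}(\mu)\big)\le\delta$. 2. For all $\nu$ as above with $|i^\star(\mu)|=1$, $$\text{[IDS]}\quad\limsup_{\delta\to0}\frac{\mathbb E_\nu[\tau_{\epsilon_0,\delta}]}{\log(1/\delta)}\le T^{\mathrm m}_{\epsilon_0}(\mu),\qquad\text{[fixed }\beta\in(0,1)]\quad\limsup_{\delta\to0}\frac{\mathbb E_\nu[\tau_{\epsilon_0,\delta}]}{\log(1/\delta)}\le T^{\mathrm m}_{\epsilon_0,\beta}(\mu).$$ -/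

import Mathlib

open MeasureTheory ProbabilityTheory Filter Set Topology
open scoped ENNReal NNReal

noncomputable section

namespace EBTC

/-! ### Instances -/

/-- A probability distribution on `ℝ` is `1`-sub-Gaussian if
`E[exp (l (X - E X))] ≤ exp (l ^ 2 / 2)` for all real `l`. -/
def IsOneSubGaussian (κ : Measure ℝ) : Prop :=
  IsProbabilityMeasure κ ∧ HasSubgaussianMGF (fun x => x - ∫ y, y ∂κ) 1 κ

/-- The vector of means of a bandit instance. -/
def means {K : ℕ} (ν : Fin K → Measure ℝ) : Fin K → ℝ := fun i => ∫ y, y ∂(ν i)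

/-- The instances of the multiplicative setting: `1`-sub-Gaussian arms with positive means. -/
def IsInstance {K : ℕ} (ν : Fin K → Measure ℝ) : Prop :=
  ∀ i, IsOneSubGaussian (ν i) ∧ 0 < means ν i

/-- The largest mean. -/
def muStar {K : ℕ} (μ : Fin K → ℝ) : ℝ := ⨆ i, μ i

/-- The set of best arms. -/
def bestArms {K : ℕ} (μ : Fin K → ℝ) : Set (Fin K) := {i | μ i = muStar μ}

/-- The set of multiplicatively `ε`-good arms. -/
def goodArms {K : ℕ} (ε : ℝ) (μ : Fin K → ℝ) : Set (Fin K) :=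
  {i | muStar μ - μ i ≤ muStar μ * ε}

/-! ### Characteristic times

They take values in `[0, ∞]`, with `1 / 0 = ∞` and `1 / ∞ = 0`. In particular an arm `j` with
`w j = 0` gives the value `0` below, and a vanishing maximum gives an infinite time. -/

/-- `max_{w ∈ simplex, w i = β} min_{j ≠ i} (μ i - (1 - ε) μ j)² / (1 / β + (1 - ε)² / w j)`,
for an arm `i` with `μ i ≥ (1 - ε) μ j` for all `j`. -/
def armValue {K : ℕ} (ε β : ℝ) (μ : Fin K → ℝ) (i : Fin K) : ℝ≥0∞ :=
  ⨆ w ∈ {w : Fin K → ℝ | w ∈ stdSimplex ℝ (Fin K) ∧ w i = β}, ⨅ j ∈ {j : Fin K | j ≠ i},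
    ENNReal.ofReal ((μ i - (1 - ε) * μ j) ^ 2) /
      (1 / ENNReal.ofReal β + ENNReal.ofReal ((1 - ε) ^ 2) / ENNReal.ofReal (w j))

/-- `T_{ε, β}(μ, i)`, defined by `2 / T_{ε, β}(μ, i) = armValue ε β μ i`. -/
def armTime {K : ℕ} (ε β : ℝ) (μ : Fin K → ℝ) (i : Fin K) : ℝ≥0∞ := 2 / armValue ε β μ i

/-- The `β`-characteristic time `T_{ε, β}(μ)`. -/
def charTimeBeta {K : ℕ} (ε β : ℝ) (μ : Fin K → ℝ) : ℝ≥0∞ :=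
  ⨅ i ∈ goodArms ε μ, armTime ε β μ i

/-- The characteristic time `T_ε(μ)`. -/
def charTime {K : ℕ} (ε : ℝ) (μ : Fin K → ℝ) : ℝ≥0∞ :=
  ⨅ i ∈ goodArms ε μ, ⨅ β ∈ Ioo (0 : ℝ) 1, armTime ε β μ i

/-! ### Stopping threshold -/

/-- `g_G(l) = 2 l - 2 l log (4 l) + log ζ(2 l) - log (1 - l) / 2`. -/
def gG (l : ℝ) : ℝ :=
  2 * l - 2 * l * Real.log (4 * l) + Real.log (riemannZeta ((2 * l : ℝ) : ℂ)).re
    - 1 / 2 * Real.log (1 - l)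

/-- `C_G(x) = min_{1/2 < l ≤ 1} (g_G(l) + x) / l`. As `g_G(1) = ∞`, the point `l = 1` is left
out of the minimum. -/
def CG (x : ℝ) : ℝ := sInf ((fun l : ℝ => (gG l + x) / l) '' Ioo (1 / 2) 1)

/-- The threshold `c(n, δ) = 2 C_G (log ((K - 1) / δ) / 2) + 4 log (4 + log (n / 2))`. -/
def threshold (K n : ℕ) (δ : ℝ) : ℝ :=
  2 * CG (Real.log (((K : ℝ) - 1) / δ) / 2) + 4 * Real.log (4 + Real.log ((n : ℝ) / 2))

/-! ### Statistics of a trajectory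

Rounds are numbered `1, 2, 3, …`. In round `n` the arm `I n` is pulled and `X n` is observed.
The leader `B n` (which is also the recommended arm) and the challenger `C n` are used in the
rounds `n > K` only. The statistics with index `n` use the rounds before `n`. -/

section Statistics

variable {K : ℕ} {Ω : Type*}

/-- `N_{n,i}`: number of pulls of arm `i` before round `n`. -/
def numPulls (I : ℕ → Ω → Fin K) (n : ℕ) (i : Fin K) (ω : Ω) : ℕ :=
  ((Finset.Ico 1 n).filter (fun t => I t ω = i)).card

/-- `μ_{n,i}`: empirical mean of arm `i` before round `n`. -/
def empMean (I : ℕ → Ω → Fin K) (X : ℕ → Ω → ℝ) (n : ℕ) (i : Fin K) (ω : Ω) : ℝ :=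
  (∑ t ∈ (Finset.Ico 1 n).filter (fun t => I t ω = i), X t ω) / (numPulls I n i ω : ℝ)

/-- The multiplicative transportation cost
`(μ_{n,i} - (1 - ε) μ_{n,j}) / √(1 / N_{n,i} + (1 - ε)² / N_{n,j})`. -/
def cost (ε : ℝ) (I : ℕ → Ω → Fin K) (X : ℕ → Ω → ℝ) (n : ℕ) (i j : Fin K) (ω : Ω) : ℝ :=
  (empMean I X n i ω - (1 - ε) * empMean I X n j ω) /
    Real.sqrt (1 / (numPulls I n i ω : ℝ) + (1 - ε) ^ 2 / (numPulls I n j ω : ℝ))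

/-- The rounds `t` with `K < t < n` in which the leader/challenger pair is `(i, j)`. -/
def pairRounds (B C : ℕ → Ω → Fin K) (n : ℕ) (i j : Fin K) (ω : Ω) : Finset ℕ :=
  (Finset.Ico (K + 1) n).filter (fun t => B t ω = i ∧ C t ω = j)

/-- `T_n(i,j)`: selection count of the leader/challenger pair `(i, j)` before round `n`. -/
def pairCount (B C : ℕ → Ω → Fin K) (n : ℕ) (i j : Fin K) (ω : Ω) : ℕ :=
  (pairRounds B C n i j ω).card

/-- `N^i_{n,j}`: number of rounds before `n` with leader `i` and challenger `j` in which `j`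
is pulled. -/
def challengerPulls (I B C : ℕ → Ω → Fin K) (n : ℕ) (i j : Fin K) (ω : Ω) : ℕ :=
  ((pairRounds B C n i j ω).filter (fun t => I t ω = j)).card

/-- The two variants of the algorithm: IDS proportions, or a fixed proportion `β`. -/
inductive Proportions where
  | ids : Proportions
  | fixed (β : ℝ) : Proportions

/-- A fixed proportion has to lie in `(0, 1)`. -/
def Proportions.Valid : Proportions → Prop
  | .ids => True
  | .fixed β => β ∈ Ioo (0 : ℝ) 1

/-- The IDS proportion `β_n(i,j) = N_{n,j} / ((1 - ε)² N_{n,i} + N_{n,j})`. -/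
def idsBeta (ε : ℝ) (I : ℕ → Ω → Fin K) (n : ℕ) (i j : Fin K) (ω : Ω) : ℝ :=
  (numPulls I n j ω : ℝ) / ((1 - ε) ^ 2 * (numPulls I n i ω : ℝ) + (numPulls I n j ω : ℝ))

/-- The target average proportion of the leader: `β` for a fixed proportion, and
`T_n(i,j)⁻¹ ∑_{t < n, (B_t, C_t) = (i,j)} β_t(i,j)` for IDS. -/
def betaBar (p : Proportions) (ε : ℝ) (I B C : ℕ → Ω → Fin K) (n : ℕ) (i j : Fin K)
    (ω : Ω) : ℝ :=
  match p with
  | .ids => (pairCount B C n i j ω : ℝ)⁻¹ * ∑ t ∈ pairRounds B C n i j ω, idsBeta ε I t i j ω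
  | .fixed β => β

/-- The multiplicative GLR stopping time with error `ε` and confidence `δ`
(equal to `⊤` if the stopping condition is never met). -/
def stoppingTime (ε δ : ℝ) (I B : ℕ → Ω → Fin K) (X : ℕ → Ω → ℝ) (ω : Ω) : ℕ∞ :=
  sInf ((fun n : ℕ => (n : ℕ∞)) '' {n : ℕ | K < n ∧ ∀ j, j ≠ B n ω →
    Real.sqrt (2 * threshold K (n - 1) δ) ≤ cost ε I X n (B n ω) j ω})

end Statistics

/-! ### Runs of the algorithm -/

/-- `(I, B, C, X)` is a run of the algorithm with slack `ε` and proportions `p` on the bandit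
instance `ν`, on the probability space `(Ω, P)`. Here `ℱ n` is the information available before
round `n` (the history, and possibly extra randomness used for breaking ties). -/
structure IsRun {K : ℕ} {Ω : Type*} [MeasurableSpace Ω] (ν : Fin K → Measure ℝ)
    (p : Proportions) (ε : ℝ) (P : Measure Ω) (ℱ : Filtration ℕ ‹MeasurableSpace Ω›)
    (I B C : ℕ → Ω → Fin K) (X : ℕ → Ω → ℝ) : Prop where
  /-- The decisions of round `n` depend only on the information available before round `n`. -/
  measurable_arm : ∀ n, 1 ≤ n → Measurable[ℱ n] (I n)
  measurable_leader : ∀ n, K < n → Measurable[ℱ n] (B n)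
  measurable_challenger : ∀ n, K < n → Measurable[ℱ n] (C n)
  /-- The observation of round `n` is available after round `n`. -/
  measurable_obs : ∀ n, 1 ≤ n → Measurable[ℱ (n + 1)] (X n)
  /-- Given the past, the observation of round `n` has law `ν (I n)`. -/
  law_obs : ∀ n, 1 ≤ n → ∀ A : Set ℝ, MeasurableSet A →
    P⟦X n ⁻¹' A | ℱ n⟧ =ᵐ[P] fun ω => (ν (I n ω)).real A
  /-- Each arm is pulled once in the rounds `1, …, K`. -/
  init : ∀ i ω, numPulls I (K + 1) i ω = 1
  /-- The leader has the largest empirical mean (ties are broken arbitrarily). -/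
  leader : ∀ n, K < n → ∀ ω i, empMean I X n i ω ≤ empMean I X n (B n ω) ω
  /-- The challenger minimizes the transportation cost from the leader (ties are broken
  arbitrarily). -/
  challenger_ne : ∀ n, K < n → ∀ ω, C n ω ≠ B n ω
  challenger : ∀ n, K < n → ∀ ω i, i ≠ B n ω →
    cost ε I X n (B n ω) (C n ω) ω ≤ cost ε I X n (B n ω) i ω
  /-- Tracking of the target proportion of the current pair. -/
  arm : ∀ n, K < n → ∀ ω, I n ω =
    if (challengerPulls I B C n (B n ω) (C n ω) ω : ℝ) ≤
        (1 - betaBar p ε I B C (n + 1) (B n ω) (C n ω) ω) *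
          (pairCount B C (n + 1) (B n ω) (C n ω) ω : ℝ)
    then C n ω else B n ω

/-- The event that the algorithm stops and then recommends an arm which is not `ε`-good. -/
def errorEvent {K : ℕ} {Ω : Type*} (ν : Fin K → Measure ℝ) (ε δ : ℝ)
    (I B : ℕ → Ω → Fin K) (X : ℕ → Ω → ℝ) : Set Ω :=
  {ω | ∃ n : ℕ, stoppingTime ε δ I B X ω = (n : ℕ∞) ∧ B n ω ∉ goodArms ε (means ν)}

/-- `limsup_{δ → 0} E[τ_{ε,δ}] / log (1 / δ)`, in `[0, ∞]`. -/
def limsupSampleComplexity {K : ℕ} {Ω : Type*} [MeasurableSpace Ω] (P : Measure Ω) (ε : ℝ)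
    (I B : ℕ → Ω → Fin K) (X : ℕ → Ω → ℝ) : ℝ≥0∞ :=
  limsup (fun δ : ℝ => (∫⁻ ω, (stoppingTime ε δ I B X ω : ℝ≥0∞) ∂P) /
    ENNReal.ofReal (Real.log (1 / δ))) (𝓝[>] (0 : ℝ))

end EBTC

end

/-!
Correctness and asymptotic optimality of a top-two algorithm for multiplicative best arm
identification.

*Correctness.* If a bad arm `i` is recommended at the stopping time, then `μ i < (1 - ε) μ s` for
the best arm `s`, and by the Cauchy-Schwarz inequality the deviations of the empirical means of `i` and
`s` alone account for the threshold (`sum_sq_ge_of_cost_ge`). For two arms the processes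
`exp (a S_i - a² N_i / 2 + b S_j - b² N_j / 2)` are supermartingales; they are mixed over `(a, b)`
with a product of two countable mixtures of Gaussians, one for each scale of the number of pulls
(`exp_le_lintegral_mixPrior`), and Ville's inequality gives a bound which is uniform in time and is
exactly the one encoded in the threshold (`IsRun.concentration`). A union bound over the `K - 1`
suboptimal arms finishes.

*Sample complexity.* The same bound shows that the event `Concentrated` of round `n`, on which all
empirical means up to round `n` are within `√(A log n / N)` of the means, fails with summable
probability. Hence it suffices to show that on this event the algorithm has stopped by round `n`, as
soon as `n` exceeds both a constant and `(2 / V + o(1)) log (1 / δ)` (`lintegral_le_of_forall_le`).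
On that event the argument is deterministic.

* Since the slack `ε` keeps the cost of a well-sampled pair large, the leader or the challenger is
  always among the least pulled arms, up to a constant factor (`IsRun.exists_min_le`). Tracking then
  gives every arm linearly many pulls (`IsRun.linear_exploration`), so the empirical means converge
  and the leader is the best arm `s`.
* With `x_j = N_j / N_s`, tracking a fixed proportion `β` forces `∑ x_j → (1 - β) / β`. The IDS
  proportion of a pair satisfies `(1 - ε)² N_s β_t = N_j (1 - β_t)`, so it conserves
  `(1 - ε)² N_s² - ∑ N_j²` and forces `∑ x_j² → (1 - ε)²` (`IsRun.balance`).
* Let `x*` satisfy the same constraint and have equal costs for all `j` (`IsBalanced`). Some arm is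
  always at or below its value `x*_k`, so that an arm above its own value is not the cheapest and is
  not chosen as challenger; afterwards `x_j` only decreases. Hence `x_j ≤ x*_j + o(1)` for all `j`,
  and the constraint forces `x_j → x*_j`. The squared costs divided by `n` tend to a common
  value `V` (`IsRun.tendsto_sq_cost_div`).
* `V` is at least the maximum defining the characteristic time of the best arm: for IDS, the
  constraint `∑ x_j² = (1 - ε)²` is the first-order condition of a concave problem
  (`armValue_le_ids`). Among the good arms the best arm has the smallest characteristic time
  (`armValue_le_armValue_best`).
-/

namespace EBTC

/-! ### The threshold function and the mixture weights -/

/-- For a real exponent the value `(riemannZeta s).re` is the sum of the Dirichlet series. -/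
lemma hasSum_zeta_re {s : ℝ} (hs : 1 < s) :
    HasSum (fun m : ℕ => ((m : ℝ) + 1) ^ (-s)) (riemannZeta (s : ℂ)).re := by
  have h1 : HasSum (fun m : ℕ => ((m : ℝ) + 1) ^ (-s)) (∑' m : ℕ, ((m : ℝ) + 1) ^ (-s)) := by
    refine Summable.hasSum ?_
    have := (summable_nat_add_iff 1).2 (Real.summable_nat_rpow.2 (show -s < -1 by linarith))
    simpa using this
  have h2 : riemannZeta (s : ℂ) = ((∑' m : ℕ, ((m : ℝ) + 1) ^ (-s) : ℝ) : ℂ) := by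
    rw [zeta_eq_tsum_one_div_nat_add_one_cpow (by simpa using hs), Complex.ofReal_tsum]
    refine tsum_congr fun m => ?_
    have hm : (0 : ℝ) ≤ (m : ℝ) + 1 := by positivity
    rw [Complex.ofReal_cpow hm, Complex.ofReal_neg, Complex.cpow_neg]
    simp
  rw [h2, Complex.ofReal_re]
  exact h1

lemma one_le_zeta_re {s : ℝ} (hs : 1 < s) : 1 ≤ (riemannZeta (s : ℂ)).re := by
  have h := (hasSum_zeta_re hs)
  have := h.summable.sum_le_tsum (Finset.range 1) (fun i _ => by positivity)
  rw [h.tsum_eq] at this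
  simpa using this

lemma gG_lower {l : ℝ} (hl : l ∈ Ioo (1 / 2 : ℝ) 1) : -2 ≤ gG l := by
  obtain ⟨h1, h2⟩ := hl
  have hz : 0 ≤ Real.log (riemannZeta ((2 * l : ℝ) : ℂ)).re :=
    Real.log_nonneg (one_le_zeta_re (by linarith))
  have hl1 : Real.log (1 - l) ≤ 0 := Real.log_nonpos (by linarith) (by linarith)
  have hl2 : Real.log (4 * l) ≤ 2 := by
    have h4 : Real.log (4 * l) ≤ Real.log 4 := Real.log_le_log (by linarith) (by linarith)
    have : Real.log 4 = 2 * Real.log 2 := by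
      rw [show (4 : ℝ) = 2 ^ 2 by norm_num, Real.log_pow]; norm_num
    linarith [Real.log_two_lt_d9]
  unfold gG
  nlinarith

/-- The set defining `CG` is bounded below, so that `CG` is a genuine infimum. -/
lemma bddBelow_CG (x : ℝ) : BddBelow ((fun l : ℝ => (gG l + x) / l) '' Ioo (1 / 2) 1) := by
  refine ⟨-(2 * (2 + |x|)), ?_⟩
  rintro _ ⟨l, hl, rfl⟩
  have hg := gG_lower hl
  obtain ⟨h1, h2⟩ := hl
  have hx := neg_abs_le x
  have hx' := abs_nonneg x
  simp only
  rw [le_div_iff₀ (by linarith)]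
  nlinarith

lemma CG_le {l : ℝ} (hl : l ∈ Ioo (1 / 2 : ℝ) 1) (x : ℝ) : CG x ≤ (gG l + x) / l :=
  csInf_le (bddBelow_CG x) ⟨l, hl, rfl⟩

lemma exists_lt_of_CG_lt {x y : ℝ} (h : CG x < y) :
    ∃ l ∈ Ioo (1 / 2 : ℝ) 1, (gG l + x) / l < y := by
  obtain ⟨_, ⟨l, hl, rfl⟩, h⟩ := exists_lt_of_csInf_lt
    (Set.Nonempty.image _ (Set.nonempty_Ioo.2 (by norm_num))) h
  exact ⟨l, hl, h⟩

/-! ### Gaussian mixtures -/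

/-- The exponential weight turns the Gaussian of variance `v` into a multiple of the one of variance
`v / (1 + v N)`. -/
lemma lintegral_exp_gaussianReal (v : ℝ≥0) (hv : v ≠ 0) (S : ℝ) (N : ℕ) :
    ∫⁻ a, ENNReal.ofReal (Real.exp (a * S - a ^ 2 * N / 2)) ∂(gaussianReal 0 v) =
      ENNReal.ofReal (Real.sqrt (1 / (1 + v * N)) *
        Real.exp (S ^ 2 * v / (2 * (1 + v * N)))) := by
  have hv0 : (0 : ℝ) < v := by positivity
  have hD : (0 : ℝ) < 1 + v * N := by positivity
  set w : ℝ≥0 := v / (1 + v * N) with hw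
  have hwr : (w : ℝ) = v / (1 + v * N) := by simp [hw]
  have hw0 : w ≠ 0 := by
    rw [hw]; positivity
  have hwpos : (0 : ℝ) < w := by positivity
  have key : ∀ a : ℝ, gaussianPDFReal 0 v a * Real.exp (a * S - a ^ 2 * N / 2) =
      Real.sqrt (1 / (1 + v * N)) * (gaussianPDFReal 0 w a * Real.exp (S * a)) := by
    intro a
    simp only [gaussianPDFReal, sub_zero]
    have e1 : (Real.sqrt (2 * Real.pi * v))⁻¹ =
        Real.sqrt (1 / (1 + v * N)) * (Real.sqrt (2 * Real.pi * w))⁻¹ := by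
      rw [← Real.sqrt_inv, ← Real.sqrt_inv, ← Real.sqrt_mul (by positivity)]
      congr 1
      rw [hwr]; field_simp
    rw [e1, mul_assoc, mul_assoc (Real.sqrt (2 * Real.pi * w))⁻¹, mul_assoc,
      ← Real.exp_add, ← Real.exp_add]
    congr 3
    rw [hwr]; field_simp; ring
  have hint : ∫⁻ a, ENNReal.ofReal (Real.exp (S * a)) ∂(gaussianReal 0 w) =
      ENNReal.ofReal (Real.exp (w * S ^ 2 / 2)) := by
    have h := congrFun (mgf_fun_id_gaussianReal (μ := 0) (v := w)) S
    rw [mgf] at h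
    rw [← ofReal_integral_eq_lintegral_ofReal (integrable_exp_mul_gaussianReal S)
      (Eventually.of_forall fun _ => (Real.exp_pos _).le), h]
    simp
  rw [gaussianReal_of_var_ne_zero _ hv, lintegral_withDensity_eq_lintegral_mul _
    (measurable_gaussianPDF 0 v) (by fun_prop)]
  rw [gaussianReal_of_var_ne_zero _ hw0, lintegral_withDensity_eq_lintegral_mul _
    (measurable_gaussianPDF 0 w) (by fun_prop)] at hint
  rw [ENNReal.ofReal_mul (by positivity), show S ^ 2 * v / (2 * (1 + v * N)) = w * S ^ 2 / 2 by
    rw [hwr]; field_simp, ← hint, ← lintegral_const_mul _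
    ((measurable_gaussianPDF 0 w).mul (by fun_prop))]
  refine lintegral_congr fun a => ?_
  simp only [Pi.mul_apply, gaussianPDF]
  rw [← ENNReal.ofReal_mul (gaussianPDFReal_nonneg _ _ _), key,
    ENNReal.ofReal_mul (by positivity), ENNReal.ofReal_mul (gaussianPDFReal_nonneg _ _ _)]

/-- The variances of the Gaussian components of the mixing distribution: a geometric grid of
ratio `exp (-4 l)`, the value for which the discretisation cost is exactly the one in `gG`. -/
noncomputable def mixVar (l : ℝ) (m : ℕ) : ℝ≥0 :=
  Real.toNNReal (l / (1 - l) * Real.exp (-(4 * l * m)))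

/-- The mixing distribution: centred Gaussians of variance `mixVar l m`, with weights
proportional to `(m + 1) ^ (-2 l)`. -/
noncomputable def mixPrior (l : ℝ) : Measure ℝ :=
  Measure.sum fun m : ℕ => ENNReal.ofReal (((m : ℝ) + 1) ^ (-(2 * l)) /
    (riemannZeta ((2 * l : ℝ) : ℂ)).re) • gaussianReal 0 (mixVar l m)

lemma isProbabilityMeasure_mixPrior {l : ℝ} (hl : l ∈ Ioo (1 / 2 : ℝ) 1) :
    IsProbabilityMeasure (mixPrior l) := by
  constructor
  have hs : 1 < 2 * l := by linarith [hl.1]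
  have hz := one_le_zeta_re hs
  rw [mixPrior, Measure.sum_apply _ MeasurableSet.univ]
  simp only [Measure.smul_apply, measure_univ, smul_eq_mul, mul_one]
  have h := (hasSum_zeta_re hs).div_const (riemannZeta ((2 * l : ℝ) : ℂ)).re
  rw [← ENNReal.ofReal_tsum_of_nonneg (fun m => by positivity) h.summable, h.tsum_eq,
    div_self (by linarith), ENNReal.ofReal_one]

/-- The mixture dominates `exp (l Y - gG l)` with `Y = S² / (2 N) - 2 log (4 + log N)`: it
suffices to keep the component whose variance is just above `l / ((1 - l) N)`. -/
lemma exp_le_lintegral_mixPrior {l : ℝ} (hl : l ∈ Ioo (1 / 2 : ℝ) 1) (S : ℝ) {N : ℕ}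
    (hN : 1 ≤ N) :
    ENNReal.ofReal (Real.exp (l * (S ^ 2 / (2 * N) - 2 * Real.log (4 + Real.log N)) - gG l)) ≤
      ∫⁻ a, ENNReal.ofReal (Real.exp (a * S - a ^ 2 * N / 2)) ∂(mixPrior l) := by
  obtain ⟨hl1, hl2⟩ := hl
  have hs : 1 < 2 * l := by linarith
  have hz := one_le_zeta_re hs
  set z := (riemannZeta ((2 * l : ℝ) : ℂ)).re with hzdef
  have hN1 : (1 : ℝ) ≤ N := by exact_mod_cast hN
  have hlogN : 0 ≤ Real.log N := Real.log_nonneg hN1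
  -- `exp (4 l m) ≤ N < exp (4 l (m + 1))`
  set m := ⌊Real.log N / (4 * l)⌋₊ with hm
  have hm1 : (m : ℝ) ≤ Real.log N / (4 * l) := Nat.floor_le (by positivity)
  have hm2 : Real.log N / (4 * l) < m + 1 := Nat.lt_floor_add_one _
  rw [le_div_iff₀ (by linarith)] at hm1
  rw [div_lt_iff₀ (by linarith)] at hm2
  set ρ : ℝ := N * Real.exp (-(4 * l * m)) with hρ
  have hρ1 : 1 ≤ ρ := by
    rw [hρ, ← Real.exp_log (show (0 : ℝ) < N by linarith), ← Real.exp_add]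
    exact Real.one_le_exp (by linarith)
  have hρ2 : ρ ≤ Real.exp (4 * l) := by
    rw [hρ, ← Real.exp_log (show (0 : ℝ) < N by linarith), ← Real.exp_add]
    exact Real.exp_le_exp.2 (by linarith)
  have hvpos : 0 < l / (1 - l) * Real.exp (-(4 * l * m)) := by
    have : 0 < 1 - l := by linarith
    positivity
  have hv : (mixVar l m : ℝ) = l / (1 - l) * Real.exp (-(4 * l * m)) :=
    Real.coe_toNNReal _ hvpos.le
  have hv0 : mixVar l m ≠ 0 := by
    rw [← NNReal.coe_ne_zero, hv]; exact hvpos.ne'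
  have hvN : (mixVar l m : ℝ) * N = l / (1 - l) * ρ := by rw [hv, hρ]; ring
  have hl3 : 0 < 1 - l := by linarith
  calc ENNReal.ofReal (Real.exp (l * (S ^ 2 / (2 * N) - 2 * Real.log (4 + Real.log N)) - gG l))
      ≤ ENNReal.ofReal (((m : ℝ) + 1) ^ (-(2 * l)) / z) *
        ENNReal.ofReal (Real.sqrt (1 / (1 + mixVar l m * N)) *
        Real.exp (S ^ 2 * mixVar l m / (2 * (1 + mixVar l m * N)))) := ?_
    _ = ∫⁻ a, ENNReal.ofReal (Real.exp (a * S - a ^ 2 * N / 2))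
        ∂(ENNReal.ofReal (((m : ℝ) + 1) ^ (-(2 * l)) / z) • gaussianReal 0 (mixVar l m)) := by
      rw [lintegral_smul_measure, lintegral_exp_gaussianReal _ hv0, smul_eq_mul]
    _ ≤ _ := by
      rw [mixPrior, lintegral_sum_measure]
      exact ENNReal.le_tsum (f := fun m : ℕ => ∫⁻ a, ENNReal.ofReal
        (Real.exp (a * S - a ^ 2 * N / 2)) ∂(ENNReal.ofReal (((m : ℝ) + 1) ^ (-(2 * l)) / z) •
          gaussianReal 0 (mixVar l m))) m
  rw [← ENNReal.ofReal_mul (by positivity)]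
  apply ENNReal.ofReal_le_ofReal
  -- the exponent
  have hexp : l * (S ^ 2 / (2 * N)) ≤ S ^ 2 * mixVar l m / (2 * (1 + mixVar l m * N)) := by
    have e : S ^ 2 * mixVar l m / (2 * (1 + mixVar l m * N)) =
        (l * ρ / (1 - l + l * ρ)) * (S ^ 2 / (2 * N)) := by
      have h1 : (mixVar l m : ℝ) = l / (1 - l) * ρ / N := by rw [← hvN]; field_simp
      rw [hvN, h1]
      field_simp
    rw [e]
    apply mul_le_mul_of_nonneg_right _ (by positivity)
    rw [le_div_iff₀ (by nlinarith)]
    exact mul_le_mul_of_nonneg_left (by nlinarith) (by linarith)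
  -- the normalisation of the Gaussian
  have hsqrt : Real.exp (Real.log (1 - l) / 2 - 2 * l) ≤
      Real.sqrt (1 / (1 + mixVar l m * N)) := by
    apply Real.le_sqrt_of_sq_le
    rw [← Real.exp_nat_mul, hvN, show ((2 : ℕ) : ℝ) * (Real.log (1 - l) / 2 - 2 * l) =
      Real.log (1 - l) + -(4 * l) by push_cast; ring, Real.exp_add, Real.exp_log hl3,
      Real.exp_neg, ← div_eq_mul_inv, div_le_div_iff₀ (Real.exp_pos _) (by positivity), one_mul]
    have : (1 - l) * (1 + l / (1 - l) * ρ) = 1 - l + l * ρ := by field_simp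
    rw [this]
    nlinarith
  -- the weight of the component
  have hwt : Real.exp (-(2 * l) * Real.log (4 + Real.log N) + 2 * l * Real.log (4 * l)) ≤
      ((m : ℝ) + 1) ^ (-(2 * l)) := by
    rw [Real.rpow_def_of_pos (by positivity)]
    apply Real.exp_le_exp.2
    have h1 : Real.log ((m : ℝ) + 1) ≤ Real.log ((4 + Real.log N) / (4 * l)) := by
      apply Real.log_le_log (by positivity)
      rw [le_div_iff₀ (by linarith)]
      nlinarith
    rw [Real.log_div (by positivity) (by positivity)] at h1
    nlinarith
  calc Real.exp (l * (S ^ 2 / (2 * N) - 2 * Real.log (4 + Real.log N)) - gG l)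
      = (Real.exp (-(2 * l) * Real.log (4 + Real.log N) + 2 * l * Real.log (4 * l)) / z) *
        (Real.exp (Real.log (1 - l) / 2 - 2 * l) * Real.exp (l * (S ^ 2 / (2 * N)))) := by
        have : z = Real.exp (Real.log z) := (Real.exp_log (by linarith)).symm
        conv_rhs => rw [this]
        rw [← Real.exp_sub, ← Real.exp_add, ← Real.exp_add]
        congr 1
        unfold gG
        rw [← hzdef]
        ring
    _ ≤ _ := by gcongr

/-! ### Ville's inequality -/

/-- Ville's inequality for a nonnegative supermartingale, in a form without conditional
expectations. -/
lemma ville {Ω : Type*} [mΩ : MeasurableSpace Ω] {P : Measure Ω} {ℱ : Filtration ℕ mΩ}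
    {M : ℕ → Ω → ℝ≥0∞} (hM : ∀ n, 1 ≤ n → Measurable[ℱ n] (M n))
    (hstep : ∀ n, 1 ≤ n → ∀ A, MeasurableSet[ℱ n] A →
      ∫⁻ ω in A, M (n + 1) ω ∂P ≤ ∫⁻ ω in A, M n ω ∂P)
    (h1 : ∫⁻ ω, M 1 ω ∂P ≤ 1) (c : ℝ≥0∞) :
    c * P {ω | ∃ n, 1 ≤ n ∧ c ≤ M n ω} ≤ 1 := by
  set D : ℕ → Set Ω := fun n => {ω | ∃ t, 1 ≤ t ∧ t < n ∧ c ≤ M t ω} with hD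
  have hDm : ∀ n, 1 ≤ n → MeasurableSet[ℱ n] (D n) := by
    intro n _
    have : D n = ⋃ t ∈ {t | 1 ≤ t ∧ t < n}, {ω | c ≤ M t ω} := by
      ext ω; simp [hD, and_assoc]
    rw [this]
    refine @MeasurableSet.biUnion _ _ (ℱ n) _ _ (Set.to_countable _) fun t ht => ?_
    exact ℱ.mono ht.2.le _ (hM t ht.1 measurableSet_Ici)
  have key : ∀ n, 1 ≤ n → c * P (D n) + ∫⁻ ω in (D n)ᶜ, M n ω ∂P ≤ 1 := by
    intro n hn
    induction n, hn using Nat.le_induction with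
    | base =>
      have : D 1 = ∅ := by ext ω; simp [hD]
      simpa [this] using h1
    | succ n hn ih =>
      set G : Set Ω := {ω | c ≤ M n ω}
      have hG : MeasurableSet G := ℱ.le n _
        (hM n hn measurableSet_Ici)
      have e1 : D (n + 1) = D n ∪ G := by
        ext ω
        simp only [hD, G, mem_ofPred_eq, mem_union]
        constructor
        · rintro ⟨t, h1, h2, h3⟩
          rcases Nat.lt_succ_iff_lt_or_eq.1 h2 with h | rfl
          · exact .inl ⟨t, h1, h, h3⟩
          · exact .inr h3
        · rintro (⟨t, h1, h2, h3⟩ | h)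
          · exact ⟨t, h1, by omega, h3⟩
          · exact ⟨n, hn, by omega, h⟩
      have e2 : (D (n + 1))ᶜ = (D n)ᶜ \ G := by rw [e1, compl_union]; rfl
      have i1 : ∫⁻ ω in (D n)ᶜ, M n ω ∂P =
          ∫⁻ ω in (D n)ᶜ ∩ G, M n ω ∂P + ∫⁻ ω in (D (n + 1))ᶜ, M n ω ∂P := by
        rw [e2, lintegral_inter_add_sdiff _ _ hG]
      have i2 : c * P ((D n)ᶜ ∩ G) ≤ ∫⁻ ω in (D n)ᶜ ∩ G, M n ω ∂P := by
        rw [← setLIntegral_const]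
        refine setLIntegral_mono' (((ℱ.le n _ (hDm n hn)).compl).inter hG) ?_
        intro ω hω
        exact hω.2
      have i3 : P (D (n + 1)) ≤ P (D n) + P ((D n)ᶜ ∩ G) := by
        rw [e1]
        refine le_trans (measure_mono ?_) (measure_union_le _ _)
        intro ω hω
        by_cases h : ω ∈ D n
        · exact .inl h
        · exact .inr ⟨h, hω.resolve_left h⟩
      have i4 := hstep n hn (D (n + 1))ᶜ
        (by
          rw [e1]
          exact @MeasurableSet.compl _ _ (ℱ n) (@MeasurableSet.union _ (ℱ n) _ _ (hDm n hn)
            (hM n hn measurableSet_Ici)))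
      calc c * P (D (n + 1)) + ∫⁻ ω in (D (n + 1))ᶜ, M (n + 1) ω ∂P
          ≤ c * (P (D n) + P ((D n)ᶜ ∩ G)) + ∫⁻ ω in (D (n + 1))ᶜ, M n ω ∂P := by gcongr
        _ = c * P (D n) + (c * P ((D n)ᶜ ∩ G) + ∫⁻ ω in (D (n + 1))ᶜ, M n ω ∂P) := by ring
        _ ≤ c * P (D n) + ∫⁻ ω in (D n)ᶜ, M n ω ∂P := by rw [i1]; gcongr
        _ ≤ 1 := ih
  have hU : {ω | ∃ n, 1 ≤ n ∧ c ≤ M n ω} = ⋃ n, D n := by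
    ext ω
    simp only [hD, mem_ofPred_eq, mem_iUnion]
    exact ⟨fun ⟨n, h, h'⟩ => ⟨n + 1, n, h, by omega, h'⟩, fun ⟨_, n, h, _, h'⟩ => ⟨n, h, h'⟩⟩
  have hmono : Monotone D := fun a b hab ω ⟨t, h1, h2, h3⟩ => ⟨t, h1, by omega, h3⟩
  rw [hU, hmono.measure_iUnion, ENNReal.mul_iSup]
  refine iSup_le fun n => ?_
  calc c * P (D n) ≤ c * P (D (n + 1)) := by gcongr; exact hmono (Nat.le_succ n)
    _ ≤ _ := le_self_add.trans (key (n + 1) (by omega))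

/-! ### The law of the observations -/

section Run

variable {K : ℕ} {Ω : Type*} [mΩ : MeasurableSpace Ω] {ν : Fin K → Measure ℝ} {p : Proportions}
  {ε : ℝ} {P : Measure Ω} {ℱ : Filtration ℕ mΩ} {I B C : ℕ → Ω → Fin K} {X : ℕ → Ω → ℝ}

/-- Given the past, on the event that arm `i` is pulled, the observation has law `ν i`. -/
lemma IsRun.measure_inter_obs [IsProbabilityMeasure P] (hν : IsInstance ν)
    (h : IsRun ν p ε P ℱ I B C X) {n : ℕ} (hn : 1 ≤ n) (i : Fin K) {D : Set Ω}
    (hD : MeasurableSet[ℱ n] D) {A : Set ℝ} (hA : MeasurableSet A) :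
    P (D ∩ {ω | I n ω = i} ∩ X n ⁻¹' A) = ν i A * P (D ∩ {ω | I n ω = i}) := by
  have := (hν i).1.1
  have hX : Measurable (X n) := (h.measurable_obs n hn).mono (ℱ.le _) le_rfl
  have hDi : MeasurableSet[ℱ n] (D ∩ {ω | I n ω = i}) :=
    @MeasurableSet.inter _ (ℱ n) _ _ hD
      (h.measurable_arm n hn (measurableSet_singleton i))
  have hXA : MeasurableSet (X n ⁻¹' A) := hX hA
  have h1 := setIntegral_condExp (ℱ.le n) (μ := P)
    (f := (X n ⁻¹' A).indicator (fun _ => (1 : ℝ)))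
    ((integrable_const (1 : ℝ)).indicator hXA) hDi
  rw [setIntegral_congr_ae (g := fun _ => (ν i).real A) (ℱ.le n _ hDi) (by
    filter_upwards [h.law_obs n hn A hA] with ω hω hωD
    rw [hω, hωD.2]), setIntegral_indicator hXA] at h1
  simp only [setIntegral_const, smul_eq_mul, mul_one] at h1
  have h2 : P.real (D ∩ {ω | I n ω = i} ∩ X n ⁻¹' A) =
    (ν i).real A * P.real (D ∩ {ω | I n ω = i}) := by rw [← h1, mul_comm]
  rw [measureReal_def, measureReal_def, measureReal_def, ← ENNReal.toReal_mul] at h2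
  exact (ENNReal.toReal_eq_toReal_iff' (measure_ne_top _ _)
    (ENNReal.mul_ne_top (measure_ne_top _ _) (measure_ne_top _ _))).1 h2

lemma IsRun.lintegral_mul_obs_eq [IsProbabilityMeasure P] (hν : IsInstance ν)
    (h : IsRun ν p ε P ℱ I B C X) {n : ℕ} (hn : 1 ≤ n) (i : Fin K) {Z : Ω → ℝ≥0∞}
    (hZ : Measurable[ℱ n] Z) {f : ℝ → ℝ≥0∞} (hf : Measurable f) :
    ∫⁻ ω in {ω | I n ω = i}, Z ω * f (X n ω) ∂P =
      (∫⁻ x, f x ∂(ν i)) * ∫⁻ ω in {ω | I n ω = i}, Z ω ∂P := by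
  have := (hν i).1.1
  have hX : Measurable (X n) := (h.measurable_obs n hn).mono (ℱ.le _) le_rfl
  have hZ' : Measurable Z := hZ.mono (ℱ.le n) le_rfl
  set E : Set Ω := {ω | I n ω = i}
  have hE : MeasurableSet E := ℱ.le n _ (h.measurable_arm n hn (measurableSet_singleton i))
  have key : ((P.restrict E).withDensity Z).map (X n) = (∫⁻ ω in E, Z ω ∂P) • ν i := by
    ext A hA
    have hXA : MeasurableSet (X n ⁻¹' A) := hX hA
    rw [Measure.map_apply hX hA, withDensity_apply _ hXA, Measure.smul_apply, smul_eq_mul,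
      Measure.restrict_restrict hXA]
    have ht : (P.restrict (X n ⁻¹' A ∩ E)).trim (ℱ.le n) =
        ν i A • (P.restrict E).trim (ℱ.le n) := by
      refine @Measure.ext _ (ℱ n) _ _ fun D hD => ?_
      rw [Measure.smul_apply, trim_measurableSet_eq _ hD, trim_measurableSet_eq _ hD,
        Measure.restrict_apply (ℱ.le n _ hD), Measure.restrict_apply (ℱ.le n _ hD), smul_eq_mul,
        ← h.measure_inter_obs hν hn i hD hA]
      congr 1
      ext ω; simp [E]; tauto
    rw [← lintegral_trim (ℱ.le n) hZ, ht, lintegral_smul_measure, lintegral_trim (ℱ.le n) hZ,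
      smul_eq_mul, mul_comm]
  calc ∫⁻ ω in E, Z ω * f (X n ω) ∂P
      = ∫⁻ ω, f (X n ω) ∂((P.restrict E).withDensity Z) := by
        exact (lintegral_withDensity_eq_lintegral_mul _ hZ' (hf.comp hX)).symm
    _ = ∫⁻ x, f x ∂(((P.restrict E).withDensity Z).map (X n)) := (lintegral_map hf hX).symm
    _ = _ := by rw [key, lintegral_smul_measure, smul_eq_mul, mul_comm]

/-- Multiplying an `ℱ n`-measurable weight by a function of the observation of round `n`, of
mean at most one under the law of each arm, does not increase the integral. -/
lemma IsRun.lintegral_mul_obs_le [IsProbabilityMeasure P] (hν : IsInstance ν)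
    (h : IsRun ν p ε P ℱ I B C X) {n : ℕ} (hn : 1 ≤ n) {Z : Ω → ℝ≥0∞}
    (hZ : Measurable[ℱ n] Z) {f : Fin K → ℝ → ℝ≥0∞} (hf : ∀ i, Measurable (f i))
    (hf1 : ∀ i, ∫⁻ x, f i x ∂(ν i) ≤ 1) :
    ∫⁻ ω, Z ω * f (I n ω) (X n ω) ∂P ≤ ∫⁻ ω, Z ω ∂P := by
  have hE : ∀ i, MeasurableSet {ω | I n ω = i} := fun i =>
    ℱ.le n _ (h.measurable_arm n hn (measurableSet_singleton i))
  have hU : (⋃ i ∈ (Finset.univ : Finset (Fin K)), {ω | I n ω = i}) = univ := by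
    ext ω; simp
  have hd : (↑(Finset.univ : Finset (Fin K)) : Set (Fin K)).PairwiseDisjoint
      (fun i => {ω | I n ω = i}) := by
    intro i _ j _ hij
    exact Set.disjoint_left.2 fun ω (h1 : I n ω = i) (h2 : I n ω = j) => hij (h1.symm.trans h2)
  rw [← setLIntegral_univ, ← setLIntegral_univ Z, ← hU,
    lintegral_biUnion_finset hd (fun i _ => hE i), lintegral_biUnion_finset hd (fun i _ => hE i)]
  refine Finset.sum_le_sum fun i _ => ?_
  calc ∫⁻ ω in {ω | I n ω = i}, Z ω * f (I n ω) (X n ω) ∂P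
      = ∫⁻ ω in {ω | I n ω = i}, Z ω * f i (X n ω) ∂P :=
        setLIntegral_congr_fun (hE i) (fun ω (hω : I n ω = i) => by simp only [hω])
    _ = (∫⁻ x, f i x ∂(ν i)) * ∫⁻ ω in {ω | I n ω = i}, Z ω ∂P :=
        h.lintegral_mul_obs_eq hν hn i hZ (hf i)
    _ ≤ 1 * ∫⁻ ω in {ω | I n ω = i}, Z ω ∂P := by gcongr; exact hf1 i
    _ = _ := one_mul _

/-! ### Time-uniform concentration for two arms -/

/-- Centred sum of the observations of arm `i` before round `n`. -/
noncomputable def centredSum (ν : Fin K → Measure ℝ) (I : ℕ → Ω → Fin K) (X : ℕ → Ω → ℝ) (n : ℕ)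
    (i : Fin K) (ω : Ω) : ℝ :=
  ∑ t ∈ (Finset.Ico 1 n).filter (fun t => I t ω = i), (X t ω - means ν i)

lemma numPulls_succ {Ω : Type*} (I : ℕ → Ω → Fin K) {n : ℕ} (hn : 1 ≤ n) (i : Fin K) (ω : Ω) :
    numPulls I (n + 1) i ω = numPulls I n i ω + if I n ω = i then 1 else 0 := by
  simp only [numPulls, Finset.card_filter]
  rw [Finset.sum_Ico_succ_top hn]

lemma centredSum_succ {Ω : Type*} (ν : Fin K → Measure ℝ) (I : ℕ → Ω → Fin K) (X : ℕ → Ω → ℝ)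
    {n : ℕ} (hn : 1 ≤ n) (i : Fin K) (ω : Ω) :
    centredSum ν I X (n + 1) i ω = centredSum ν I X n i ω +
      if I n ω = i then X n ω - means ν i else 0 := by
  simp only [centredSum, Finset.sum_filter]
  rw [Finset.sum_Ico_succ_top hn]

lemma numPulls_one {Ω : Type*} (I : ℕ → Ω → Fin K) (i : Fin K) (ω : Ω) :
    numPulls I 1 i ω = 0 := by simp [numPulls]

lemma centredSum_one {Ω : Type*} (ν : Fin K → Measure ℝ) (I : ℕ → Ω → Fin K) (X : ℕ → Ω → ℝ)
    (i : Fin K) (ω : Ω) : centredSum ν I X 1 i ω = 0 := by simp [centredSum]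

lemma centredSum_eq {Ω : Type*} (ν : Fin K → Measure ℝ) (I : ℕ → Ω → Fin K) (X : ℕ → Ω → ℝ)
    (n : ℕ) (i : Fin K) (ω : Ω) (hN : 1 ≤ numPulls I n i ω) :
    centredSum ν I X n i ω = numPulls I n i ω * (empMean I X n i ω - means ν i) := by
  have : (numPulls I n i ω : ℝ) ≠ 0 := by positivity
  rw [centredSum, Finset.sum_sub_distrib, empMean, mul_sub, mul_div_cancel₀ _ this]
  simp [numPulls]

lemma IsRun.measurable_numPulls (h : IsRun ν p ε P ℱ I B C X) {n : ℕ} (hn : 1 ≤ n) (i : Fin K) :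
    Measurable[ℱ n] (fun ω => (numPulls I n i ω : ℝ)) := by
  induction n, hn using Nat.le_induction with
  | base => simp only [numPulls_one]; exact measurable_const
  | succ n hn ih =>
    have e : (fun ω => (numPulls I (n + 1) i ω : ℝ)) = fun ω => (numPulls I n i ω : ℝ) +
        if I n ω = i then 1 else 0 := by
      funext ω; rw [numPulls_succ I hn]; push_cast; rfl
    rw [e]
    refine (ih.mono (ℱ.mono n.le_succ) le_rfl).add ?_
    exact Measurable.ite (ℱ.mono n.le_succ _ (h.measurable_arm n hn (measurableSet_singleton i)))
      measurable_const measurable_const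

lemma IsRun.measurable_centredSum (h : IsRun ν p ε P ℱ I B C X) {n : ℕ} (hn : 1 ≤ n)
    (i : Fin K) : Measurable[ℱ n] (fun ω => centredSum ν I X n i ω) := by
  induction n, hn using Nat.le_induction with
  | base => simp only [centredSum_one]; exact measurable_const
  | succ n hn ih =>
    simp only [centredSum_succ ν I X hn]
    refine (ih.mono (ℱ.mono n.le_succ) le_rfl).add ?_
    exact Measurable.ite (ℱ.mono n.le_succ _ (h.measurable_arm n hn (measurableSet_singleton i)))
      ((h.measurable_obs n hn).sub_const _) measurable_const

lemma IsOneSubGaussian.lintegral_exp_le {κ : Measure ℝ} (hκ : IsOneSubGaussian κ) (a : ℝ) :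
    ∫⁻ x, ENNReal.ofReal (Real.exp (a * (x - ∫ y, y ∂κ) - a ^ 2 / 2)) ∂κ ≤ 1 := by
  have e : ∀ x, Real.exp (a * (x - ∫ y, y ∂κ) - a ^ 2 / 2) =
      Real.exp (a * (x - ∫ y, y ∂κ)) * Real.exp (-(a ^ 2 / 2)) := fun x => by
    rw [← Real.exp_add]; rfl
  rw [← ofReal_integral_eq_lintegral_ofReal _ (Eventually.of_forall fun _ => (Real.exp_pos _).le)]
  · rw [← ENNReal.ofReal_one]
    apply ENNReal.ofReal_le_ofReal
    simp_rw [e]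
    rw [integral_mul_const]
    have := hκ.2.mgf_le a
    rw [mgf] at this
    calc _ ≤ Real.exp (a ^ 2 / 2) * Real.exp (-(a ^ 2 / 2)) := by
          gcongr; simpa using this
      _ = 1 := by rw [← Real.exp_add]; simp
  · simp_rw [e]
    exact (hκ.2.integrable_exp_mul a).mul_const _

/-- The exponential supermartingale of the two arms `i` and `j`. -/
noncomputable def twoArm (ν : Fin K → Measure ℝ) (I : ℕ → Ω → Fin K) (X : ℕ → Ω → ℝ)
    (i j : Fin K) (n : ℕ) (q : ℝ × ℝ) (ω : Ω) : ℝ≥0∞ :=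
  ENNReal.ofReal (Real.exp (q.1 * centredSum ν I X n i ω - q.1 ^ 2 * numPulls I n i ω / 2)) *
  ENNReal.ofReal (Real.exp (q.2 * centredSum ν I X n j ω - q.2 ^ 2 * numPulls I n j ω / 2))

lemma IsRun.twoArm_step [IsProbabilityMeasure P] (hν : IsInstance ν)
    (h : IsRun ν p ε P ℱ I B C X) {i j : Fin K} (hij : i ≠ j) {n : ℕ} (hn : 1 ≤ n) (q : ℝ × ℝ)
    {A : Set Ω} (hA : MeasurableSet[ℱ n] A) :
    ∫⁻ ω in A, twoArm ν I X i j (n + 1) q ω ∂P ≤ ∫⁻ ω in A, twoArm ν I X i j n q ω ∂P := by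
  classical
  set f : Fin K → ℝ → ℝ≥0∞ := fun k x =>
    if k = i then ENNReal.ofReal (Real.exp (q.1 * (x - ∫ y, y ∂(ν i)) - q.1 ^ 2 / 2))
    else if k = j then ENNReal.ofReal (Real.exp (q.2 * (x - ∫ y, y ∂(ν j)) - q.2 ^ 2 / 2))
    else 1 with hfdef
  have hf : ∀ k, Measurable (f k) := by
    intro k
    simp only [hfdef]
    split_ifs <;> fun_prop
  have hf1 : ∀ k, ∫⁻ x, f k x ∂(ν k) ≤ 1 := by
    intro k
    have := (hν k).1.1
    by_cases h1 : k = i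
    · subst h1; simpa [hfdef] using (hν k).1.lintegral_exp_le q.1
    by_cases h2 : k = j
    · subst h2; simpa [hfdef, h1] using (hν k).1.lintegral_exp_le q.2
    simp [hfdef, h1, h2]
  have hZ : Measurable[ℱ n] (A.indicator (twoArm ν I X i j n q)) := by
    refine Measurable.indicator ?_ hA
    have a1 := h.measurable_numPulls hn i
    have a2 := h.measurable_numPulls hn j
    have a3 := h.measurable_centredSum hn i
    have a4 := h.measurable_centredSum hn j
    unfold twoArm
    fun_prop
  have hle := h.lintegral_mul_obs_le hν hn hZ hf hf1
  have e : ∀ ω, A.indicator (twoArm ν I X i j n q) ω * f (I n ω) (X n ω) =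
      A.indicator (twoArm ν I X i j (n + 1) q) ω := by
    intro ω
    by_cases hω : ω ∈ A
    · simp only [indicator_of_mem hω, twoArm, hfdef, numPulls_succ I hn, centredSum_succ ν I X hn]
      rw [← ENNReal.ofReal_mul (Real.exp_pos _).le, ← ENNReal.ofReal_mul (Real.exp_pos _).le,
        ← Real.exp_add, ← Real.exp_add]
      by_cases h1 : I n ω = i
      · have h2 : I n ω ≠ j := h1 ▸ hij
        simp only [h1, if_true, hij, if_false]
        rw [← ENNReal.ofReal_mul (Real.exp_pos _).le, ← Real.exp_add]
        congr 2
        simp only [means]; push_cast; ring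
      · by_cases h2 : I n ω = j
        · have h3 : j ≠ i := hij.symm
          simp only [h2, if_true, h3, if_false]
          rw [← ENNReal.ofReal_mul (Real.exp_pos _).le, ← Real.exp_add]
          congr 2
          simp only [means]; push_cast; ring
        · simp [h1, h2]
    · simp [hω]
  simp_rw [e] at hle
  rwa [lintegral_indicator (ℱ.le n _ hA), lintegral_indicator (ℱ.le n _ hA)] at hle

/-- The logarithmically corrected self-normalised deviation of an empirical mean. -/
noncomputable def deviation (ν : Fin K → Measure ℝ) (I : ℕ → Ω → Fin K) (X : ℕ → Ω → ℝ) (n : ℕ)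
    (i : Fin K) (ω : Ω) : ℝ :=
  numPulls I n i ω * (empMean I X n i ω - means ν i) ^ 2 / 2
    - 2 * Real.log (4 + Real.log (numPulls I n i ω))

lemma numPulls_mono {Ω : Type*} (I : ℕ → Ω → Fin K) (i : Fin K) (ω : Ω) {m n : ℕ} (h : m ≤ n) :
    numPulls I m i ω ≤ numPulls I n i ω :=
  Finset.card_le_card (Finset.filter_subset_filter _ (Finset.Ico_subset_Ico_right h))

lemma IsRun.one_le_numPulls (h : IsRun ν p ε P ℱ I B C X) {n : ℕ} (hn : K < n) (i : Fin K)
    (ω : Ω) : 1 ≤ numPulls I n i ω := by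
  rw [← h.init i ω]
  exact numPulls_mono I i ω hn

/-- Ville's inequality for the mixture of the two-arm supermartingales. -/
lemma IsRun.concentration [IsProbabilityMeasure P] (hν : IsInstance ν)
    (h : IsRun ν p ε P ℱ I B C X) {i j : Fin K} (hij : i ≠ j) {l : ℝ}
    (hl : l ∈ Ioo (1 / 2 : ℝ) 1) (x : ℝ) :
    P {ω | ∃ n, K < n ∧ 2 * gG l + x ≤ l * (deviation ν I X n i ω + deviation ν I X n j ω)} ≤
      ENNReal.ofReal (Real.exp (-x)) := by
  have := isProbabilityMeasure_mixPrior hl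
  set π := (mixPrior l).prod (mixPrior l)
  set M : ℕ → Ω → ℝ≥0∞ := fun n ω => ∫⁻ q, twoArm ν I X i j n q ω ∂π with hM
  have hjoint : ∀ n, 1 ≤ n → Measurable[inferInstance, inferInstance]
      (fun z : (ℝ × ℝ) × Ω => twoArm ν I X i j n z.1 z.2) := by
    intro n hn
    have a1 : Measurable (fun ω => (numPulls I n i ω : ℝ)) :=
      (h.measurable_numPulls hn i).mono (ℱ.le n) le_rfl
    have a2 : Measurable (fun ω => (numPulls I n j ω : ℝ)) :=
      (h.measurable_numPulls hn j).mono (ℱ.le n) le_rfl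
    have a3 : Measurable (fun ω => centredSum ν I X n i ω) :=
      (h.measurable_centredSum hn i).mono (ℱ.le n) le_rfl
    have a4 : Measurable (fun ω => centredSum ν I X n j ω) :=
      (h.measurable_centredSum hn j).mono (ℱ.le n) le_rfl
    have b1 := a1.comp (measurable_snd : Measurable (Prod.snd : (ℝ × ℝ) × Ω → Ω))
    have b2 := a2.comp (measurable_snd : Measurable (Prod.snd : (ℝ × ℝ) × Ω → Ω))
    have b3 := a3.comp (measurable_snd : Measurable (Prod.snd : (ℝ × ℝ) × Ω → Ω))
    have b4 := a4.comp (measurable_snd : Measurable (Prod.snd : (ℝ × ℝ) × Ω → Ω))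
    simp only [Function.comp_def] at b1 b2 b3 b4
    unfold twoArm
    fun_prop
  have hprod : ∀ n ω, M n ω =
      (∫⁻ a, ENNReal.ofReal (Real.exp (a * centredSum ν I X n i ω -
        a ^ 2 * numPulls I n i ω / 2)) ∂(mixPrior l)) *
      ∫⁻ a, ENNReal.ofReal (Real.exp (a * centredSum ν I X n j ω -
        a ^ 2 * numPulls I n j ω / 2)) ∂(mixPrior l) := by
    intro n ω
    exact lintegral_prod_mul (μ := mixPrior l) (ν := mixPrior l)
      (f := fun a => ENNReal.ofReal (Real.exp (a * centredSum ν I X n i ω -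
        a ^ 2 * numPulls I n i ω / 2)))
      (g := fun a => ENNReal.ofReal (Real.exp (a * centredSum ν I X n j ω -
        a ^ 2 * numPulls I n j ω / 2)))
      (Measurable.aemeasurable (by fun_prop)) (Measurable.aemeasurable (by fun_prop))
  have hMm : ∀ n, 1 ≤ n → Measurable[ℱ n] (M n) := by
    intro n hn
    have a1 := h.measurable_numPulls hn i
    have a2 := h.measurable_numPulls hn j
    have a3 := h.measurable_centredSum hn i
    have a4 := h.measurable_centredSum hn j
    have a1' : @Measurable (Ω × ℝ × ℝ) ℝ (@Prod.instMeasurableSpace _ _ (ℱ n) _) _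
      (fun z => (numPulls I n i z.1 : ℝ)) := a1.comp (@measurable_fst _ _ (ℱ n) _)
    have a2' : @Measurable (Ω × ℝ × ℝ) ℝ (@Prod.instMeasurableSpace _ _ (ℱ n) _) _
      (fun z => (numPulls I n j z.1 : ℝ)) := a2.comp (@measurable_fst _ _ (ℱ n) _)
    have a3' : @Measurable (Ω × ℝ × ℝ) ℝ (@Prod.instMeasurableSpace _ _ (ℱ n) _) _
      (fun z => centredSum ν I X n i z.1) := a3.comp (@measurable_fst _ _ (ℱ n) _)
    have a4' : @Measurable (Ω × ℝ × ℝ) ℝ (@Prod.instMeasurableSpace _ _ (ℱ n) _) _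
      (fun z => centredSum ν I X n j z.1) := a4.comp (@measurable_fst _ _ (ℱ n) _)
    have b : @Measurable (Ω × ℝ × ℝ) (ℝ × ℝ) (@Prod.instMeasurableSpace _ _ (ℱ n) _) _
      (fun z => z.2) := @measurable_snd _ _ (ℱ n) _
    refine @Measurable.lintegral_prod_right' _ _ (ℱ n) _ π _
      (fun z : Ω × ℝ × ℝ => twoArm ν I X i j n z.2 z.1) ?_
    unfold twoArm
    fun_prop
  have hstep : ∀ n, 1 ≤ n → ∀ A, MeasurableSet[ℱ n] A →
      ∫⁻ ω in A, M (n + 1) ω ∂P ≤ ∫⁻ ω in A, M n ω ∂P := by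
    intro n hn A hA
    have hs : ∀ n, 1 ≤ n → ∫⁻ ω in A, M n ω ∂P =
        ∫⁻ q, ∫⁻ ω in A, twoArm ν I X i j n q ω ∂P ∂π := by
      intro n hn
      refine lintegral_lintegral_swap ?_
      exact ((hjoint n hn).comp measurable_swap).aemeasurable
    rw [hs n hn, hs (n + 1) (by omega)]
    exact lintegral_mono fun q => h.twoArm_step hν hij hn q hA
  have hone : ∫⁻ ω, M 1 ω ∂P ≤ 1 := by
    simp [hM, twoArm, centredSum_one, numPulls_one]
  have hv := ville hMm hstep hone (ENNReal.ofReal (Real.exp x))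
  have hsub : {ω | ∃ n, K < n ∧ 2 * gG l + x ≤
      l * (deviation ν I X n i ω + deviation ν I X n j ω)} ⊆
      {ω | ∃ n, 1 ≤ n ∧ ENNReal.ofReal (Real.exp x) ≤ M n ω} := by
    rintro ω ⟨n, hn, hle⟩
    refine ⟨n, by omega, ?_⟩
    rw [hprod]
    have hdev : ∀ k, centredSum ν I X n k ω ^ 2 / (2 * numPulls I n k ω) -
        2 * Real.log (4 + Real.log (numPulls I n k ω)) = deviation ν I X n k ω := by
      intro k
      have hN := h.one_le_numPulls hn k ω
      have : (numPulls I n k ω : ℝ) ≠ 0 := by positivity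
      rw [centredSum_eq ν I X n k ω hN, deviation]
      field_simp
    refine le_trans ?_ (mul_le_mul'
      (exp_le_lintegral_mixPrior hl (centredSum ν I X n i ω) (h.one_le_numPulls hn i ω))
      (exp_le_lintegral_mixPrior hl (centredSum ν I X n j ω) (h.one_le_numPulls hn j ω)))
    rw [hdev, hdev, ← ENNReal.ofReal_mul (Real.exp_pos _).le, ← Real.exp_add]
    apply ENNReal.ofReal_le_ofReal
    apply Real.exp_le_exp.2
    linarith
  have hv2 := (mul_le_mul_right (measure_mono (μ := P) hsub) _).trans hv
  rw [Real.exp_neg, ENNReal.ofReal_inv_of_pos (Real.exp_pos _)]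
  rwa [ENNReal.le_inv_iff_mul_le, mul_comm]

end Run

/-! ### The recommendation is correct with probability at least `1 - δ` -/

section Error

variable {K : ℕ} {Ω : Type*} [mΩ : MeasurableSpace Ω] {ν : Fin K → Measure ℝ} {p : Proportions}
  {ε : ℝ} {P : Measure Ω} {ℱ : Filtration ℕ mΩ} {I B C : ℕ → Ω → Fin K} {X : ℕ → Ω → ℝ}

lemma sum_numPulls {Ω : Type*} (I : ℕ → Ω → Fin K) (n : ℕ) (ω : Ω) :
    ∑ i, numPulls I n i ω = n - 1 := by
  have := Finset.card_eq_sum_card_fiberwise (f := fun t => I t ω) (s := Finset.Ico 1 n)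
    (t := Finset.univ) (fun _ _ => Finset.mem_coe.2 (Finset.mem_univ _))
  rw [Nat.card_Ico] at this
  exact this.symm

lemma numPulls_le {Ω : Type*} (I : ℕ → Ω → Fin K) (n : ℕ) (i : Fin K) (ω : Ω) :
    numPulls I n i ω ≤ n - 1 := by
  rw [← sum_numPulls I n ω]
  exact Finset.single_le_sum (f := fun j => numPulls I n j ω) (fun _ _ => Nat.zero_le _)
    (Finset.mem_univ i)

lemma numPulls_add_le {Ω : Type*} (I : ℕ → Ω → Fin K) (n : ℕ) (ω : Ω) {i j : Fin K}
    (hij : i ≠ j) : numPulls I n i ω + numPulls I n j ω ≤ n - 1 := by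
  rw [← sum_numPulls I n ω, ← Finset.sum_pair (f := fun i => numPulls I n i ω) hij]
  exact Finset.sum_le_sum_of_subset (Finset.subset_univ _)

lemma exists_eq_muStar (hK : 0 < K) (μ : Fin K → ℝ) : ∃ i, μ i = muStar μ := by
  have : Nonempty (Fin K) := ⟨⟨0, hK⟩⟩
  exact exists_eq_ciSup_of_finite

lemma le_muStar (μ : Fin K → ℝ) (i : Fin K) : μ i ≤ muStar μ :=
  le_ciSup (Set.finite_range μ).bddAbove i

/-- Concavity of the logarithm merges the corrections of the two arms into the one of the
threshold. -/
lemma log_correction_le {a b n : ℕ} (ha : 1 ≤ a) (hb : 1 ≤ b) (hab : a + b ≤ n) :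
    2 * Real.log (4 + Real.log a) + 2 * Real.log (4 + Real.log b) ≤
      4 * Real.log (4 + Real.log ((n : ℝ) / 2)) := by
  have ha1 : (1 : ℝ) ≤ a := by exact_mod_cast ha
  have hb1 : (1 : ℝ) ≤ b := by exact_mod_cast hb
  have hn : (a : ℝ) + b ≤ n := by exact_mod_cast hab
  have la := Real.log_nonneg ha1
  have lb := Real.log_nonneg hb1
  have h1 : Real.log a + Real.log b ≤ 2 * Real.log ((n : ℝ) / 2) := by
    rw [← Real.log_mul (by positivity) (by positivity),
      show 2 * Real.log ((n : ℝ) / 2) = Real.log (((n : ℝ) / 2) ^ 2) by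
        rw [Real.log_pow]; norm_num]
    apply Real.log_le_log (by positivity)
    nlinarith [sq_nonneg ((a : ℝ) - b)]
  have h2 : Real.log (4 + Real.log a) + Real.log (4 + Real.log b) ≤
      2 * Real.log (4 + Real.log ((n : ℝ) / 2)) := by
    rw [← Real.log_mul (by positivity) (by positivity),
      show 2 * Real.log (4 + Real.log ((n : ℝ) / 2)) =
        Real.log ((4 + Real.log ((n : ℝ) / 2)) ^ 2) by rw [Real.log_pow]; norm_num]
    apply Real.log_le_log (by positivity)
    nlinarith [sq_nonneg (Real.log a - Real.log b)]
  linarith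

/-- When a wrong arm is recommended, the transportation cost against the best arm is explained
by the deviations of two empirical means only (Cauchy-Schwarz inequality). -/
lemma sum_sq_ge_of_cost_ge {a b x y mx my r T : ℝ} (ha : 0 < a) (hb : 0 < b) (hT : 0 ≤ T)
    (hneg : mx - r * my < 0)
    (hcost : Real.sqrt T ≤ (x - r * y) / Real.sqrt (1 / a + r ^ 2 / b)) :
    T ≤ a * (x - mx) ^ 2 + b * (y - my) ^ 2 := by
  have hD : 0 < 1 / a + r ^ 2 / b := by positivity
  rw [le_div_iff₀ (Real.sqrt_pos.2 hD), ← Real.sqrt_mul hT] at hcost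
  have h1 : Real.sqrt (T * (1 / a + r ^ 2 / b)) ≤ (x - mx) - r * (y - my) := by linarith
  have h2 := Real.sqrt_le_left ((Real.sqrt_nonneg _).trans h1) |>.1 h1
  have h3 : ((x - mx) - r * (y - my)) ^ 2 ≤
      (a * (x - mx) ^ 2 + b * (y - my) ^ 2) * (1 / a + r ^ 2 / b) := by
    have : (a * (x - mx) ^ 2 + b * (y - my) ^ 2) * (1 / a + r ^ 2 / b) -
        ((x - mx) - r * (y - my)) ^ 2 = (r * a * (x - mx) + b * (y - my)) ^ 2 / (a * b) := by
      field_simp; ring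
    have : 0 ≤ (r * a * (x - mx) + b * (y - my)) ^ 2 / (a * b) := by positivity
    linarith
  exact le_of_mul_le_mul_right (h2.trans h3) hD

lemma IsRun.errorEvent_subset (hν : IsInstance ν) (hε : ε ∈ Ioo (0 : ℝ) 1)
    (h : IsRun ν p ε P ℱ I B C X) {s : Fin K} (hs : means ν s = muStar (means ν)) (δ : ℝ) :
    errorEvent ν ε δ I B X ⊆ ⋃ i ∈ Finset.univ.erase s, {ω | ∃ n, K < n ∧
      2 * CG (Real.log (((K : ℝ) - 1) / δ) / 2) ≤
        deviation ν I X n i ω + deviation ν I X n s ω} := by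
  rintro ω ⟨n, hn, hbad⟩
  have hne : ((fun n : ℕ => (n : ℕ∞)) '' {n : ℕ | K < n ∧ ∀ j, j ≠ B n ω →
    Real.sqrt (2 * threshold K (n - 1) δ) ≤ cost ε I X n (B n ω) j ω}).Nonempty := by
    by_contra hcon
    rw [Set.not_nonempty_iff_eq_empty] at hcon
    rw [stoppingTime, hcon, sInf_empty] at hn
    exact ENat.top_ne_natCast n hn
  have hmem := csInf_mem hne
  rw [stoppingTime] at hn
  rw [hn] at hmem
  obtain ⟨m, ⟨hm, hreach⟩, hmn⟩ := hmem
  have hmn' : m = n := by simpa using hmn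
  subst hmn'
  have hlt : means ν (B m ω) - (1 - ε) * means ν s < 0 := by
    simp only [goodArms, mem_ofPred_eq, not_le] at hbad
    rw [hs]; linarith
  have hBs : s ≠ B m ω := by
    intro hcon
    have := (hν s).2
    rw [← hcon] at hlt
    nlinarith [hε.1]
  simp only [mem_iUnion]
  refine ⟨B m ω, Finset.mem_erase.2 ⟨hBs.symm, Finset.mem_univ _⟩, m, hm, ?_⟩
  have hNi := h.one_le_numPulls hm (B m ω) ω
  have hNs := h.one_le_numPulls hm s ω
  have hlog := log_correction_le hNi hNs (numPulls_add_le I m ω hBs.symm)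
  have hsum : 2 * threshold K (m - 1) δ ≤
      numPulls I m (B m ω) ω * (empMean I X m (B m ω) ω - means ν (B m ω)) ^ 2 +
      numPulls I m s ω * (empMean I X m s ω - means ν s) ^ 2 := by
    rcases le_total 0 (2 * threshold K (m - 1) δ) with hT | hT
    · exact sum_sq_ge_of_cost_ge (by exact_mod_cast hNi) (by exact_mod_cast hNs) hT hlt
        (hreach s hBs)
    · exact hT.trans (by positivity)
  rw [threshold] at hsum
  simp only [deviation]
  linarith

lemma IsRun.measure_errorEvent_le [IsProbabilityMeasure P] (hK : 2 ≤ K) (hν : IsInstance ν)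
    (hε : ε ∈ Ioo (0 : ℝ) 1) (h : IsRun ν p ε P ℱ I B C X) {δ : ℝ} (hδ : δ ∈ Ioo (0 : ℝ) 1) :
    P (errorEvent ν ε δ I B X) ≤ ENNReal.ofReal δ := by
  obtain ⟨s, hs⟩ := exists_eq_muStar (by omega) (means ν)
  have hK1 : (1 : ℝ) ≤ (K : ℝ) - 1 := by
    have : (2 : ℝ) ≤ K := by exact_mod_cast hK
    linarith
  set x := Real.log (((K : ℝ) - 1) / δ) with hx
  have harm : ∀ i ∈ Finset.univ.erase s, P {ω | ∃ n, K < n ∧ 2 * CG (x / 2) ≤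
        deviation ν I X n i ω + deviation ν I X n s ω} ≤ ENNReal.ofReal (Real.exp (-x)) := by
    intro i hi
    have his : i ≠ s := (Finset.mem_erase.1 hi).1
    -- the infimum defining `CG` need not be attained: take `y < x` and let `y` tend to `x`
    have hy : ∀ y < x, P {ω | ∃ n, K < n ∧ 2 * CG (x / 2) ≤
        deviation ν I X n i ω + deviation ν I X n s ω} ≤ ENNReal.ofReal (Real.exp (-y)) := by
      intro y hy
      obtain ⟨l, hl, hlt⟩ := exists_lt_of_CG_lt
        (show CG (x / 2) < CG (x / 2) + (x - y) / 2 by linarith)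
      refine (measure_mono ?_).trans (h.concentration hν his hl y)
      rintro ω ⟨n, hn, hle⟩
      refine ⟨n, hn, ?_⟩
      obtain ⟨hl1, hl2⟩ := hl
      rw [div_lt_iff₀ (by linarith)] at hlt
      nlinarith
    have ht : Tendsto (fun y : ℝ => ENNReal.ofReal (Real.exp (-y))) (𝓝[<] x)
        (𝓝 (ENNReal.ofReal (Real.exp (-x)))) :=
      ((ENNReal.continuous_ofReal.comp (by fun_prop)).tendsto x).mono_left nhdsWithin_le_nhds
    exact ge_of_tendsto ht (by filter_upwards [self_mem_nhdsWithin] with y h using hy y h)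
  calc P (errorEvent ν ε δ I B X)
      ≤ ∑ i ∈ Finset.univ.erase s, P {ω | ∃ n, K < n ∧ 2 * CG (x / 2) ≤
        deviation ν I X n i ω + deviation ν I X n s ω} :=
        (measure_mono (h.errorEvent_subset hν hε hs δ)).trans (measure_biUnion_finset_le _ _)
    _ ≤ ∑ i ∈ Finset.univ.erase s, ENNReal.ofReal (Real.exp (-x)) := Finset.sum_le_sum harm
    _ = ENNReal.ofReal (((K : ℝ) - 1) * Real.exp (-x)) := by
        rw [Finset.sum_const, Finset.card_erase_of_mem (Finset.mem_univ _), Finset.card_univ,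
          Fintype.card_fin, nsmul_eq_mul, ENNReal.ofReal_mul (by linarith)]
        congr 1
        rw [← ENNReal.ofReal_natCast, Nat.cast_sub (by omega)]
        simp
    _ = ENNReal.ofReal δ := by
        congr 1
        have := hδ.1
        rw [hx, Real.exp_neg, Real.exp_log (by positivity)]
        have : (K : ℝ) - 1 ≠ 0 := by linarith
        field_simp

end Error

/-! ### Tracking of the proportions -/

section Path

variable {K : ℕ} {Ω : Type*} [mΩ : MeasurableSpace Ω] {ν : Fin K → Measure ℝ} {p : Proportions}
  {ε : ℝ} {P : Measure Ω} {ℱ : Filtration ℕ mΩ} {I B C : ℕ → Ω → Fin K} {X : ℕ → Ω → ℝ}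

/-- The proportion `β_t(i,j)` which the algorithm averages: the IDS one, or the constant `β`. -/
noncomputable def propBeta {Ω : Type*} (p : Proportions) (ε : ℝ) (I : ℕ → Ω → Fin K) (t : ℕ)
    (i j : Fin K) (ω : Ω) : ℝ :=
  match p with
  | .ids => idsBeta ε I t i j ω
  | .fixed β => β

lemma propBeta_mem {Ω : Type*} (hp : p.Valid) (I : ℕ → Ω → Fin K) (t : ℕ) (i j : Fin K)
    (ω : Ω) : propBeta p ε I t i j ω ∈ Icc (0 : ℝ) 1 := by
  cases p with
  | ids =>
    simp only [propBeta, idsBeta]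
    refine ⟨by positivity, div_le_one_of_le₀ ?_ (by positivity)⟩
    have : 0 ≤ (1 - ε) ^ 2 * (numPulls I t i ω : ℝ) := by positivity
    linarith
  | fixed β => exact ⟨hp.1.le, hp.2.le⟩

/-- A lower bound for the rate at which a pair allocates pulls to its less pulled arm. -/
noncomputable def minRate (p : Proportions) (ε : ℝ) : ℝ :=
  match p with
  | .ids => (1 - ε) ^ 2 / 2
  | .fixed β => min β (1 - β)

lemma minRate_pos (hp : p.Valid) (hε : ε ∈ Ioo (0 : ℝ) 1) : 0 < minRate p ε := by
  cases p with
  | ids =>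
    have : 0 < 1 - ε := by linarith [hε.2]
    simp only [minRate]; positivity
  | fixed β => exact lt_min hp.1 (by linarith [hp.2])

lemma betaBar_mul_pairCount {Ω : Type*} (p : Proportions) (ε : ℝ) (I B C : ℕ → Ω → Fin K)
    (n : ℕ) (i j : Fin K) (ω : Ω) :
    betaBar p ε I B C n i j ω * pairCount B C n i j ω =
      ∑ t ∈ pairRounds B C n i j ω, propBeta p ε I t i j ω := by
  cases p with
  | fixed β => simp [betaBar, propBeta, pairCount, mul_comm]
  | ids =>
    simp only [betaBar, propBeta]
    by_cases h : pairCount B C n i j ω = 0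
    · have h' : pairRounds B C n i j ω = ∅ := Finset.card_eq_zero.1 h
      simp [h']
    · have : (pairCount B C n i j ω : ℝ) ≠ 0 := by exact_mod_cast h
      field_simp

lemma sum_pairRounds_succ {Ω : Type*} (B C : ℕ → Ω → Fin K) {n : ℕ} (hn : K < n) (i j : Fin K)
    (ω : Ω) (f : ℕ → ℝ) :
    ∑ t ∈ pairRounds B C (n + 1) i j ω, f t = ∑ t ∈ pairRounds B C n i j ω, f t +
      if B n ω = i ∧ C n ω = j then f n else 0 := by
  simp only [pairRounds, Finset.sum_filter]
  rw [Finset.sum_Ico_succ_top hn]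

lemma pairRounds_init {Ω : Type*} (B C : ℕ → Ω → Fin K) (i j : Fin K) (ω : Ω) :
    pairRounds B C (K + 1) i j ω = ∅ := by simp [pairRounds]

lemma pairCount_eq_sum {Ω : Type*} (B C : ℕ → Ω → Fin K) (n : ℕ) (i j : Fin K) (ω : Ω) :
    (pairCount B C n i j ω : ℝ) = ∑ _t ∈ pairRounds B C n i j ω, (1 : ℝ) := by
  simp [pairCount]

lemma challengerPulls_eq_sum {Ω : Type*} (I B C : ℕ → Ω → Fin K) (n : ℕ) (i j : Fin K) (ω : Ω) :
    (challengerPulls I B C n i j ω : ℝ) =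
      ∑ t ∈ pairRounds B C n i j ω, if I t ω = j then (1 : ℝ) else 0 := by
  simp [challengerPulls]

lemma IsRun.arm_eq_or (h : IsRun ν p ε P ℱ I B C X) {n : ℕ} (hn : K < n) (ω : Ω) :
    I n ω = B n ω ∨ I n ω = C n ω := by
  rw [h.arm n hn ω]
  split_ifs <;> simp

/-- Tracking: the number of pulls of the challenger in the rounds of a pair exceeds its target by
at least `0` and at most `1`. -/
lemma IsRun.tracking (h : IsRun ν p ε P ℱ I B C X) (hp : p.Valid) {n : ℕ} (hn : K + 1 ≤ n)
    (i j : Fin K) (ω : Ω) :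
    ∑ t ∈ pairRounds B C n i j ω, (1 - propBeta p ε I t i j ω) ≤
      challengerPulls I B C n i j ω ∧
    (challengerPulls I B C n i j ω : ℝ) ≤
      ∑ t ∈ pairRounds B C n i j ω, (1 - propBeta p ε I t i j ω) + 1 := by
  induction n, hn using Nat.le_induction with
  | base => simp [challengerPulls_eq_sum, pairRounds_init]
  | succ n hn ih =>
    have hKn : K < n := hn
    rw [challengerPulls_eq_sum] at ih ⊢
    rw [sum_pairRounds_succ B C hKn, sum_pairRounds_succ B C hKn]
    by_cases hpair : B n ω = i ∧ C n ω = j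
    · have hβ := propBeta_mem (ε := ε) hp I n i j ω
      have harm := h.arm n hKn ω
      have hne := h.challenger_ne n hKn ω
      rw [hpair.1, hpair.2] at harm hne
      have htarget : (1 - betaBar p ε I B C (n + 1) i j ω) * (pairCount B C (n + 1) i j ω : ℝ) =
          ∑ t ∈ pairRounds B C n i j ω, (1 - propBeta p ε I t i j ω) +
            (1 - propBeta p ε I n i j ω) := by
        rw [sub_mul, one_mul, betaBar_mul_pairCount, pairCount_eq_sum, ← Finset.sum_sub_distrib,
          sum_pairRounds_succ B C hKn, if_pos hpair]
      rw [htarget, challengerPulls_eq_sum] at harm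
      simp only [hpair, and_self, if_true]
      by_cases hle : (∑ t ∈ pairRounds B C n i j ω, if I t ω = j then (1 : ℝ) else 0) ≤
          ∑ t ∈ pairRounds B C n i j ω, (1 - propBeta p ε I t i j ω) +
            (1 - propBeta p ε I n i j ω)
      · rw [if_pos hle] at harm
        rw [if_pos harm]
        constructor <;> linarith [hβ.1, hβ.2]
      · rw [if_neg hle] at harm
        rw [if_neg (by rw [harm]; exact hne.symm)]
        push Not at hle
        constructor <;> linarith [hβ.1, hβ.2]
    · simp only [hpair, if_false, add_zero]
      exact ih

lemma challengerPulls_le_numPulls {Ω : Type*} (I B C : ℕ → Ω → Fin K) (n : ℕ) (i j : Fin K)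
    (ω : Ω) : challengerPulls I B C n i j ω ≤ numPulls I n j ω := by
  refine Finset.card_le_card fun t ht => ?_
  simp only [pairRounds, Finset.mem_filter, Finset.mem_Ico] at ht ⊢
  exact ⟨⟨by omega, ht.1.1.2⟩, ht.2⟩

lemma IsRun.pairCount_le (h : IsRun ν p ε P ℱ I B C X) (n : ℕ) (i j : Fin K) (ω : Ω) :
    pairCount B C n i j ω ≤ challengerPulls I B C n i j ω + numPulls I n i ω := by
  rw [pairCount, challengerPulls,
    ← Finset.card_filter_add_card_filter_not (s := pairRounds B C n i j ω) (fun t => I t ω = j)]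
  refine Nat.add_le_add_left (Finset.card_le_card fun t ht => ?_) _
  simp only [pairRounds, Finset.mem_filter, Finset.mem_Ico] at ht ⊢
  refine ⟨⟨by omega, ht.1.1.2⟩, ?_⟩
  rcases h.arm_eq_or (show K < t by omega) ω with h1 | h1
  · exact h1.trans ht.1.2.1
  · exact absurd (h1.trans ht.1.2.2) ht.2

/-- A pair gives its leader a bounded weight as long as the leader is rarely pulled. -/
lemma IsRun.sum_beta_le (h : IsRun ν p ε P ℱ I B C X) (hp : p.Valid) {L : ℝ} (hL : 0 ≤ L) {n : ℕ}
    (hn : K + 1 ≤ n) (i j : Fin K) (ω : Ω) :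
    ∑ t ∈ pairRounds B C n i j ω,
      (if (numPulls I t i ω : ℝ) ≤ L then propBeta p ε I t i j ω else 0) ≤ L + 2 := by
  induction n, hn using Nat.le_induction with
  | base => simp only [pairRounds_init, Finset.sum_empty]; linarith
  | succ n hn ih =>
    have hKn : K < n := hn
    rw [sum_pairRounds_succ B C hKn]
    have hβ := propBeta_mem (ε := ε) hp I n i j ω
    by_cases hle : (numPulls I n i ω : ℝ) ≤ L
    · have h1 : ∑ t ∈ pairRounds B C n i j ω,
          (if (numPulls I t i ω : ℝ) ≤ L then propBeta p ε I t i j ω else 0) ≤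
          ∑ t ∈ pairRounds B C n i j ω, propBeta p ε I t i j ω := by
        refine Finset.sum_le_sum fun t _ => ?_
        have := propBeta_mem (ε := ε) hp I t i j ω
        split_ifs
        · exact le_rfl
        · exact this.1
      have h2 := (h.tracking hp hn i j ω).2
      have h3 : (pairCount B C n i j ω : ℝ) ≤ challengerPulls I B C n i j ω +
        numPulls I n i ω := by exact_mod_cast h.pairCount_le n i j ω
      rw [Finset.sum_sub_distrib, ← pairCount_eq_sum] at h2
      have h4 : (if B n ω = i ∧ C n ω = j then
          (if (numPulls I n i ω : ℝ) ≤ L then propBeta p ε I n i j ω else 0) else 0) ≤ 1 := by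
        split_ifs <;> linarith [hβ.2]
      linarith
    · simp only [hle, if_false, ite_self, add_zero]
      exact ih

/-- A pair gives its challenger a bounded weight as long as the challenger is rarely pulled. -/
lemma IsRun.sum_one_sub_beta_le (h : IsRun ν p ε P ℱ I B C X) (hp : p.Valid) {L : ℝ} (hL : 0 ≤ L)
    {n : ℕ} (hn : K + 1 ≤ n) (i j : Fin K) (ω : Ω) :
    ∑ t ∈ pairRounds B C n i j ω,
      (if (numPulls I t j ω : ℝ) ≤ L then 1 - propBeta p ε I t i j ω else 0) ≤ L + 2 := by
  induction n, hn using Nat.le_induction with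
  | base => simp only [pairRounds_init, Finset.sum_empty]; linarith
  | succ n hn ih =>
    have hKn : K < n := hn
    rw [sum_pairRounds_succ B C hKn]
    have hβ := propBeta_mem (ε := ε) hp I n i j ω
    by_cases hle : (numPulls I n j ω : ℝ) ≤ L
    · have h1 : ∑ t ∈ pairRounds B C n i j ω,
          (if (numPulls I t j ω : ℝ) ≤ L then 1 - propBeta p ε I t i j ω else 0) ≤
          ∑ t ∈ pairRounds B C n i j ω, (1 - propBeta p ε I t i j ω) := by
        refine Finset.sum_le_sum fun t _ => ?_
        have := propBeta_mem (ε := ε) hp I t i j ω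
        split_ifs
        · exact le_rfl
        · linarith [this.2]
      have h2 := (h.tracking hp hn i j ω).1
      have h3 : (challengerPulls I B C n i j ω : ℝ) ≤ numPulls I n j ω := by
        exact_mod_cast challengerPulls_le_numPulls I B C n i j ω
      have h4 : (if B n ω = i ∧ C n ω = j then
          (if (numPulls I n j ω : ℝ) ≤ L then 1 - propBeta p ε I n i j ω else 0) else 0) ≤ 1 := by
        split_ifs <;> linarith [hβ.1]
      linarith
    · simp only [hle, if_false, ite_self, add_zero]
      exact ih

/-- In each round of a pair with a rarely pulled arm, a rarely pulled arm receives at least the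
weight `minRate`. -/
lemma IsRun.minRate_le (h : IsRun ν p ε P ℱ I B C X) (hε : ε ∈ Ioo (0 : ℝ) 1) (hp : p.Valid)
    {L : ℝ} {t : ℕ} (ht : K < t) (i j : Fin K) (ω : Ω)
    (hor : (numPulls I t i ω : ℝ) ≤ L ∨ (numPulls I t j ω : ℝ) ≤ L) :
    minRate p ε ≤ (if (numPulls I t i ω : ℝ) ≤ L then propBeta p ε I t i j ω else 0) +
      (if (numPulls I t j ω : ℝ) ≤ L then 1 - propBeta p ε I t i j ω else 0) := by
  have hβ := propBeta_mem (ε := ε) hp I t i j ω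
  have ha : (1 : ℝ) ≤ numPulls I t i ω := by exact_mod_cast h.one_le_numPulls ht i ω
  have hb : (1 : ℝ) ≤ numPulls I t j ω := by exact_mod_cast h.one_le_numPulls ht j ω
  have hA : 0 ≤ (if (numPulls I t i ω : ℝ) ≤ L then propBeta p ε I t i j ω else 0) := by
    split_ifs <;> linarith [hβ.1]
  have hB : 0 ≤ (if (numPulls I t j ω : ℝ) ≤ L then 1 - propBeta p ε I t i j ω else 0) := by
    split_ifs <;> linarith [hβ.2]
  have hr1 : 0 < 1 - ε := by linarith [hε.2]
  have hr2 : (1 - ε) ^ 2 ≤ 1 := by nlinarith [hε.1]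
  have hr3 : 0 < (1 - ε) ^ 2 := by positivity
  cases p with
  | fixed β =>
    simp only [minRate, propBeta] at *
    rcases hor with h1 | h1
    · rw [if_pos h1]; linarith [min_le_left β (1 - β)]
    · rw [if_pos h1]; linarith [min_le_right β (1 - β)]
  | ids =>
    set a : ℝ := (numPulls I t i ω : ℝ)
    set b : ℝ := (numPulls I t j ω : ℝ)
    have hbeta : propBeta .ids ε I t i j ω = b / ((1 - ε) ^ 2 * a + b) := rfl
    have hden : 0 < (1 - ε) ^ 2 * a + b := by positivity
    simp only [minRate]
    rcases le_total a b with hab | hab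
    · have h1 : a ≤ L := hor.elim id fun h1 => hab.trans h1
      have h2 : (1 - ε) ^ 2 / 2 ≤ propBeta .ids ε I t i j ω := by
        rw [hbeta, div_le_div_iff₀ (by norm_num) hden]
        nlinarith [mul_le_mul_of_nonneg_right hr2 (show 0 ≤ a by linarith)]
      rw [if_pos h1] at hA ⊢
      linarith
    · have h1 : b ≤ L := hor.elim (fun h1 => hab.trans h1) id
      have h2 : (1 - ε) ^ 2 / 2 ≤ 1 - propBeta .ids ε I t i j ω := by
        rw [hbeta, le_sub_iff_add_le, div_add_div _ _ (by norm_num) hden.ne',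
          div_le_one (by positivity)]
        nlinarith [mul_le_mul_of_nonneg_left hab hr3.le,
          mul_le_mul_of_nonneg_right hr2 (show 0 ≤ a by linarith)]
      rw [if_pos h1] at hB ⊢
      linarith

lemma sum_pairCount {Ω : Type*} (B C : ℕ → Ω → Fin K) (n : ℕ) (ω : Ω) :
    ∑ q : Fin K × Fin K, pairCount B C n q.1 q.2 ω = n - (K + 1) := by
  have := Finset.card_eq_sum_card_fiberwise (f := fun t => (B t ω, C t ω))
    (s := Finset.Ico (K + 1) n) (t := Finset.univ)
    (fun _ _ => Finset.mem_coe.2 (Finset.mem_univ _))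
  rw [Nat.card_Ico] at this
  rw [this]
  refine Finset.sum_congr rfl fun q _ => ?_
  simp [pairCount, pairRounds, Prod.ext_iff]

/-- If in every round the leader or the challenger has been pulled at most `L` times, then the
number of rounds is at most of order `L`. -/
lemma IsRun.time_le (h : IsRun ν p ε P ℱ I B C X) (hε : ε ∈ Ioo (0 : ℝ) 1) (hp : p.Valid)
    {L : ℝ} (hL : 0 ≤ L) {n : ℕ} (hn : K + 1 ≤ n) (ω : Ω)
    (hor : ∀ t, K < t → t < n →
      (numPulls I t (B t ω) ω : ℝ) ≤ L ∨ (numPulls I t (C t ω) ω : ℝ) ≤ L) :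
    minRate p ε * n ≤ minRate p ε * (K + 1) + K ^ 2 * (2 * (L + 2)) := by
  have hpair : ∀ q : Fin K × Fin K,
      minRate p ε * pairCount B C n q.1 q.2 ω ≤ 2 * (L + 2) := by
    intro q
    have h1 := h.sum_beta_le hp hL hn q.1 q.2 ω
    have h2 := h.sum_one_sub_beta_le hp hL hn q.1 q.2 ω
    calc minRate p ε * pairCount B C n q.1 q.2 ω
        = ∑ _t ∈ pairRounds B C n q.1 q.2 ω, minRate p ε := by
          rw [pairCount_eq_sum, Finset.mul_sum, mul_one]
      _ ≤ ∑ t ∈ pairRounds B C n q.1 q.2 ω,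
          ((if (numPulls I t q.1 ω : ℝ) ≤ L then propBeta p ε I t q.1 q.2 ω else 0) +
          (if (numPulls I t q.2 ω : ℝ) ≤ L then 1 - propBeta p ε I t q.1 q.2 ω else 0)) := by
          refine Finset.sum_le_sum fun t ht => ?_
          simp only [pairRounds, Finset.mem_filter, Finset.mem_Ico] at ht
          refine h.minRate_le hε hp (by omega) q.1 q.2 ω ?_
          have := hor t (by omega) ht.1.2
          rwa [ht.2.1, ht.2.2] at this
      _ ≤ _ := by rw [Finset.sum_add_distrib]; linarith
  have hsum := Finset.sum_le_sum fun q (_ : q ∈ Finset.univ) => hpair q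
  rw [← Finset.mul_sum, ← Nat.cast_sum, sum_pairCount, Nat.cast_sub hn, Finset.sum_const,
    Finset.card_univ, Fintype.card_prod, Fintype.card_fin, nsmul_eq_mul] at hsum
  push_cast at hsum
  nlinarith

end Path

/-! ### Exploration on the concentration event -/

section Path

variable {K : ℕ} {Ω : Type*} [mΩ : MeasurableSpace Ω] {ν : Fin K → Measure ℝ} {p : Proportions}
  {ε : ℝ} {P : Measure Ω} {ℱ : Filtration ℕ mΩ} {I B C : ℕ → Ω → Fin K} {X : ℕ → Ω → ℝ}

/-- Up to round `n`, all empirical means are within `√(A log n / N)` of the means. -/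
def Concentrated {Ω : Type*} (ν : Fin K → Measure ℝ) (I : ℕ → Ω → Fin K) (X : ℕ → Ω → ℝ) (A : ℝ)
    (n : ℕ) (ω : Ω) : Prop :=
  ∀ t, K < t → t ≤ n → ∀ i,
    (numPulls I t i ω : ℝ) * (empMean I X t i ω - means ν i) ^ 2 ≤ A * Real.log n

lemma one_le_log {n : ℕ} (hn : 3 ≤ n) : 1 ≤ Real.log n := by
  rw [Real.le_log_iff_exp_le (by positivity)]
  have : (3 : ℝ) ≤ n := by exact_mod_cast hn
  linarith [Real.exp_one_lt_d9]

lemma IsInstance.exists_bounds (hν : IsInstance ν) (hK : 0 < K) :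
    ∃ a M : ℝ, 0 < a ∧ ∀ i, a ≤ means ν i ∧ means ν i ≤ M := by
  have : Nonempty (Fin K) := ⟨⟨0, hK⟩⟩
  obtain ⟨i, hi⟩ := Finite.exists_min (means ν)
  obtain ⟨j, hj⟩ := Finite.exists_max (means ν)
  exact ⟨means ν i, means ν j, (hν i).2, fun k => ⟨hi k, hj k⟩⟩

lemma slack_mul_le {ε x y : ℝ} (hε : ε ≤ 1) (hxy : x ≤ y) : ε * y ≤ y - (1 - ε) * x := by
  have := mul_nonneg (sub_nonneg.2 hε) (sub_nonneg.2 hxy)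
  linarith

/-- Upper bound for the squared cost against an arm with `Nk` pulls and an imprecise mean. -/
lemma sq_cost_le {Nb Nk r M mb mk μk V : ℝ} (hNb : 0 < Nb) (hNk : 1 ≤ Nk) (hr0 : 0 < r)
    (hr1 : r ≤ 1) (hμk : 0 ≤ μk) (hmb : mb ≤ 2 * M) (hnum : 0 ≤ mb - r * mk)
    (hdk : Nk * (mk - μk) ^ 2 ≤ V) :
    ((mb - r * mk) / Real.sqrt (1 / Nb + r ^ 2 / Nk)) ^ 2 ≤ (8 * M ^ 2 * Nk + 2 * V) / r ^ 2 := by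
  have hN : 0 < Nk := by linarith
  have hmk : mb - r * mk ≤ 2 * M + r * |mk - μk| := by
    have h1 := mul_nonneg hr0.le hμk
    have h2 := mul_nonneg hr0.le (show 0 ≤ |mk - μk| + (mk - μk) by linarith [neg_abs_le (mk - μk)])
    linarith
  have hd : (mk - μk) ^ 2 ≤ V / Nk := by
    rw [le_div_iff₀ hN]; linarith
  have e2 : (r * |mk - μk|) ^ 2 ≤ V / Nk := by
    rw [mul_pow, sq_abs]
    have : r ^ 2 ≤ 1 := pow_le_one₀ hr0.le hr1
    exact (mul_le_of_le_one_left (sq_nonneg _) this).trans hd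
  have e1 : (mb - r * mk) ^ 2 ≤ 8 * M ^ 2 + 2 * (V / Nk) := by
    have h1 : (mb - r * mk) ^ 2 ≤ (2 * M + r * |mk - μk|) ^ 2 := pow_le_pow_left₀ hnum hmk 2
    have h2 := add_sq_le (a := 2 * M) (b := r * |mk - μk|)
    linarith
  rw [div_pow, Real.sq_sqrt (by positivity)]
  calc (mb - r * mk) ^ 2 / (1 / Nb + r ^ 2 / Nk)
      ≤ (8 * M ^ 2 + 2 * (V / Nk)) / (r ^ 2 / Nk) := by
        have h0 : 0 ≤ 8 * M ^ 2 + 2 * (V / Nk) := (sq_nonneg _).trans e1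
        gcongr
        have : 0 ≤ 1 / Nb := by positivity
        linarith
    _ = (8 * M ^ 2 * Nk + 2 * V) / r ^ 2 := by field_simp

/-- Because of the slack `ε`, the cost between two well-sampled arms is large. As the challenger
has the smallest cost, the leader or the challenger has not been pulled much more often than any
other arm. -/
lemma IsRun.exists_min_le (hK : 0 < K) (hν : IsInstance ν) (hε : ε ∈ Ioo (0 : ℝ) 1)
    (h : IsRun ν p ε P ℱ I B C X) {A : ℝ} (hA : 0 < A) :
    ∃ D : ℝ, 1 ≤ D ∧ ∀ n ω, 3 ≤ n → Concentrated ν I X A n ω → ∀ t, K < t → t ≤ n → ∀ k,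
      (numPulls I t (B t ω) ω : ℝ) ≤ D * (numPulls I t k ω + Real.log n) ∨
      (numPulls I t (C t ω) ω : ℝ) ≤ D * (numPulls I t k ω + Real.log n) := by
  obtain ⟨a, M, ha, hM⟩ := hν.exists_bounds hK
  have hMa : a ≤ M := (hM ⟨0, hK⟩).1.trans (hM ⟨0, hK⟩).2
  obtain ⟨hε0, hε1⟩ := hε
  have hr : 0 < 1 - ε := by linarith
  set D1 := 4 * A / a ^ 2 with hD1
  set D2 := 8 * (8 * M ^ 2 + 2 * A) / (ε ^ 2 * a ^ 2 * (1 - ε) ^ 2) with hD2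
  have hD1p : 0 < D1 := by positivity
  have hD2p : 0 < D2 := by
    have : 0 < M := by linarith
    positivity
  refine ⟨1 + D1 + D2, by linarith, fun n ω hn hc t ht htn k => ?_⟩
  have hlog := one_le_log hn
  have hNB : (1 : ℝ) ≤ numPulls I t (B t ω) ω := by exact_mod_cast h.one_le_numPulls ht _ ω
  have hNC : (1 : ℝ) ≤ numPulls I t (C t ω) ω := by exact_mod_cast h.one_le_numPulls ht _ ω
  have hNk : (1 : ℝ) ≤ numPulls I t k ω := by exact_mod_cast h.one_le_numPulls ht _ ω
  set b := B t ω with hb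
  set c := C t ω with hcdef
  by_contra hcon
  push Not at hcon
  obtain ⟨hcB, hcC⟩ := hcon
  by_cases hkb : k = b
  · rw [hkb] at hcB
    have := le_mul_of_one_le_left (show 0 ≤ (numPulls I t b ω : ℝ) + Real.log n by linarith)
      (show 1 ≤ 1 + D1 + D2 by linarith)
    linarith
  have hdb := hc t ht htn b
  have hdk := hc t ht htn k
  -- the empirical mean of the leader is accurate
  have hb2 : |empMean I X t b ω - means ν b| ≤ a / 2 := by
    apply abs_le_of_sq_le_sq _ (by positivity)
    have h1 : D1 * Real.log n ≤ numPulls I t b ω :=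
      (mul_le_mul (by linarith) (by linarith) (by linarith) (by linarith)).trans hcB.le
    have h2 : D1 * Real.log n * (empMean I X t b ω - means ν b) ^ 2 ≤ A * Real.log n :=
      (mul_le_mul_of_nonneg_right h1 (sq_nonneg _)).trans hdb
    have h3 : D1 * (empMean I X t b ω - means ν b) ^ 2 ≤ A :=
      le_of_mul_le_mul_right (by linarith) (show 0 < Real.log n by linarith)
    have h4 : D1 * (a / 2) ^ 2 = A := by rw [hD1]; field_simp; norm_num
    exact le_of_mul_le_mul_left (by linarith) hD1p
  rw [abs_le] at hb2
  set mb := empMean I X t b ω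
  set mc := empMean I X t c ω
  set mk := empMean I X t k ω
  set Nb : ℝ := (numPulls I t b ω : ℝ)
  set Nc : ℝ := (numPulls I t c ω : ℝ)
  set Nk : ℝ := (numPulls I t k ω : ℝ)
  set W := (1 + D1 + D2) * (Nk + Real.log n) with hW
  have hWpos : 0 < W := by positivity
  have hmb1 : a / 2 ≤ mb := by linarith [hb2.1, (hM b).1]
  have hmb2 : mb ≤ 2 * M := by linarith [hb2.2, (hM b).2]
  have hlead : mc ≤ mb := h.leader t ht ω c
  have hnum : ε * a / 2 ≤ mb - (1 - ε) * mc := by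
    have := mul_le_mul_of_nonneg_left hmb1 hε0.le
    linarith [slack_mul_le hε1.le hlead]
  have hcost := h.challenger t ht ω k hkb
  have hlow : ε * a / 2 * Real.sqrt (W / 2) ≤ cost ε I X t b c ω := by
    rw [cost, le_div_iff₀ (Real.sqrt_pos.2 (by positivity)), mul_assoc,
      ← Real.sqrt_mul (by positivity)]
    have : Real.sqrt (W / 2 * (1 / Nb + (1 - ε) ^ 2 / Nc)) ≤ 1 := by
      rw [Real.sqrt_le_one]
      have e1 : 1 / Nb ≤ 1 / W := one_div_le_one_div_of_le hWpos hcB.le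
      have e2 : (1 - ε) ^ 2 / Nc ≤ 1 / W :=
        div_le_div₀ (by norm_num) (pow_le_one₀ hr.le (by linarith)) hWpos hcC.le
      calc W / 2 * (1 / Nb + (1 - ε) ^ 2 / Nc) ≤ W / 2 * (1 / W + 1 / W) := by gcongr
        _ = 1 := by field_simp; norm_num
    have h0 : 0 ≤ ε * a / 2 := by positivity
    exact (mul_le_of_le_one_right h0 this).trans hnum
  have hsq : (cost ε I X t b k ω) ^ 2 ≤ (8 * M ^ 2 * Nk + 2 * (A * Real.log n)) / (1 - ε) ^ 2 := by
    have hmk : mk ≤ mb := h.leader t ht ω k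
    have hnn : 0 ≤ mb - (1 - ε) * mk :=
      (mul_nonneg hε0.le (by linarith)).trans (slack_mul_le hε1.le hmk)
    exact sq_cost_le (Nb := Nb) (Nk := Nk) (by linarith) hNk hr (by linarith)
      (ha.le.trans (hM k).1) hmb2 hnn hdk
  have hfin : (ε * a / 2 * Real.sqrt (W / 2)) ^ 2 ≤ (cost ε I X t b k ω) ^ 2 := by
    have := hlow.trans hcost
    gcongr
  rw [mul_pow, Real.sq_sqrt (by positivity)] at hfin
  have h1 := hfin.trans hsq
  rw [le_div_iff₀ (by positivity)] at h1
  have h2 : D2 * (ε ^ 2 * a ^ 2 * (1 - ε) ^ 2) = 8 * (8 * M ^ 2 + 2 * A) := by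
    rw [hD2]; field_simp
  have h3 : D2 * (Nk + Real.log n) < W := mul_lt_mul_of_pos_right (by linarith) (by linarith)
  have h4 : 0 < ε ^ 2 * a ^ 2 * (1 - ε) ^ 2 := by positivity
  have h5 := mul_lt_mul_of_pos_right h3 h4
  have h6 : D2 * (Nk + Real.log n) * (ε ^ 2 * a ^ 2 * (1 - ε) ^ 2) =
    8 * (8 * M ^ 2 + 2 * A) * (Nk + Real.log n) := by rw [← h2]; ring
  have h7 := mul_nonneg (sq_nonneg M) (show 0 ≤ Real.log n by linarith)
  have h8 := mul_nonneg hA.le (show 0 ≤ Nk by linarith)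
  linarith

/-- All arms are explored linearly in time, up to a logarithmic term. -/
lemma IsRun.linear_exploration (hK : 0 < K) (hν : IsInstance ν) (hε : ε ∈ Ioo (0 : ℝ) 1)
    (hp : p.Valid) (h : IsRun ν p ε P ℱ I B C X) {A : ℝ} (hA : 0 < A) :
    ∃ κ D : ℝ, 0 < κ ∧ 0 < D ∧ ∀ n ω, 3 ≤ n → Concentrated ν I X A n ω → ∀ t, K < t → t ≤ n →
      ∀ k, κ * t ≤ numPulls I t k ω + D * Real.log n := by
  obtain ⟨D, hD, hmin⟩ := h.exists_min_le hK hν hε hA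
  have hb := minRate_pos hp hε
  set b := minRate p ε
  have hK1 : (1 : ℝ) ≤ K := by exact_mod_cast hK
  set G : ℝ := 2 * K ^ 2 * D with hG
  have hGp : 0 < G := by positivity
  refine ⟨b / G, (b * (K + 1) + 4 * K ^ 2 + G) / G, by positivity, by positivity,
    fun n ω hn hc t ht htn k => ?_⟩
  have hlog := one_le_log hn
  have hL : 0 ≤ D * (numPulls I t k ω + Real.log n) := by positivity
  -- pull counts are monotone, so the bound on the rarely pulled arm holds in all earlier rounds
  have := h.time_le hε hp hL ht ω (fun s hs hst => by
    have hmono : (numPulls I s k ω : ℝ) ≤ numPulls I t k ω := by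
      exact_mod_cast numPulls_mono I k ω hst.le
    have hle : D * (numPulls I s k ω + Real.log n) ≤ D * (numPulls I t k ω + Real.log n) := by
      gcongr
    exact (hmin n ω hn hc s hs (hst.le.trans htn) k).imp (fun h => h.trans hle)
      (fun h => h.trans hle))
  have e : b / G * t = b * t / G := by ring
  have e2 : (numPulls I t k ω : ℝ) + (b * (K + 1) + 4 * K ^ 2 + G) / G * Real.log n =
    (G * numPulls I t k ω + (b * (K + 1) + 4 * K ^ 2 + G) * Real.log n) / G := by
    field_simp
  rw [e, e2]
  gcongr
  have : 0 ≤ (b * (K + 1) + 4 * (K : ℝ) ^ 2) * (Real.log n - 1) :=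
    mul_nonneg (by positivity) (by linarith)
  nlinarith

lemma bestArms_unique {μ : Fin K → ℝ} (h : (bestArms μ).ncard = 1) :
    ∃ s, μ s = muStar μ ∧ ∀ i, i ≠ s → μ i < μ s := by
  obtain ⟨s, hs⟩ := Set.ncard_eq_one.1 h
  have hs1 : s ∈ bestArms μ := by rw [hs]; rfl
  refine ⟨s, hs1, fun i hi => ?_⟩
  rw [show μ s = muStar μ from hs1]
  refine lt_of_le_of_ne (le_muStar μ i) fun hcon => hi ?_
  have : i ∈ bestArms μ := hcon
  rwa [hs] at this

lemma exists_gap {μ : Fin K → ℝ} {s : Fin K} (hs : ∀ i, i ≠ s → μ i < μ s) :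
    ∃ g : ℝ, 0 < g ∧ ∀ i, i ≠ s → μ i + g ≤ μ s := by
  by_cases hne : (Finset.univ.erase s).Nonempty
  · obtain ⟨j, hj, hmax⟩ := Finset.exists_max_image _ μ hne
    refine ⟨μ s - μ j, by linarith [hs j (Finset.mem_erase.1 hj).1], fun i hi => ?_⟩
    linarith [hmax i (Finset.mem_erase.2 ⟨hi, Finset.mem_univ _⟩)]
  · refine ⟨1, one_pos, fun i hi => absurd ⟨i, Finset.mem_erase.2 ⟨hi, Finset.mem_univ _⟩⟩ hne⟩

/-- The leader is the best arm from a time of logarithmic order on. -/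
lemma IsRun.leader_eq (hK : 0 < K) (hν : IsInstance ν) (hε : ε ∈ Ioo (0 : ℝ) 1)
    (hp : p.Valid) (h : IsRun ν p ε P ℱ I B C X) {s : Fin K}
    (hs : ∀ i, i ≠ s → means ν i < means ν s) {A : ℝ} (hA : 0 < A) :
    ∃ D : ℝ, 0 < D ∧ ∀ n ω, 3 ≤ n → Concentrated ν I X A n ω → ∀ t, K < t → t ≤ n →
      D * Real.log n ≤ t → B t ω = s := by
  obtain ⟨g, hg, hgap⟩ := exists_gap hs
  obtain ⟨κ, D, hκ, hD, hexp⟩ := h.linear_exploration hK hν hε hp hA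
  refine ⟨(D + 9 * A / g ^ 2) / κ, by positivity, fun n ω hn hc t ht htn hDt => ?_⟩
  have hlog := one_le_log hn
  have hdev : ∀ i, |empMean I X t i ω - means ν i| ≤ g / 3 := by
    intro i
    apply abs_le_of_sq_le_sq _ (by positivity)
    have h1 := hexp n ω hn hc t ht htn i
    have h2 := hc t ht htn i
    rw [div_mul_eq_mul_div, div_le_iff₀ hκ] at hDt
    have h3 : 9 * A / g ^ 2 * Real.log n ≤ numPulls I t i ω := by nlinarith
    have h4 := (mul_le_mul_of_nonneg_right h3 (sq_nonneg (empMean I X t i ω - means ν i))).trans h2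
    have h5 : 9 * A / g ^ 2 * (empMean I X t i ω - means ν i) ^ 2 ≤ A :=
      le_of_mul_le_mul_right (by linarith) (show 0 < Real.log n by linarith)
    have h6 : 9 * A / g ^ 2 * (g / 3) ^ 2 = A := by field_simp; norm_num
    exact le_of_mul_le_mul_left (by linarith) (show 0 < 9 * A / g ^ 2 by positivity)
  by_contra hne
  have h1 := h.leader t ht ω s
  have h2 := abs_le.1 (hdev s)
  have h3 := abs_le.1 (hdev (B t ω))
  linarith [hgap _ hne, h2.1, h3.2]

end Path

/-! ### The limiting proportions -/

section Path

variable {K : ℕ} {Ω : Type*} [mΩ : MeasurableSpace Ω] {ν : Fin K → Measure ℝ} {p : Proportions}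
  {ε : ℝ} {P : Measure Ω} {ℱ : Filtration ℕ mΩ} {I B C : ℕ → Ω → Fin K} {X : ℕ → Ω → ℝ}

/-- Target number of pulls of the challenger `j` in the rounds with leader `s`. -/
noncomputable def targetPulls (p : Proportions) (ε : ℝ) (I B C : ℕ → Ω → Fin K) (s : Fin K)
    (t : ℕ) (j : Fin K) (ω : Ω) : ℝ :=
  ∑ u ∈ pairRounds B C t s j ω, (1 - propBeta p ε I u s j ω)

/-- Target number of pulls of the leader `s`, over all challengers. -/
noncomputable def targetLeader (p : Proportions) (ε : ℝ) (I B C : ℕ → Ω → Fin K) (s : Fin K)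
    (t : ℕ) (ω : Ω) : ℝ :=
  ∑ j ∈ Finset.univ.erase s, ∑ u ∈ pairRounds B C t s j ω, propBeta p ε I u s j ω

/-- The rounds before `t` in which the arm `s` is not the leader, initialisation included. -/
def otherRounds (B : ℕ → Ω → Fin K) (s : Fin K) (t : ℕ) (ω : Ω) : Finset ℕ :=
  (Finset.Ico 1 t).filter fun u => u ≤ K ∨ B u ω ≠ s

/-- The numbers of pulls differ from their targets by at most the number of rounds with another
leader, up to the tracking error. -/
lemma IsRun.numPulls_sub_targetPulls (h : IsRun ν p ε P ℱ I B C X) (hp : p.Valid) {s j : Fin K}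
    (hj : j ≠ s) {t : ℕ} (ht : K + 1 ≤ t) (ω : Ω) :
    0 ≤ numPulls I t j ω - targetPulls p ε I B C s t j ω ∧
      numPulls I t j ω - targetPulls p ε I B C s t j ω ≤ (otherRounds B s t ω).card + 1 := by
  have htr := h.tracking hp ht s j ω
  have h1 : (challengerPulls I B C t s j ω : ℝ) ≤ numPulls I t j ω := by
    exact_mod_cast challengerPulls_le_numPulls I B C t s j ω
  have h2 : numPulls I t j ω ≤ challengerPulls I B C t s j ω + (otherRounds B s t ω).card := by
    refine (Finset.card_le_card ?_).trans (Finset.card_union_le _ _)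
    intro u hu
    simp only [Finset.mem_filter, Finset.mem_Ico, Finset.mem_union, pairRounds,
      otherRounds] at hu ⊢
    by_cases hl : u ≤ K ∨ B u ω ≠ s
    · exact .inr ⟨hu.1, hl⟩
    · push Not at hl
      rcases h.arm_eq_or hl.1 ω with h3 | h3
      · exact absurd (hu.2.symm.trans (h3.trans hl.2)) hj
      · exact .inl ⟨⟨⟨hl.1, hu.1.2⟩, hl.2, h3.symm.trans hu.2⟩, hu.2⟩
  have h3 : (numPulls I t j ω : ℝ) ≤ challengerPulls I B C t s j ω +
    (otherRounds B s t ω).card := by exact_mod_cast h2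
  unfold targetPulls
  constructor <;> linarith [htr.1, htr.2]

lemma IsRun.sum_pairCount_leader (h : IsRun ν p ε P ℱ I B C X) (s : Fin K) (t : ℕ) (ω : Ω) :
    ∑ j ∈ Finset.univ.erase s, pairCount B C t s j ω + (otherRounds B s t ω).card = t - 1 := by
  have h1 := Finset.card_eq_sum_card_fiberwise (f := fun u => C u ω)
    (s := (Finset.Ico 1 t).filter fun u => ¬ (u ≤ K ∨ B u ω ≠ s)) (t := Finset.univ.erase s)
    (by
      intro u hu
      have hu' := Finset.mem_filter.1 (Finset.mem_coe.1 hu)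
      have hu2 := hu'.2
      push Not at hu2
      refine Finset.mem_coe.2 (Finset.mem_erase.2 ⟨?_, Finset.mem_univ _⟩)
      rw [← hu2.2]
      exact h.challenger_ne u hu2.1 ω)
  have h2 := Finset.card_filter_add_card_filter_not (s := Finset.Ico 1 t)
    (fun u => u ≤ K ∨ B u ω ≠ s)
  rw [Nat.card_Ico, h1] at h2
  rw [← h2, add_comm, otherRounds]
  congr 1
  refine Finset.sum_congr rfl fun j _ => ?_
  rw [pairCount]
  congr 1
  ext u
  simp only [pairRounds, Finset.mem_filter, Finset.mem_Ico]
  push Not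
  constructor
  · rintro ⟨h1, h2, h3⟩; exact ⟨⟨⟨by omega, h1.2⟩, by omega, h2⟩, h3⟩
  · rintro ⟨⟨h1, h2, h3⟩, h4⟩; exact ⟨⟨by omega, h1.2⟩, h3, h4⟩

lemma IsRun.targets_bounds (h : IsRun ν p ε P ℱ I B C X) (hp : p.Valid) (s : Fin K) {t : ℕ}
    (ht : K + 1 ≤ t) (ω : Ω) :
    |(numPulls I t s ω : ℝ) - targetLeader p ε I B C s t ω| ≤
        K * ((otherRounds B s t ω).card + 1) ∧
      0 ≤ targetLeader p ε I B C s t ω ∧ targetLeader p ε I B C s t ω ≤ t := by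
  have hK : 0 < K := s.pos
  have hK1 : (1 : ℝ) ≤ K := by exact_mod_cast hK
  have hsum := sum_numPulls I t ω
  rw [← Finset.add_sum_erase _ _ (Finset.mem_univ s)] at hsum
  have hpc := h.sum_pairCount_leader s t ω
  have hsum' : (numPulls I t s ω : ℝ) + ∑ j ∈ Finset.univ.erase s, (numPulls I t j ω : ℝ) =
      t - 1 := by
    rw [← Nat.cast_one, ← Nat.cast_sub (by omega), ← hsum]; push_cast; rfl
  have hpc' : ∑ j ∈ Finset.univ.erase s, (pairCount B C t s j ω : ℝ) +
      (otherRounds B s t ω).card = t - 1 := by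
    rw [← Nat.cast_one, ← Nat.cast_sub (by omega), ← hpc]; push_cast; rfl
  have hU : targetLeader p ε I B C s t ω = ∑ j ∈ Finset.univ.erase s,
      ((pairCount B C t s j ω : ℝ) - targetPulls p ε I B C s t j ω) := by
    refine Finset.sum_congr rfl fun j _ => ?_
    rw [targetPulls, pairCount_eq_sum, ← Finset.sum_sub_distrib]
    simp
  have hdiff : (numPulls I t s ω : ℝ) - targetLeader p ε I B C s t ω =
      (otherRounds B s t ω).card - ∑ j ∈ Finset.univ.erase s,
        ((numPulls I t j ω : ℝ) - targetPulls p ε I B C s t j ω) := by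
    rw [hU, Finset.sum_sub_distrib, Finset.sum_sub_distrib]
    linarith
  have hlow : 0 ≤ ∑ j ∈ Finset.univ.erase s,
      ((numPulls I t j ω : ℝ) - targetPulls p ε I B C s t j ω) :=
    Finset.sum_nonneg fun j hj =>
      (h.numPulls_sub_targetPulls hp (Finset.mem_erase.1 hj).1 ht ω).1
  have hup : ∑ j ∈ Finset.univ.erase s,
      ((numPulls I t j ω : ℝ) - targetPulls p ε I B C s t j ω) ≤
      K * ((otherRounds B s t ω).card + 1) := by
    refine (Finset.sum_le_card_nsmul _ _ _ fun j hj =>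
      (h.numPulls_sub_targetPulls hp (Finset.mem_erase.1 hj).1 ht ω).2).trans ?_
    rw [nsmul_eq_mul]
    gcongr
    exact (Finset.card_le_univ _).trans (by simp)
  have hE : (0 : ℝ) ≤ (otherRounds B s t ω).card := by positivity
  refine ⟨?_, ?_, ?_⟩
  · rw [hdiff, abs_le]
    constructor <;> nlinarith
  · exact Finset.sum_nonneg fun j _ => Finset.sum_nonneg fun u _ => (propBeta_mem hp I u s j ω).1
  · have : targetLeader p ε I B C s t ω ≤ ∑ j ∈ Finset.univ.erase s,
        (pairCount B C t s j ω : ℝ) := by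
      refine Finset.sum_le_sum fun j _ => ?_
      rw [pairCount_eq_sum]
      exact Finset.sum_le_sum fun u _ => (propBeta_mem hp I u s j ω).2
    linarith

lemma targetPulls_succ {Ω : Type*} (p : Proportions) (ε : ℝ) (I B C : ℕ → Ω → Fin K) (s : Fin K)
    {t : ℕ} (ht : K < t) (j : Fin K) (ω : Ω) :
    targetPulls p ε I B C s (t + 1) j ω = targetPulls p ε I B C s t j ω +
      if B t ω = s ∧ C t ω = j then 1 - propBeta p ε I t s j ω else 0 :=
  sum_pairRounds_succ B C ht s j ω _

lemma IsRun.targetLeader_succ (h : IsRun ν p ε P ℱ I B C X) (s : Fin K) {t : ℕ} (ht : K < t)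
    (ω : Ω) :
    targetLeader p ε I B C s (t + 1) ω = targetLeader p ε I B C s t ω +
      if B t ω = s then propBeta p ε I t s (C t ω) ω else 0 := by
  simp only [targetLeader, sum_pairRounds_succ B C ht, Finset.sum_add_distrib]
  congr 1
  by_cases hB : B t ω = s
  · have hmem : C t ω ∈ Finset.univ.erase s :=
      Finset.mem_erase.2 ⟨hB ▸ h.challenger_ne t ht ω, Finset.mem_univ _⟩
    simp only [hB, true_and, if_true]
    rw [Finset.sum_ite_eq, if_pos hmem]
  · simp [hB]

/-- One step of the approximate invariant: adding `β` to `U` and `1 - β` to `S` changes `r² U² - S²`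
by a bounded amount, when `β = b / (r² a + b)` and `U`, `S` are close to `a`, `b`. -/
lemma invariant_step {r a b U S Q β : ℝ} (hr0 : 0 ≤ r) (hr1 : r ≤ 1) (hβ0 : 0 ≤ β) (hβ1 : β ≤ 1)
    (hbal : r ^ 2 * a * β = b * (1 - β)) (hU : |a - U| ≤ Q) (hS : |b - S| ≤ Q) :
    |r ^ 2 * (2 * U * β + β ^ 2) - (2 * S * (1 - β) + (1 - β) ^ 2)| ≤ 4 * Q + 1 := by
  have hr2 : r ^ 2 ≤ 1 := pow_le_one₀ hr0 hr1
  have hr3 : 0 ≤ r ^ 2 := sq_nonneg r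
  have e : r ^ 2 * (2 * U * β + β ^ 2) - (2 * S * (1 - β) + (1 - β) ^ 2) =
      -(2 * (r ^ 2 * β) * (a - U)) + 2 * (1 - β) * (b - S) + (r ^ 2 * β ^ 2 - (1 - β) ^ 2) := by
    linear_combination 2 * hbal
  have hQ : 0 ≤ Q := (abs_nonneg _).trans hU
  have h1 : |2 * (r ^ 2 * β) * (a - U)| ≤ 2 * Q := by
    rw [abs_mul, abs_of_nonneg (by positivity)]
    have : r ^ 2 * β ≤ 1 := mul_le_one₀ hr2 hβ0 hβ1
    calc 2 * (r ^ 2 * β) * |a - U| ≤ 2 * 1 * Q := by gcongr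
      _ = 2 * Q := by ring
  have h2 : |2 * (1 - β) * (b - S)| ≤ 2 * Q := by
    have h0 : 0 ≤ 1 - β := by linarith
    rw [abs_mul, abs_of_nonneg (by positivity)]
    calc 2 * (1 - β) * |b - S| ≤ 2 * 1 * Q := by gcongr; linarith
      _ = 2 * Q := by ring
  have h3 : |r ^ 2 * β ^ 2 - (1 - β) ^ 2| ≤ 1 := by
    have hb : β ^ 2 ≤ 1 := pow_le_one₀ hβ0 hβ1
    have hc : (1 - β) ^ 2 ≤ 1 := pow_le_one₀ (by linarith) (by linarith)
    have hd : r ^ 2 * β ^ 2 ≤ 1 := mul_le_one₀ hr2 (sq_nonneg _) hb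
    have he : 0 ≤ r ^ 2 * β ^ 2 := by positivity
    rw [abs_le]
    constructor <;> nlinarith [sq_nonneg (1 - β)]
  rw [e]
  calc _ ≤ |(-(2 * (r ^ 2 * β) * (a - U)) + 2 * (1 - β) * (b - S))| +
        |r ^ 2 * β ^ 2 - (1 - β) ^ 2| := abs_add_le _ _
    _ ≤ (|-(2 * (r ^ 2 * β) * (a - U))| + |2 * (1 - β) * (b - S)|) +
        |r ^ 2 * β ^ 2 - (1 - β) ^ 2| := by gcongr; exact abs_add_le _ _
    _ ≤ _ := by rw [abs_neg]; linarith

/-- With IDS proportions the quantity `(1 - ε)² N_s² - ∑ N_j²` is almost conserved. -/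
lemma IsRun.ids_invariant (hε : ε ∈ Ioo (0 : ℝ) 1) (h : IsRun ν .ids ε P ℱ I B C X) (s : Fin K)
    {Q : ℝ} {n : ℕ} (ω : Ω)
    (hQ : ∀ t, K < t → t ≤ n → K * (((otherRounds B s t ω).card : ℝ) + 1) ≤ Q) {t : ℕ}
    (ht : K + 1 ≤ t) (htn : t ≤ n) :
    |(1 - ε) ^ 2 * targetLeader .ids ε I B C s t ω ^ 2 -
      ∑ j ∈ Finset.univ.erase s, targetPulls .ids ε I B C s t j ω ^ 2| ≤ (4 * Q + 1) * t := by
  have hp : Proportions.ids.Valid := trivial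
  have hK1 : (1 : ℝ) ≤ K := by exact_mod_cast s.pos
  induction t, ht using Nat.le_induction with
  | base =>
    have hQ0 : 0 ≤ Q := le_trans (by positivity) (hQ (K + 1) (by omega) htn)
    simp only [targetLeader, targetPulls, pairRounds_init, Finset.sum_empty, Finset.sum_const_zero]
    norm_num
    positivity
  | succ t ht ih =>
    have hKt : K < t := ht
    have ih' := ih (by omega)
    have hQt := hQ t hKt (by omega)
    have hQ0 : 0 ≤ Q := le_trans (by positivity) hQt
    rw [h.targetLeader_succ s hKt]
    simp only [targetPulls_succ .ids ε I B C s hKt]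
    by_cases hB : B t ω = s
    · set c := C t ω with hc
      have hcs : c ≠ s := hB ▸ h.challenger_ne t hKt ω
      have hmem : c ∈ Finset.univ.erase s := Finset.mem_erase.2 ⟨hcs, Finset.mem_univ _⟩
      simp only [hB, true_and, if_true]
      set U := targetLeader .ids ε I B C s t ω
      set S := fun j => targetPulls .ids ε I B C s t j ω with hS
      set β := fun j => propBeta .ids ε I t s j ω with hβ
      have hsum : ∑ j ∈ Finset.univ.erase s, (S j + if c = j then 1 - β j else 0) ^ 2 =
          ∑ j ∈ Finset.univ.erase s, S j ^ 2 +
            (2 * S c * (1 - β c) + (1 - β c) ^ 2) := by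
        have : ∀ j, (S j + if c = j then 1 - β j else 0) ^ 2 =
            S j ^ 2 + if c = j then 2 * S j * (1 - β j) + (1 - β j) ^ 2 else 0 := by
          intro j
          split_ifs <;> ring
        simp only [this, Finset.sum_add_distrib]
        rw [Finset.sum_ite_eq, if_pos hmem]
      rw [hsum]
      have hb := propBeta_mem (ε := ε) hp I t s c ω
      have hNc : (1 : ℝ) ≤ numPulls I t c ω := by exact_mod_cast h.one_le_numPulls hKt c ω
      have hbal : (1 - ε) ^ 2 * numPulls I t s ω * β c = numPulls I t c ω * (1 - β c) := by
        simp only [hβ, propBeta, idsBeta]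
        have : 0 < (1 - ε) ^ 2 * (numPulls I t s ω : ℝ) + numPulls I t c ω := by positivity
        field_simp
        ring
      have hU : |(numPulls I t s ω : ℝ) - U| ≤ Q := (h.targets_bounds hp s ht ω).1.trans hQt
      have hSc : |(numPulls I t c ω : ℝ) - S c| ≤ Q := by
        have h1 := h.numPulls_sub_targetPulls hp hcs ht ω
        rw [abs_of_nonneg h1.1]
        refine h1.2.trans (le_trans ?_ hQt)
        exact le_mul_of_one_le_left (by positivity) hK1
      have hstep := invariant_step (by linarith [hε.2]) (by linarith [hε.1]) hb.1 hb.2 hbal hU hSc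
      have e : (1 - ε) ^ 2 * (U + β c) ^ 2 - (∑ j ∈ Finset.univ.erase s, S j ^ 2 +
            (2 * S c * (1 - β c) + (1 - β c) ^ 2)) =
          ((1 - ε) ^ 2 * U ^ 2 - ∑ j ∈ Finset.univ.erase s, S j ^ 2) +
          ((1 - ε) ^ 2 * (2 * U * β c + β c ^ 2) - (2 * S c * (1 - β c) + (1 - β c) ^ 2)) := by
        ring
      rw [e]
      refine (abs_add_le _ _).trans ?_
      push_cast
      linarith
    · simp only [hB, false_and, if_false, add_zero]
      refine ih'.trans ?_
      push_cast
      nlinarith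

/-- Exponent `q` of the limiting constraint `∑_{j ≠ s} (N_j / N_s) ^ q = c`. -/
def balExp : Proportions → ℕ
  | .ids => 2
  | .fixed _ => 1

/-- Constant `c` of the limiting constraint `∑_{j ≠ s} (N_j / N_s) ^ q = c`. -/
noncomputable def balConst (ε : ℝ) : Proportions → ℝ
  | .ids => (1 - ε) ^ 2
  | .fixed β => (1 - β) / β

/-- The pulls satisfy the limiting constraint up to an error of logarithmic order. For IDS it is the
first-order optimality condition of the optimal allocation. -/
lemma IsRun.balance (hK : 0 < K) (hν : IsInstance ν) (hε : ε ∈ Ioo (0 : ℝ) 1)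
    (hp : p.Valid) (h : IsRun ν p ε P ℱ I B C X) {s : Fin K}
    (hs : ∀ i, i ≠ s → means ν i < means ν s) {A : ℝ} (hA : 0 < A) :
    ∃ D : ℝ, ∀ n ω, 3 ≤ n → K < n → Concentrated ν I X A n ω →
      |balConst ε p * (numPulls I n s ω : ℝ) ^ balExp p -
        ∑ j ∈ Finset.univ.erase s, (numPulls I n j ω : ℝ) ^ balExp p| ≤
      D * Real.log n * n ^ (balExp p - 1) := by
  obtain ⟨D, hD, hlead⟩ := h.leader_eq hK hν hε hp hs hA
  have hK1 : (1 : ℝ) ≤ K := by exact_mod_cast hK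
  -- outside a number of rounds of logarithmic order, the leader is the best arm
  have hQ : ∀ n ω, 3 ≤ n → Concentrated ν I X A n ω → ∀ t, K < t → t ≤ n →
      K * (((otherRounds B s t ω).card : ℝ) + 1) ≤ K * (K + D + 2) * Real.log n := by
    intro n ω hn hc t ht htn
    have hlog := one_le_log hn
    have hsub : otherRounds B s t ω ⊆ Finset.Ico 1 (K + 1 + ⌈D * Real.log n⌉₊) := by
      intro u hu
      simp only [otherRounds, Finset.mem_filter, Finset.mem_Ico] at hu ⊢
      refine ⟨hu.1.1, ?_⟩
      by_contra hcon
      push Not at hcon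
      rcases hu.2 with h1 | h1
      · omega
      · refine h1 (hlead n ω hn hc u (by omega) (by omega) ?_)
        have : (⌈D * Real.log n⌉₊ : ℝ) ≤ u := by exact_mod_cast (by omega : ⌈D * Real.log n⌉₊ ≤ u)
        exact (Nat.le_ceil _).trans this
    have hcard := Finset.card_le_card hsub
    rw [Nat.card_Ico] at hcard
    have h1 : ((otherRounds B s t ω).card : ℝ) ≤ K + ⌈D * Real.log n⌉₊ := by
      exact_mod_cast (by omega : (otherRounds B s t ω).card ≤ K + ⌈D * Real.log n⌉₊)
    have h2 := Nat.ceil_lt_add_one (show 0 ≤ D * Real.log n by positivity)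
    rw [mul_assoc]
    gcongr
    nlinarith
  set G := K * (K + D + 2) with hG
  have hG0 : 0 ≤ G := by positivity
  cases p with
  | fixed β =>
    obtain ⟨hβ0, hβ1⟩ : β ∈ Ioo (0 : ℝ) 1 := id hp
    refine ⟨(K + 1) * G / β, fun n ω hn hKn hc => ?_⟩
    have hlog := one_le_log hn
    have hQn := hQ n ω hn hc n hKn le_rfl
    have hU := (h.targets_bounds hp s hKn ω).1.trans hQn
    have hS : |∑ j ∈ Finset.univ.erase s, (numPulls I n j ω : ℝ) -
        ∑ j ∈ Finset.univ.erase s, targetPulls (.fixed β) ε I B C s n j ω| ≤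
        K * (G * Real.log n) := by
      rw [← Finset.sum_sub_distrib]
      refine (Finset.abs_sum_le_sum_abs _ _).trans ?_
      refine (Finset.sum_le_card_nsmul _ _ (G * Real.log n) fun j hj => ?_).trans ?_
      · have h1 := h.numPulls_sub_targetPulls hp (Finset.mem_erase.1 hj).1 hKn ω
        rw [abs_of_nonneg h1.1]
        exact (h1.2.trans (le_mul_of_one_le_left (by positivity) hK1)).trans hQn
      · rw [nsmul_eq_mul]
        gcongr
        exact (Finset.card_le_univ _).trans (by simp)
    have hrel : (1 - β) * targetLeader (.fixed β) ε I B C s n ω =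
        β * ∑ j ∈ Finset.univ.erase s, targetPulls (.fixed β) ε I B C s n j ω := by
      simp only [targetLeader, targetPulls, propBeta, Finset.sum_const, nsmul_eq_mul,
        Finset.mul_sum]
      exact Finset.sum_congr rfl fun j _ => by ring
    simp only [balConst, balExp, pow_one, pow_zero, mul_one, Nat.sub_self]
    set N : ℝ := (numPulls I n s ω : ℝ)
    set U := targetLeader (.fixed β) ε I B C s n ω
    set M := ∑ j ∈ Finset.univ.erase s, (numPulls I n j ω : ℝ)
    set S := ∑ j ∈ Finset.univ.erase s, targetPulls (.fixed β) ε I B C s n j ω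
    have e : (1 - β) / β * N - M = ((1 - β) * (N - U) - β * (M - S)) / β := by
      field_simp
      linear_combination hrel
    rw [e, abs_div, abs_of_pos hβ0, div_mul_eq_mul_div]
    gcongr
    have h0 : 0 ≤ 1 - β := by linarith
    calc |(1 - β) * (N - U) - β * (M - S)| ≤ |(1 - β) * (N - U)| + |β * (M - S)| := abs_sub _ _
      _ = (1 - β) * |N - U| + β * |M - S| := by
        rw [abs_mul, abs_mul, abs_of_nonneg h0, abs_of_pos hβ0]
      _ ≤ 1 * (G * Real.log n) + 1 * (K * (G * Real.log n)) := by gcongr; linarith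
      _ = _ := by ring
  | ids =>
    refine ⟨6 * G + 1 + K * (2 * G), fun n ω hn hKn hc => ?_⟩
    have hlog := one_le_log hn
    have hQn := hQ n ω hn hc n hKn le_rfl
    have hinv := h.ids_invariant hε s ω (hQ n ω hn hc) hKn le_rfl
    obtain ⟨hU, hU0, hUn⟩ := h.targets_bounds hp s hKn ω
    replace hU := hU.trans hQn
    have hNle : ∀ j, (numPulls I n j ω : ℝ) ≤ n := by
      intro j
      exact_mod_cast (numPulls_le I n j ω).trans (Nat.sub_le n 1)
    have hsqdiff : ∀ a b : ℝ, 0 ≤ a → 0 ≤ b → a ≤ n → b ≤ n → |a - b| ≤ G * Real.log n →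
        |a ^ 2 - b ^ 2| ≤ 2 * (G * Real.log n) * n := by
      intro a b ha hb han hbn hab
      rw [show a ^ 2 - b ^ 2 = (a - b) * (a + b) by ring, abs_mul, abs_of_nonneg (add_nonneg ha hb)]
      calc |a - b| * (a + b) ≤ (G * Real.log n) * (n + n) := by gcongr
        _ = _ := by ring
    have hS : |∑ j ∈ Finset.univ.erase s, (numPulls I n j ω : ℝ) ^ 2 -
        ∑ j ∈ Finset.univ.erase s, targetPulls .ids ε I B C s n j ω ^ 2| ≤
        K * (2 * (G * Real.log n) * n) := by
      rw [← Finset.sum_sub_distrib]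
      refine (Finset.abs_sum_le_sum_abs _ _).trans ?_
      refine (Finset.sum_le_card_nsmul _ _ (2 * (G * Real.log n) * n) fun j hj => ?_).trans ?_
      · have h1 := h.numPulls_sub_targetPulls hp (Finset.mem_erase.1 hj).1 hKn ω
        refine hsqdiff _ _ (by positivity) ?_ (hNle j) (by linarith [hNle j]) ?_
        · exact Finset.sum_nonneg fun u _ => by linarith [(propBeta_mem (ε := ε) hp I u s j ω).2]
        · rw [abs_of_nonneg h1.1]
          exact (h1.2.trans (le_mul_of_one_le_left (by positivity) hK1)).trans hQn
      · rw [nsmul_eq_mul]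
        gcongr
        exact (Finset.card_le_univ _).trans (by simp)
    have hN := hsqdiff _ _ (by positivity) hU0 (hNle s) hUn hU
    simp only [balConst, balExp, Nat.add_one_sub_one, pow_one]
    set N : ℝ := (numPulls I n s ω : ℝ)
    set U := targetLeader .ids ε I B C s n ω
    set M := ∑ j ∈ Finset.univ.erase s, (numPulls I n j ω : ℝ) ^ 2
    set S := ∑ j ∈ Finset.univ.erase s, targetPulls .ids ε I B C s n j ω ^ 2
    have e : (1 - ε) ^ 2 * N ^ 2 - M =
        ((1 - ε) ^ 2 * U ^ 2 - S) + ((1 - ε) ^ 2 * (N ^ 2 - U ^ 2) - (M - S)) := by ring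
    have hr : (1 - ε) ^ 2 ≤ 1 := pow_le_one₀ (by linarith [hε.2]) (by linarith [hε.1])
    have hr' : |(1 - ε) ^ 2 * (N ^ 2 - U ^ 2)| ≤ 2 * (G * Real.log n) * n := by
      rw [abs_mul, abs_of_nonneg (sq_nonneg _)]
      exact (mul_le_of_le_one_left (abs_nonneg _) hr).trans hN
    rw [e]
    refine (abs_add_le _ _).trans ?_
    have h2 := abs_sub ((1 - ε) ^ 2 * (N ^ 2 - U ^ 2)) (M - S)
    have h3 : (n : ℝ) ≤ Real.log n * n := le_mul_of_one_le_left (by positivity) hlog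
    nlinarith

end Path

/-! ### Convergence of the allocation on the concentration event -/

/-- An asymptotic upper bound on each coordinate and convergence of a power sum force
convergence of the coordinates. -/
lemma tendsto_of_tendsto_sum_pow {ι α : Type*} [DecidableEq ι] {l : Filter α} {S : Finset ι}
    {f : ι → α → ℝ} {x : ι → ℝ} {q : ℕ} (hq : q ≠ 0) (hf : ∀ j ∈ S, ∀ z, 0 ≤ f j z)
    (hup : ∀ j ∈ S, ∀ η > 0, ∀ᶠ z in l, f j z ≤ x j + η)
    (hsum : Tendsto (fun z => ∑ j ∈ S, f j z ^ q) l (𝓝 (∑ j ∈ S, x j ^ q))) {j : ι} (hj : j ∈ S) :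
    Tendsto (f j) l (𝓝 (x j)) := by
  refine tendsto_order.2 ⟨fun a ha => ?_, fun a ha => ?_⟩
  · rcases lt_or_ge a 0 with ha0 | ha0
    · exact Eventually.of_forall fun z => ha0.trans_le (hf j hj z)
    have hpow : a ^ q < x j ^ q := pow_lt_pow_left₀ ha ha0 hq
    have hcont : Tendsto (fun η : ℝ => a ^ q + ∑ k ∈ S.erase j, (x k + η) ^ q) (𝓝[>] 0)
        (𝓝 (a ^ q + ∑ k ∈ S.erase j, (x k + 0) ^ q)) := by
      refine Tendsto.mono_left (Continuous.tendsto ?_ 0) nhdsWithin_le_nhds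
      fun_prop
    simp only [add_zero] at hcont
    have hlt : a ^ q + ∑ k ∈ S.erase j, x k ^ q < ∑ k ∈ S, x k ^ q := by
      rw [← Finset.add_sum_erase S _ hj]; linarith
    obtain ⟨η, hη, hηpos⟩ := ((hcont.eventually_lt_const hlt).and self_mem_nhdsWithin).exists
    have hall : ∀ᶠ z in l, ∀ k ∈ S, f k z ≤ x k + η :=
      (Finset.eventually_all S).2 fun k hk => hup k hk η hηpos
    filter_upwards [hall, hsum.eventually_const_lt hη] with z hz1 hz2
    by_contra hcon
    push Not at hcon
    rw [← Finset.add_sum_erase S _ hj] at hz2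
    have h1 : f j z ^ q ≤ a ^ q := pow_le_pow_left₀ (hf j hj z) hcon q
    have h2 : ∑ k ∈ S.erase j, f k z ^ q ≤ ∑ k ∈ S.erase j, (x k + η) ^ q :=
      Finset.sum_le_sum fun k hk => pow_le_pow_left₀ (hf k (Finset.mem_erase.1 hk).2 z)
        (hz1 k (Finset.mem_erase.1 hk).2) q
    linarith
  · filter_upwards [hup j hj ((a - x j) / 2) (by linarith)] with z hz
    linarith

section Path

variable {K : ℕ} {Ω : Type*} [mΩ : MeasurableSpace Ω] {ν : Fin K → Measure ℝ} {p : Proportions}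
  {ε : ℝ} {P : Measure Ω} {ℱ : Filtration ℕ mΩ} {I B C : ℕ → Ω → Fin K} {X : ℕ → Ω → ℝ}

/-- Convergence along this filter is convergence as the round tends to infinity, uniformly over
the outcomes of the concentration event of that round. -/
def concFilter {Ω : Type*} (ν : Fin K → Measure ℝ) (I : ℕ → Ω → Fin K) (X : ℕ → Ω → ℝ) (A : ℝ) :
    Filter (ℕ × Ω) :=
  comap Prod.fst atTop ⊓ 𝓟 {z | Concentrated ν I X A z.1 z.2}

lemma eventually_concFilter {Ω : Type*} {ν : Fin K → Measure ℝ} {I : ℕ → Ω → Fin K}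
    {X : ℕ → Ω → ℝ} {A : ℝ} {Q : ℕ × Ω → Prop} :
    (∀ᶠ z in concFilter ν I X A, Q z) ↔
      ∃ m, ∀ n ω, m ≤ n → Concentrated ν I X A n ω → Q (n, ω) := by
  rw [concFilter, eventually_inf_principal, eventually_comap, eventually_atTop]
  constructor
  · rintro ⟨m, hm⟩
    exact ⟨m, fun n ω hn hc => hm n hn (n, ω) rfl hc⟩
  · rintro ⟨m, hm⟩
    refine ⟨m, ?_⟩
    rintro n hn ⟨n', ω⟩ rfl hc
    exact hm _ ω hn hc

lemma tendsto_fst_concFilter {Ω : Type*} {ν : Fin K → Measure ℝ} {I : ℕ → Ω → Fin K}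
    {X : ℕ → Ω → ℝ} {A : ℝ} : Tendsto Prod.fst (concFilter ν I X A) atTop :=
  tendsto_comap.mono_left inf_le_left

lemma tendsto_log_div_concFilter {Ω : Type*} {ν : Fin K → Measure ℝ} {I : ℕ → Ω → Fin K}
    {X : ℕ → Ω → ℝ} {A : ℝ} (c : ℝ) :
    Tendsto (fun z : ℕ × Ω => c * (Real.log z.1 / z.1)) (concFilter ν I X A) (𝓝 0) := by
  have h : Tendsto (fun n : ℕ => c * (Real.log n / n)) atTop (𝓝 (c * 0)) :=
    ((Real.isLittleO_log_id_atTop.tendsto_div_nhds_zero).comp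
      tendsto_natCast_atTop_atTop).const_mul c
  rw [mul_zero] at h
  exact h.comp tendsto_fst_concFilter

/-- Ratio of the number of pulls of arm `j` to the number of pulls of arm `s`. -/
noncomputable def pullRatio {Ω : Type*} (I : ℕ → Ω → Fin K) (s j : Fin K) (z : ℕ × Ω) : ℝ :=
  numPulls I z.1 j z.2 / numPulls I z.1 s z.2

lemma IsRun.eventually_linear (hK : 0 < K) (hν : IsInstance ν) (hε : ε ∈ Ioo (0 : ℝ) 1)
    (hp : p.Valid) (h : IsRun ν p ε P ℱ I B C X) {A : ℝ} (hA : 0 < A) :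
    ∃ κ : ℝ, 0 < κ ∧ ∀ᶠ z in concFilter ν I X A, 3 ≤ z.1 ∧ K < z.1 ∧
      Concentrated ν I X A z.1 z.2 ∧ ∀ k, κ * z.1 ≤ numPulls I z.1 k z.2 := by
  obtain ⟨κ, D, hκ, hD, hexp⟩ := h.linear_exploration hK hν hε hp hA
  refine ⟨κ / 2, by positivity, ?_⟩
  have hc : ∀ᶠ z in concFilter ν I X A, Concentrated ν I X A z.1 z.2 :=
    eventually_concFilter.2 ⟨0, fun n ω _ h => h⟩
  filter_upwards [hc, tendsto_fst_concFilter.eventually_ge_atTop 3,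
    tendsto_fst_concFilter.eventually_gt_atTop K,
    (tendsto_log_div_concFilter D).eventually_lt_const (show 0 < κ / 2 by positivity)]
    with z h1 h2 h3 h4
  refine ⟨h2, h3, h1, fun k => ?_⟩
  have h5 := hexp z.1 z.2 h2 h1 z.1 h3 le_rfl k
  have hz : (0 : ℝ) < z.1 := by exact_mod_cast (by omega : 0 < z.1)
  rw [← mul_div_assoc, div_lt_iff₀ hz] at h4
  linarith

lemma IsRun.tendsto_empMean (hK : 0 < K) (hν : IsInstance ν) (hε : ε ∈ Ioo (0 : ℝ) 1)
    (hp : p.Valid) (h : IsRun ν p ε P ℱ I B C X) {A : ℝ} (hA : 0 < A) (i : Fin K) :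
    Tendsto (fun z : ℕ × Ω => empMean I X z.1 i z.2) (concFilter ν I X A) (𝓝 (means ν i)) := by
  obtain ⟨κ, hκ, hlin⟩ := h.eventually_linear hK hν hε hp hA
  have hsq : Tendsto (fun z : ℕ × Ω => (empMean I X z.1 i z.2 - means ν i) ^ 2)
      (concFilter ν I X A) (𝓝 0) := by
    refine squeeze_zero' (Eventually.of_forall fun z => sq_nonneg _) ?_
      (tendsto_log_div_concFilter (A / κ))
    filter_upwards [hlin] with z ⟨h1, h2, hc, hN⟩
    have hz : (0 : ℝ) < z.1 := by exact_mod_cast (by omega : 0 < z.1)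
    have h3 := hc z.1 h2 le_rfl i
    rw [div_mul_div_comm, le_div_iff₀ (by positivity), mul_comm]
    exact (mul_le_mul_of_nonneg_right (hN i) (sq_nonneg _)).trans h3
  rw [tendsto_iff_norm_sub_tendsto_zero]
  have := hsq.sqrt
  simpa [Real.sqrt_sq_eq_abs] using this

lemma IsRun.eventually_leader (hK : 0 < K) (hν : IsInstance ν) (hε : ε ∈ Ioo (0 : ℝ) 1)
    (hp : p.Valid) (h : IsRun ν p ε P ℱ I B C X) {s : Fin K}
    (hs : ∀ i, i ≠ s → means ν i < means ν s) {A : ℝ} (hA : 0 < A) :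
    ∀ᶠ z in concFilter ν I X A, B z.1 z.2 = s := by
  obtain ⟨D, hD, hlead⟩ := h.leader_eq hK hν hε hp hs hA
  obtain ⟨κ, hκ, hlin⟩ := h.eventually_linear hK hν hε hp hA
  filter_upwards [hlin, (tendsto_log_div_concFilter D).eventually_lt_const one_pos]
    with z ⟨h1, h2, hc, hN⟩ h3
  refine hlead z.1 z.2 h1 hc z.1 h2 le_rfl ?_
  have hz : (0 : ℝ) < z.1 := by exact_mod_cast (by omega : 0 < z.1)
  rw [← mul_div_assoc, div_lt_one hz] at h3
  exact h3.le

lemma balExp_ne_zero (p : Proportions) : balExp p ≠ 0 := by cases p <;> simp [balExp]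

lemma balConst_pos (hp : p.Valid) (hε : ε ∈ Ioo (0 : ℝ) 1) : 0 < balConst ε p := by
  cases p with
  | ids =>
    have : 0 < 1 - ε := by linarith [hε.2]
    simp only [balConst]; positivity
  | fixed β => exact div_pos (by linarith [hp.2]) hp.1

lemma IsRun.tendsto_sum_pullRatio (hK : 0 < K) (hν : IsInstance ν) (hε : ε ∈ Ioo (0 : ℝ) 1)
    (hp : p.Valid) (h : IsRun ν p ε P ℱ I B C X) {s : Fin K}
    (hs : ∀ i, i ≠ s → means ν i < means ν s) {A : ℝ} (hA : 0 < A) :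
    Tendsto (fun z : ℕ × Ω => ∑ j ∈ Finset.univ.erase s, pullRatio I s j z ^ balExp p)
      (concFilter ν I X A) (𝓝 (balConst ε p)) := by
  obtain ⟨D, hbal⟩ := h.balance hK hν hε hp hs hA
  obtain ⟨κ, hκ, hlin⟩ := h.eventually_linear hK hν hε hp hA
  rw [tendsto_iff_norm_sub_tendsto_zero]
  refine squeeze_zero' (Eventually.of_forall fun z => norm_nonneg _) ?_
    (tendsto_log_div_concFilter (D / κ ^ balExp p))
  filter_upwards [hlin] with z ⟨h1, h2, hc, hN⟩
  have hz : (0 : ℝ) < z.1 := by exact_mod_cast (by omega : 0 < z.1)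
  have hb := hbal z.1 z.2 h1 h2 hc
  have hNs : 0 < (numPulls I z.1 s z.2 : ℝ) := (by positivity : 0 < κ * z.1).trans_le (hN s)
  have hNs' : κ ^ balExp p * (z.1 : ℝ) ^ balExp p ≤ (numPulls I z.1 s z.2 : ℝ) ^ balExp p := by
    rw [← mul_pow]
    exact pow_le_pow_left₀ (by positivity) (hN s) _
  have hq : (z.1 : ℝ) ^ balExp p = z.1 ^ (balExp p - 1) * z.1 := by
    rw [← pow_succ, Nat.sub_add_cancel (Nat.one_le_iff_ne_zero.2 (balExp_ne_zero p))]
  set N := (numPulls I z.1 s z.2 : ℝ)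
  set M := ∑ j ∈ Finset.univ.erase s, (numPulls I z.1 j z.2 : ℝ) ^ balExp p with hM
  have hsum : ∑ j ∈ Finset.univ.erase s, pullRatio I s j z ^ balExp p = M / N ^ balExp p := by
    simp only [pullRatio, div_pow, ← Finset.sum_div]
    rfl
  have e : ‖M / N ^ balExp p - balConst ε p‖ =
      |balConst ε p * N ^ balExp p - M| / N ^ balExp p := by
    rw [Real.norm_eq_abs, abs_sub_comm, ← abs_of_pos (show 0 < N ^ balExp p by positivity),
      ← abs_div, abs_of_pos (show 0 < N ^ balExp p by positivity)]
    congr 1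
    field_simp
  rw [hsum, e]
  have hD0 : 0 ≤ D * Real.log z.1 * z.1 ^ (balExp p - 1) := (abs_nonneg _).trans hb
  calc _ ≤ (D * Real.log z.1 * z.1 ^ (balExp p - 1)) / (κ ^ balExp p * z.1 ^ balExp p) :=
        div_le_div₀ hD0 hb (by positivity) hNs'
    _ = _ := by rw [hq]; field_simp

/-- The last pull of each arm lies in a round of linear order (the arm has linearly many pulls), so
that asymptotic statements apply to that round; the constant of the concentration event doubles. -/
lemma IsRun.eventually_last_pull (hK : 0 < K) (hν : IsInstance ν) (hε : ε ∈ Ioo (0 : ℝ) 1)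
    (hp : p.Valid) (h : IsRun ν p ε P ℱ I B C X) {A : ℝ} (hA : 0 < A) (j : Fin K)
    {Q : ℕ × Ω → Prop} (hQ : ∀ᶠ z in concFilter ν I X (2 * A), Q z) :
    ∀ᶠ z in concFilter ν I X A, ∃ m, K < m ∧ m < z.1 ∧ I m z.2 = j ∧
      numPulls I z.1 j z.2 = numPulls I m j z.2 + 1 ∧ Q (m, z.2) := by
  obtain ⟨κ, hκ, hlin⟩ := h.eventually_linear hK hν hε hp hA
  obtain ⟨m0, hm0⟩ := eventually_concFilter.1 hQ
  have hlast : ∀ n, 1 ≤ n → ∀ ω, 1 ≤ numPulls I n j ω → ∃ m, 1 ≤ m ∧ m < n ∧ I m ω = j ∧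
      numPulls I n j ω = numPulls I m j ω + 1 := by
    intro n hn ω
    induction n, hn using Nat.le_induction with
    | base => intro h0; rw [numPulls_one] at h0; omega
    | succ n hn ih =>
      intro h0
      rw [numPulls_succ I hn] at h0 ⊢
      by_cases hI : I n ω = j
      · exact ⟨n, hn, by omega, hI, by rw [if_pos hI]⟩
      · rw [if_neg hI, add_zero] at h0 ⊢
        obtain ⟨m, h1, h2, h3⟩ := ih h0
        exact ⟨m, h1, by omega, h3⟩
  have hnat : Tendsto (fun z : ℕ × Ω => κ * (z.1 : ℝ)) (concFilter ν I X A) atTop :=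
    (tendsto_natCast_atTop_atTop.comp tendsto_fst_concFilter).const_mul_atTop hκ
  have hnat2 : Tendsto (fun z : ℕ × Ω => (z.1 : ℝ)) (concFilter ν I X A) atTop :=
    tendsto_natCast_atTop_atTop.comp tendsto_fst_concFilter
  filter_upwards [hlin, hnat.eventually_ge_atTop (m0 + K + 2 : ℝ),
    hnat2.eventually_ge_atTop (1 / κ ^ 2)] with z ⟨h1, h2, hc, hN⟩ h3 h4
  have hNj := hN j
  obtain ⟨m, hm1, hmn, hI, hNm⟩ := hlast z.1 (by omega) z.2 (h.one_le_numPulls h2 j z.2)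
  have hmN := numPulls_le I m j z.2
  have hκm : κ * z.1 ≤ m := by
    refine hNj.trans ?_
    exact_mod_cast (by omega : numPulls I z.1 j z.2 ≤ m)
  have hm : m0 + K + 2 ≤ m := by exact_mod_cast h3.trans hκm
  refine ⟨m, by omega, hmn, hI, hNm, hm0 m z.2 (by omega) ?_⟩
  -- since `κ n ≤ m` and `1 / κ² ≤ n`, `log n ≤ 2 log m`
  intro t ht htm i
  refine (hc t ht (by omega) i).trans ?_
  have hz : (0 : ℝ) < z.1 := by exact_mod_cast (by omega : 0 < z.1)
  have hlog : Real.log z.1 ≤ 2 * Real.log m := by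
    rw [show 2 * Real.log (m : ℝ) = Real.log ((m : ℝ) ^ 2) by rw [Real.log_pow]; norm_num]
    apply Real.log_le_log hz
    rw [div_le_iff₀ (by positivity)] at h4
    calc (z.1 : ℝ) = z.1 * 1 := (mul_one _).symm
      _ ≤ z.1 * (z.1 * κ ^ 2) := by gcongr
      _ = (κ * z.1) ^ 2 := by ring
      _ ≤ (m : ℝ) ^ 2 := by gcongr
  calc A * Real.log z.1 ≤ A * (2 * Real.log m) := by gcongr
    _ = _ := by ring

lemma sq_cost_eq {Ω : Type*} (ε : ℝ) (I : ℕ → Ω → Fin K) (X : ℕ → Ω → ℝ) {s j : Fin K} (z : ℕ × Ω)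
    (hs : 1 ≤ numPulls I z.1 s z.2) (hj : 1 ≤ numPulls I z.1 j z.2) :
    cost ε I X z.1 s j z.2 ^ 2 = numPulls I z.1 s z.2 *
      ((empMean I X z.1 s z.2 - (1 - ε) * empMean I X z.1 j z.2) ^ 2 *
      (pullRatio I s j z / (pullRatio I s j z + (1 - ε) ^ 2))) := by
  have h1 : (0 : ℝ) < numPulls I z.1 s z.2 := by exact_mod_cast hs
  have h2 : (0 : ℝ) < numPulls I z.1 j z.2 := by exact_mod_cast hj
  rw [cost, div_pow, Real.sq_sqrt (by positivity), pullRatio]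
  field_simp

/-- The limiting allocation: relative to the best arm `s`, arm `j` receives `x j` pulls. The
transportation costs are all equal to `v` (per pull of `s`). -/
structure IsBalanced (ε : ℝ) (p : Proportions) (μ : Fin K → ℝ) (s : Fin K) (x : Fin K → ℝ)
    (v : ℝ) : Prop where
  pos : ∀ j, j ≠ s → 0 < x j
  cost_eq : ∀ j, j ≠ s → (μ s - (1 - ε) * μ j) ^ 2 * (x j / (x j + (1 - ε) ^ 2)) = v
  sum_pow : ∑ j ∈ Finset.univ.erase s, x j ^ balExp p = balConst ε p

lemma div_add_lt_div_add {a b c : ℝ} (ha : 0 ≤ a) (hc : 0 < c) (hab : a < b) :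
    a / (a + c) < b / (b + c) := by
  rw [div_lt_div_iff₀ (by linarith) (by linarith)]
  nlinarith

lemma div_add_le_div_add {a b c : ℝ} (ha : 0 ≤ a) (hc : 0 < c) (hab : a ≤ b) :
    a / (a + c) ≤ b / (b + c) := by
  rcases hab.eq_or_lt with rfl | h
  · exact le_rfl
  · exact (div_add_lt_div_add ha hc h).le

/-- An arm which exceeds its limiting ratio is not chosen as a challenger. -/
lemma IsRun.eventually_challenger_le (hK : 0 < K) (hν : IsInstance ν) (hε : ε ∈ Ioo (0 : ℝ) 1)
    (hp : p.Valid) (h : IsRun ν p ε P ℱ I B C X) {s : Fin K}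
    (hs : ∀ i, i ≠ s → means ν i < means ν s) {x : Fin K → ℝ} {v : ℝ}
    (hx : IsBalanced ε p (means ν) s x v) {A : ℝ} (hA : 0 < A) {j : Fin K} (hj : j ≠ s) {η : ℝ}
    (hη : 0 < η) :
    ∀ᶠ z in concFilter ν I X A, C z.1 z.2 = j → pullRatio I s j z ≤ x j + η := by
  have hr : 0 < 1 - ε := by linarith [hε.2]
  have hr2 : 0 < (1 - ε) ^ 2 := by positivity
  have hΔ : ∀ k, k ≠ s → 0 < means ν s - (1 - ε) * means ν k := by
    intro k hk
    have h1 := hs k hk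
    have h2 := (hν k).2
    nlinarith [hε.1]
  have hmem : j ∈ Finset.univ.erase s := Finset.mem_erase.2 ⟨hj, Finset.mem_univ _⟩
  set H : ℝ → ℝ := fun y => y / (y + (1 - ε) ^ 2) with hH
  have hv : v < (means ν s - (1 - ε) * means ν j) ^ 2 * H (x j + η) := by
    rw [← hx.cost_eq j hj]
    have := hΔ j hj
    exact mul_lt_mul_of_pos_left (div_add_lt_div_add (hx.pos j hj).le hr2 (by linarith))
      (by positivity)
  -- a margin `e` for the arms which are below their limiting ratio
  have hmargin : ∀ᶠ e in 𝓝[>] (0 : ℝ), ∀ k ∈ Finset.univ.erase s,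
      (means ν s - (1 - ε) * means ν k) ^ 2 * H (x k + e) <
        (means ν s - (1 - ε) * means ν j) ^ 2 * H (x j + η) := by
    refine (Finset.eventually_all _).2 fun k hk => ?_
    have hk' := (Finset.mem_erase.1 hk).1
    have hxk := hx.pos k hk'
    have hc : ContinuousAt (fun e : ℝ =>
        (means ν s - (1 - ε) * means ν k) ^ 2 * H (x k + e)) 0 := by
      simp only [hH]
      refine ContinuousAt.mul continuousAt_const (ContinuousAt.div (by fun_prop) (by fun_prop) ?_)
      positivity
    have ht := hc.tendsto.mono_left (nhdsWithin_le_nhds (s := Ioi 0))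
    refine ht.eventually_lt_const ?_
    simpa [hH, hx.cost_eq k hk'] using hv
  obtain ⟨e, he, he0⟩ := (hmargin.and self_mem_nhdsWithin).exists
  have he0' : 0 < e := he0
  have hmean := fun k => h.tendsto_empMean hK hν hε hp hA k
  have hD : ∀ k, Tendsto (fun z : ℕ × Ω => empMean I X z.1 s z.2 - (1 - ε) * empMean I X z.1 k z.2)
      (concFilter ν I X A) (𝓝 (means ν s - (1 - ε) * means ν k)) := fun k =>
    (hmean s).sub ((hmean k).const_mul _)
  have hlt : ∀ᶠ z in concFilter ν I X A, ∀ k ∈ Finset.univ.erase s,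
      (empMean I X z.1 s z.2 - (1 - ε) * empMean I X z.1 k z.2) ^ 2 * H (x k + e) <
      (empMean I X z.1 s z.2 - (1 - ε) * empMean I X z.1 j z.2) ^ 2 * H (x j + η) :=
    (Finset.eventually_all _).2 fun k hk =>
      (((hD k).pow 2).mul_const _).eventually_lt (((hD j).pow 2).mul_const _) (he k hk)
  have hsum : ∀ᶠ z in concFilter ν I X A, ∑ k ∈ Finset.univ.erase s, pullRatio I s k z ^ balExp p <
      ∑ k ∈ Finset.univ.erase s, (x k + e) ^ balExp p := by
    refine (h.tendsto_sum_pullRatio hK hν hε hp hs hA).eventually_lt_const ?_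
    rw [← hx.sum_pow]
    refine Finset.sum_lt_sum_of_nonempty ⟨j, hmem⟩ fun k hk => ?_
    exact pow_lt_pow_left₀ (by linarith) (hx.pos k (Finset.mem_erase.1 hk).1).le
      (balExp_ne_zero p)
  obtain ⟨κ, hκ, hlin⟩ := h.eventually_linear hK hν hε hp hA
  filter_upwards [hlt, hsum, hlin, h.eventually_leader hK hν hε hp hs hA,
    (hD j).eventually_const_lt (hΔ j hj)] with z h1 h2 ⟨_, h3, _, _⟩ hB hDj hC
  obtain ⟨k, hk, hkx⟩ := Finset.exists_lt_of_sum_lt h2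
  have hk' := (Finset.mem_erase.1 hk).1
  have hNs := h.one_le_numPulls h3 s z.2
  have hNk := h.one_le_numPulls h3 k z.2
  have hNj := h.one_le_numPulls h3 j z.2
  have hxk := hx.pos k hk'
  have hkx' : pullRatio I s k z < x k + e := lt_of_pow_lt_pow_left₀ _ (by linarith) hkx
  have hcost := h.challenger z.1 h3 z.2 k (by rw [hB]; exact hk')
  rw [hB, hC] at hcost
  have hcj : 0 ≤ cost ε I X z.1 s j z.2 := div_nonneg hDj.le (Real.sqrt_nonneg _)
  have hsq := pow_le_pow_left₀ hcj hcost 2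
  rw [sq_cost_eq ε I X z hNs hNj, sq_cost_eq ε I X z hNs hNk] at hsq
  have hsq' := le_of_mul_le_mul_left hsq (by exact_mod_cast hNs)
  have hHk : H (pullRatio I s k z) ≤ H (x k + e) :=
    div_add_le_div_add (by unfold pullRatio; positivity) hr2 hkx'.le
  have h5 := mul_le_mul_of_nonneg_left hHk
    (sq_nonneg (empMean I X z.1 s z.2 - (1 - ε) * empMean I X z.1 k z.2))
  by_contra hcon
  push Not at hcon
  have hHj : H (x j + η) ≤ H (pullRatio I s j z) :=
    div_add_le_div_add (by linarith [hx.pos j hj]) hr2 hcon.le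
  have h6 := mul_le_mul_of_nonneg_left hHj
    (sq_nonneg (empMean I X z.1 s z.2 - (1 - ε) * empMean I X z.1 j z.2))
  linarith [h1 k hk]

/-- After its last pull as a challenger, the ratio of an arm can only decrease. -/
lemma IsRun.eventually_pullRatio_le (hK : 0 < K) (hν : IsInstance ν) (hε : ε ∈ Ioo (0 : ℝ) 1)
    (hp : p.Valid) (h : IsRun ν p ε P ℱ I B C X) {s : Fin K}
    (hs : ∀ i, i ≠ s → means ν i < means ν s) {x : Fin K → ℝ} {v : ℝ}
    (hx : IsBalanced ε p (means ν) s x v) {A : ℝ} (hA : 0 < A) {j : Fin K} (hj : j ≠ s) {η : ℝ}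
    (hη : 0 < η) :
    ∀ᶠ z in concFilter ν I X A, pullRatio I s j z ≤ x j + η := by
  have hA2 : 0 < 2 * A := by positivity
  obtain ⟨κ, hκ, hlin⟩ := h.eventually_linear hK hν hε hp hA2
  have hnat : Tendsto (fun z : ℕ × Ω => κ * (z.1 : ℝ)) (concFilter ν I X (2 * A)) atTop :=
    (tendsto_natCast_atTop_atTop.comp tendsto_fst_concFilter).const_mul_atTop hκ
  have hQ : ∀ᶠ z in concFilter ν I X (2 * A), B z.1 z.2 = s ∧
      (C z.1 z.2 = j → pullRatio I s j z ≤ x j + η / 2) ∧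
      2 / η ≤ numPulls I z.1 s z.2 := by
    filter_upwards [h.eventually_leader hK hν hε hp hs hA2,
      h.eventually_challenger_le hK hν hε hp hs hx hA2 hj (half_pos hη), hlin,
      hnat.eventually_ge_atTop (2 / η)] with z h1 h2 h3 h4
    exact ⟨h1, h2, h4.trans (h3.2.2.2 s)⟩
  filter_upwards [h.eventually_last_pull hK hν hε hp hA j hQ] with z
  rintro ⟨m, hKm, hmn, hI, hN, hB, hC, hNs⟩
  have hCj : C m z.2 = j := by
    rcases h.arm_eq_or hKm z.2 with h1 | h1
    · exact absurd (hI.symm.trans (h1.trans hB)) hj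
    · exact h1.symm.trans hI
  have hratio := hC hCj
  simp only [pullRatio] at hratio hNs ⊢
  have hpos : (0 : ℝ) < numPulls I m s z.2 := by
    exact_mod_cast h.one_le_numPulls hKm s z.2
  have hmono : (numPulls I m s z.2 : ℝ) ≤ numPulls I z.1 s z.2 := by
    exact_mod_cast numPulls_mono I s z.2 hmn.le
  rw [hN]
  push_cast
  calc ((numPulls I m j z.2 : ℝ) + 1) / numPulls I z.1 s z.2
      ≤ ((numPulls I m j z.2 : ℝ) + 1) / numPulls I m s z.2 := by gcongr
    _ = (numPulls I m j z.2 : ℝ) / numPulls I m s z.2 + 1 / numPulls I m s z.2 := add_div _ _ _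
    _ ≤ (x j + η / 2) + η / 2 := by
      refine add_le_add hratio ?_
      rw [div_le_iff₀ hη] at hNs
      rw [div_le_iff₀ hpos]
      linarith
    _ = x j + η := by ring

/-- Uniformly on the concentration event, the squared transportation costs grow linearly with the
optimal rate. -/
lemma IsRun.tendsto_sq_cost_div (hK : 0 < K) (hν : IsInstance ν) (hε : ε ∈ Ioo (0 : ℝ) 1)
    (hp : p.Valid) (h : IsRun ν p ε P ℱ I B C X) {s : Fin K}
    (hs : ∀ i, i ≠ s → means ν i < means ν s) {x : Fin K → ℝ} {v : ℝ}
    (hx : IsBalanced ε p (means ν) s x v) {A : ℝ} (hA : 0 < A) {j : Fin K} (hj : j ≠ s) :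
    Tendsto (fun z : ℕ × Ω => cost ε I X z.1 s j z.2 ^ 2 / z.1) (concFilter ν I X A)
      (𝓝 (v / (1 + ∑ k ∈ Finset.univ.erase s, x k))) := by
  have hr : 0 < 1 - ε := by linarith [hε.2]
  have hratio : ∀ k ∈ Finset.univ.erase s,
      Tendsto (pullRatio I s k) (concFilter ν I X A) (𝓝 (x k)) := by
    intro k hk
    refine tendsto_of_tendsto_sum_pow (balExp_ne_zero p) (S := Finset.univ.erase s)
      (fun k _ z => by unfold pullRatio; positivity)
      (fun k hk η hη => h.eventually_pullRatio_le hK hν hε hp hs hx hA (Finset.mem_erase.1 hk).1 hη)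
      ?_ hk
    rw [hx.sum_pow]
    exact h.tendsto_sum_pullRatio hK hν hε hp hs hA
  have hsum0 : 0 < 1 + ∑ k ∈ Finset.univ.erase s, x k := by
    have := Finset.sum_nonneg fun k (hk : k ∈ Finset.univ.erase s) =>
      (hx.pos k (Finset.mem_erase.1 hk).1).le
    linarith
  have hinv : Tendsto (fun z : ℕ × Ω => (1 - ((z.1 : ℝ))⁻¹) /
      (1 + ∑ k ∈ Finset.univ.erase s, pullRatio I s k z)) (concFilter ν I X A)
      (𝓝 ((1 - 0) / (1 + ∑ k ∈ Finset.univ.erase s, x k))) := by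
    refine Tendsto.div (tendsto_const_nhds.sub ?_)
      (tendsto_const_nhds.add (tendsto_finsetSum _ hratio)) hsum0.ne'
    exact tendsto_inv_atTop_zero.comp
      (tendsto_natCast_atTop_atTop.comp tendsto_fst_concFilter)
  obtain ⟨κ, hκ, hlin⟩ := h.eventually_linear hK hν hε hp hA
  have hNs : Tendsto (fun z : ℕ × Ω => (numPulls I z.1 s z.2 : ℝ) / z.1) (concFilter ν I X A)
      (𝓝 (1 / (1 + ∑ k ∈ Finset.univ.erase s, x k))) := by
    rw [sub_zero] at hinv
    refine hinv.congr' ?_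
    filter_upwards [hlin] with z ⟨h1, h2, hc, hN⟩
    have hz : (0 : ℝ) < z.1 := by exact_mod_cast (by omega : 0 < z.1)
    have hpos : (0 : ℝ) < numPulls I z.1 s z.2 := by
      exact_mod_cast h.one_le_numPulls h2 s z.2
    have hsum : (numPulls I z.1 s z.2 : ℝ) + ∑ k ∈ Finset.univ.erase s,
        (numPulls I z.1 k z.2 : ℝ) = z.1 - 1 := by
      rw [Finset.add_sum_erase _ (fun k => (numPulls I z.1 k z.2 : ℝ)) (Finset.mem_univ s),
        ← Nat.cast_sum, sum_numPulls, Nat.cast_sub (by omega)]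
      simp
    have e : 1 + ∑ k ∈ Finset.univ.erase s, pullRatio I s k z =
        (z.1 - 1) / numPulls I z.1 s z.2 := by
      simp only [pullRatio, ← Finset.sum_div]
      rw [← hsum]
      field_simp
    have hz1 : (0 : ℝ) < z.1 - 1 := by
      have : (3 : ℝ) ≤ z.1 := by exact_mod_cast h1
      linarith
    rw [e]
    field_simp
  have hmean := fun k => h.tendsto_empMean hK hν hε hp hA k
  have hξ := hratio j (Finset.mem_erase.2 ⟨hj, Finset.mem_univ _⟩)
  have hxj := hx.pos j hj
  have hlim := hNs.mul ((((hmean s).sub ((hmean j).const_mul (1 - ε))).pow 2).mul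
    (hξ.div (hξ.add_const ((1 - ε) ^ 2)) (by positivity)))
  rw [hx.cost_eq j hj, one_div_mul_eq_div] at hlim
  refine hlim.congr' ?_
  filter_upwards [hlin] with z ⟨_, h2, _, _⟩
  rw [sq_cost_eq ε I X z (h.one_le_numPulls h2 s z.2) (h.one_le_numPulls h2 j z.2)]
  simp only [Pi.div_apply]
  ring

lemma IsRun.eventually_sq_cost_ge (hK : 0 < K) (hν : IsInstance ν) (hε : ε ∈ Ioo (0 : ℝ) 1)
    (hp : p.Valid) (h : IsRun ν p ε P ℱ I B C X) {s : Fin K}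
    (hs : ∀ i, i ≠ s → means ν i < means ν s) {x : Fin K → ℝ} {v : ℝ}
    (hx : IsBalanced ε p (means ν) s x v) {A : ℝ} (hA : 0 < A) {V : ℝ}
    (hV : V < v / (1 + ∑ k ∈ Finset.univ.erase s, x k)) :
    ∃ m, ∀ n ω, m ≤ n → Concentrated ν I X A n ω → K < n ∧ B n ω = s ∧ ∀ j, j ≠ s →
      0 ≤ cost ε I X n s j ω ∧ V * n ≤ cost ε I X n s j ω ^ 2 := by
  rw [← eventually_concFilter (Q := fun z : ℕ × Ω => K < z.1 ∧ B z.1 z.2 = s ∧ ∀ j, j ≠ s →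
      0 ≤ cost ε I X z.1 s j z.2 ∧ V * z.1 ≤ cost ε I X z.1 s j z.2 ^ 2)]
  have hall : ∀ᶠ z in concFilter ν I X A, ∀ j ∈ Finset.univ.erase s,
      V < cost ε I X z.1 s j z.2 ^ 2 / z.1 :=
    (Finset.eventually_all _).2 fun j hj =>
      (h.tendsto_sq_cost_div hK hν hε hp hs hx hA (Finset.mem_erase.1 hj).1).eventually_const_lt hV
  have hnum : ∀ᶠ z in concFilter ν I X A, ∀ j ∈ Finset.univ.erase s,
      0 < empMean I X z.1 s z.2 - (1 - ε) * empMean I X z.1 j z.2 := by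
    refine (Finset.eventually_all _).2 fun j hj => ?_
    refine ((h.tendsto_empMean hK hν hε hp hA s).sub
      ((h.tendsto_empMean hK hν hε hp hA j).const_mul _)).eventually_const_lt ?_
    have h1 := hs j (Finset.mem_erase.1 hj).1
    have h2 := (hν j).2
    nlinarith [hε.1]
  filter_upwards [hall, hnum, h.eventually_leader hK hν hε hp hs hA,
    tendsto_fst_concFilter.eventually_gt_atTop K] with z h1 h2 h3 h4
  refine ⟨h4, h3, fun j hj => ?_⟩
  have hmem : j ∈ Finset.univ.erase s := Finset.mem_erase.2 ⟨hj, Finset.mem_univ _⟩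
  have hz : (0 : ℝ) < z.1 := by exact_mod_cast (by omega : 0 < z.1)
  have h5 := h1 j hmem
  rw [lt_div_iff₀ hz] at h5
  exact ⟨div_nonneg (h2 j hmem).le (Real.sqrt_nonneg _), h5.le⟩

end Path

/-! ### Characteristic times -/

section CharTime

variable {K : ℕ} {ε : ℝ} {p : Proportions} {μ : Fin K → ℝ} {s : Fin K}

/-- The gaps `μ s - (1 - ε) μ j` are positive. -/
lemma gap_pos (hε : ε ∈ Ioo (0 : ℝ) 1) (hμ : ∀ i, 0 < μ i) (hs : ∀ i, μ i ≤ μ s) (j : Fin K) :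
    0 < μ s - (1 - ε) * μ j := by
  nlinarith [hε.1, hμ j, hs j]

/-- The balanced allocation exists: it is parametrised by the ratio of the second best arm, and
the constraint is met by the intermediate value theorem. -/
lemma exists_isBalanced (hK : 2 ≤ K) (hε : ε ∈ Ioo (0 : ℝ) 1) (hp : p.Valid) (hμ : ∀ i, 0 < μ i)
    (hs : ∀ i, μ i ≤ μ s) : ∃ x v, 0 < v ∧ IsBalanced ε p μ s x v := by
  have hr : 0 < 1 - ε := by linarith [hε.2]
  have hne : (Finset.univ.erase s).Nonempty := by
    rw [← Finset.card_pos, Finset.card_erase_of_mem (Finset.mem_univ _), Finset.card_univ,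
      Fintype.card_fin]
    omega
  obtain ⟨k, hk, hmax⟩ := Finset.exists_max_image _ μ hne
  set R := (1 - ε) ^ 2 with hR
  have hR0 : 0 < R := by positivity
  set D : Fin K → ℝ := fun j => (μ s - (1 - ε) * μ j) ^ 2 with hD
  have hDpos : ∀ j, 0 < D j := fun j => by have := gap_pos hε hμ hs j; positivity
  have hDk : ∀ j, j ≠ s → D k ≤ D j := by
    intro j hj
    have h1 := hmax j (Finset.mem_erase.2 ⟨hj, Finset.mem_univ _⟩)
    exact pow_le_pow_left₀ (gap_pos hε hμ hs k).le (by nlinarith) 2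
  set f : Fin K → ℝ → ℝ := fun j y => R * D k * y / (D j * (y + R) - D k * y) with hf
  have hden : ∀ j, j ≠ s → ∀ y, 0 ≤ y → 0 < D j * (y + R) - D k * y := by
    intro j hj y hy
    have h1 := mul_le_mul_of_nonneg_right (hDk j hj) hy
    have h2 := mul_pos (hDpos j) hR0
    nlinarith
  have hc := balConst_pos hp hε
  set c := balConst ε p
  have hq := balExp_ne_zero p
  have hcont : ContinuousOn (fun y => ∑ j ∈ Finset.univ.erase s, f j y ^ balExp p)
      (Icc 0 (1 + c)) := by
    refine continuousOn_finsetSum _ fun j hj => ?_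
    refine ContinuousOn.pow (ContinuousOn.div (by fun_prop) (by fun_prop) fun y hy => ?_) _
    exact (hden j (Finset.mem_erase.1 hj).1 y hy.1).ne'
  have h0 : ∑ j ∈ Finset.univ.erase s, f j 0 ^ balExp p = 0 := by
    refine Finset.sum_eq_zero fun j _ => ?_
    simp [hf, hq]
  have h1 : c ≤ ∑ j ∈ Finset.univ.erase s, f j (1 + c) ^ balExp p := by
    have hfk : f k (1 + c) = 1 + c := by
      have := hDpos k
      have e : D k * (1 + c + R) - D k * (1 + c) = D k * R := by ring
      simp only [hf]
      rw [e]
      field_simp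
    have h2 : f k (1 + c) ^ balExp p ≤ ∑ j ∈ Finset.univ.erase s, f j (1 + c) ^ balExp p := by
      refine Finset.single_le_sum (f := fun j => f j (1 + c) ^ balExp p) (fun j hj => ?_) hk
      have := hden j (Finset.mem_erase.1 hj).1 (1 + c) (by linarith)
      have := hDpos k
      positivity
    rw [hfk] at h2
    linarith [le_self_pow₀ (show 1 ≤ 1 + c by linarith) hq]
  obtain ⟨y, ⟨hy0, _⟩, hy⟩ := intermediate_value_Icc (by linarith) hcont
    (show c ∈ Icc _ _ from ⟨by rw [h0]; exact hc.le, h1⟩)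
  have hypos : 0 < y := by
    rcases hy0.eq_or_lt with h | h
    · rw [← h] at hy
      exact absurd (h0.symm.trans hy) hc.ne
    · exact h
  have hDkp := hDpos k
  refine ⟨fun j => f j y, D k * y / (y + R), by positivity, ⟨fun j hj => ?_, fun j hj => ?_, hy⟩⟩
  · have := hden j hj y hy0
    simp only [hf]; positivity
  · have h2 := hden j hj y hy0
    have h3 := hDpos j
    have e : f j y + R = R * D j * (y + R) / (D j * (y + R) - D k * y) := by
      simp only [hf]
      field_simp
      ring
    change D j * (f j y / (f j y + R)) = _
    rw [e]
    simp only [hf]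
    field_simp

lemma cost_term_le {Δ r b w Z : ℝ} (hr : 0 < r) (hb : 0 < b) (hw : 0 ≤ w)
    (h : 0 < w → Δ ^ 2 / (1 / b + r ^ 2 / w) ≤ Z) :
    ENNReal.ofReal (Δ ^ 2) / (1 / ENNReal.ofReal b + ENNReal.ofReal (r ^ 2) / ENNReal.ofReal w) ≤
      ENNReal.ofReal Z := by
  rcases hw.eq_or_lt with rfl | hw
  · have : ENNReal.ofReal (r ^ 2) / ENNReal.ofReal 0 = ⊤ := by
      rw [ENNReal.ofReal_zero, ENNReal.div_zero]
      simpa using hr.ne'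
    rw [this, add_top, ENNReal.div_top]
    exact zero_le
  · rw [← ENNReal.ofReal_one, ← ENNReal.ofReal_div_of_pos hb, ← ENNReal.ofReal_div_of_pos hw,
      ← ENNReal.ofReal_add (by positivity) (by positivity),
      ← ENNReal.ofReal_div_of_pos (by positivity)]
    exact ENNReal.ofReal_le_ofReal (h hw)

lemma armValue_le {β Z : ℝ} (hε : ε ∈ Ioo (0 : ℝ) 1) (hβ : 0 < β)
    (h : ∀ w ∈ stdSimplex ℝ (Fin K), w s = β → ∃ j, j ≠ s ∧
      (0 < w j → (μ s - (1 - ε) * μ j) ^ 2 / (1 / β + (1 - ε) ^ 2 / w j) ≤ Z)) :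
    armValue ε β μ s ≤ ENNReal.ofReal Z := by
  refine iSup₂_le fun w hw => ?_
  obtain ⟨j, hj, hjZ⟩ := h w hw.1 hw.2
  exact (iInf₂_le j hj).trans (cost_term_le (by linarith [hε.2]) hβ (hw.1.1 j) hjZ)

lemma sum_erase_of_mem_stdSimplex {w : Fin K → ℝ} (hw : w ∈ stdSimplex ℝ (Fin K)) :
    ∑ j ∈ Finset.univ.erase s, w j = 1 - w s := by
  have := Finset.add_sum_erase Finset.univ w (Finset.mem_univ s)
  linarith [hw.2]

/-- For a fixed proportion `β`, the balanced allocation attains the maximum of the minimal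
transportation cost: another allocation gives less to some arm. -/
lemma armValue_le_fixed {β : ℝ} (hK : 2 ≤ K) (hε : ε ∈ Ioo (0 : ℝ) 1) (hβ : β ∈ Ioo (0 : ℝ) 1)
    {x : Fin K → ℝ} {v : ℝ} (hx : IsBalanced ε (.fixed β) μ s x v) :
    armValue ε β μ s ≤ ENNReal.ofReal (v / (1 + ∑ k ∈ Finset.univ.erase s, x k)) := by
  obtain ⟨hβ0, hβ1⟩ := hβ
  have hr : 0 < 1 - ε := by linarith [hε.2]
  have hsum : ∑ k ∈ Finset.univ.erase s, x k = (1 - β) / β := by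
    simpa [balExp, balConst] using hx.sum_pow
  have hV : v / (1 + ∑ k ∈ Finset.univ.erase s, x k) = β * v := by
    rw [hsum]; field_simp; ring
  rw [hV]
  refine armValue_le hε hβ0 fun w hw hws => ?_
  have hne : (Finset.univ.erase s).Nonempty := by
    rw [← Finset.card_pos, Finset.card_erase_of_mem (Finset.mem_univ _), Finset.card_univ,
      Fintype.card_fin]
    omega
  obtain ⟨j, hj, hle⟩ : ∃ j ∈ Finset.univ.erase s, w j ≤ β * x j := by
    refine Finset.exists_le_of_sum_le hne ?_
    rw [sum_erase_of_mem_stdSimplex hw, hws, ← Finset.mul_sum, hsum]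
    field_simp
    exact le_rfl
  have hjs := (Finset.mem_erase.1 hj).1
  refine ⟨j, hjs, fun hwj => ?_⟩
  have hxj := hx.pos j hjs
  rw [← hx.cost_eq j hjs]
  calc (μ s - (1 - ε) * μ j) ^ 2 / (1 / β + (1 - ε) ^ 2 / w j)
      ≤ (μ s - (1 - ε) * μ j) ^ 2 / (1 / β + (1 - ε) ^ 2 / (β * x j)) := by gcongr
    _ = _ := by field_simp

/-- For the IDS constraint, the balanced allocation is optimal over all proportions. The cost is
concave and homogeneous in the allocation, hence below its tangent at the balanced allocation; the
constraint `∑ x_j² = (1 - ε)²` says that a combination of these tangents is constant on the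
simplex. -/
lemma armValue_le_ids {β : ℝ} (hK : 2 ≤ K) (hε : ε ∈ Ioo (0 : ℝ) 1) (hβ : β ∈ Ioo (0 : ℝ) 1)
    {x : Fin K → ℝ} {v : ℝ} (hx : IsBalanced ε .ids μ s x v) :
    armValue ε β μ s ≤ ENNReal.ofReal (v / (1 + ∑ k ∈ Finset.univ.erase s, x k)) := by
  obtain ⟨hβ0, hβ1⟩ := hβ
  have hr : 0 < 1 - ε := by linarith [hε.2]
  set R := (1 - ε) ^ 2 with hR
  have hR0 : 0 < R := by positivity
  have hsum : ∑ k ∈ Finset.univ.erase s, x k ^ 2 = R := hx.sum_pow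
  have hS : 0 ≤ ∑ k ∈ Finset.univ.erase s, x k :=
    Finset.sum_nonneg fun k hk => (hx.pos k (Finset.mem_erase.1 hk).1).le
  set S := ∑ k ∈ Finset.univ.erase s, x k with hSdef
  have hne : (Finset.univ.erase s).Nonempty := by
    rw [← Finset.card_pos, Finset.card_erase_of_mem (Finset.mem_univ _), Finset.card_univ,
      Fintype.card_fin]
    omega
  refine armValue_le hε hβ0 fun w hw hws => ?_
  -- summed over `j`, both sides equal `1`
  obtain ⟨j, hj, hle⟩ : ∃ j ∈ Finset.univ.erase s,
      x j ^ 2 / R * β + w j ≤ (x j ^ 2 + R * x j) / (R * (1 + S)) := by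
    refine Finset.exists_le_of_sum_le hne (le_of_eq ?_)
    rw [Finset.sum_add_distrib, sum_erase_of_mem_stdSimplex hw, hws, ← Finset.sum_mul,
      ← Finset.sum_div, hsum, ← Finset.sum_div, Finset.sum_add_distrib, hsum, ← Finset.mul_sum]
    field_simp
    ring
  have hjs := (Finset.mem_erase.1 hj).1
  refine ⟨j, hjs, fun hwj => ?_⟩
  have hxj := hx.pos j hjs
  have hvj := hx.cost_eq j hjs
  set Δ := (μ s - (1 - ε) * μ j) ^ 2 with hΔ
  have hΔ0 : 0 ≤ Δ := sq_nonneg _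
  -- the tangent inequality
  have htan : (x j + R) ^ 2 / R ≤ (x j ^ 2 / R * β + w j) * (1 / β + R / w j) := by
    have e : (x j ^ 2 / R * β + w j) * (1 / β + R / w j) - (x j + R) ^ 2 / R =
        (x j * β - w j) ^ 2 / (β * w j) := by field_simp; ring
    have : 0 ≤ (x j * β - w j) ^ 2 / (β * w j) := by positivity
    linarith
  rw [div_le_div_iff₀ (by positivity) (by positivity), ← hvj]
  have h1 := htan.trans (mul_le_mul_of_nonneg_right hle (by positivity))
  rw [div_mul_eq_mul_div, div_le_div_iff₀ hR0 (by positivity)] at h1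
  have h2 : (x j + R) * (1 + S) ≤ x j * (1 / β + R / w j) := by
    have h3 : R * (x j + R) * ((x j + R) * (1 + S)) ≤
        R * (x j + R) * (x j * (1 / β + R / w j)) := by nlinarith
    exact le_of_mul_le_mul_left h3 (by positivity)
  have h4 : 1 + S ≤ x j / (x j + R) * (1 / β + R / w j) := by
    rw [div_mul_eq_mul_div, le_div_iff₀ (by positivity)]
    linarith
  calc Δ * (1 + S) ≤ Δ * (x j / (x j + R) * (1 / β + R / w j)) := by gcongr
    _ = _ := by ring

/-- Exchanging the roles of a good arm and of the best arm does not decrease the value. -/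
lemma armValue_le_armValue_best {β : ℝ} (hε : ε ∈ Ioo (0 : ℝ) 1) (hs : μ s = muStar μ)
    {i : Fin K} (hi : i ∈ goodArms ε μ) :
    armValue ε β μ i ≤ armValue ε β μ s := by
  have hle : ∀ j, μ j ≤ μ s := fun j => hs ▸ le_muStar μ j
  have hi' : 0 ≤ μ i - (1 - ε) * μ s := by
    have : muStar μ - μ i ≤ muStar μ * ε := hi
    rw [hs]; linarith
  have hr : 0 < 1 - ε := by linarith [hε.2]
  refine iSup₂_le fun w hw => ?_
  refine le_iSup₂_of_le (fun j => w (Equiv.swap i s j)) ?_ ?_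
  · refine ⟨⟨fun j => hw.1.1 _, ?_⟩, ?_⟩
    · rw [Equiv.sum_comp (Equiv.swap i s) w]; exact hw.1.2
    · change w (Equiv.swap i s s) = β
      rw [Equiv.swap_apply_right]; exact hw.2
  · refine le_iInf₂ fun j hj => ?_
    have hj' : Equiv.swap i s j ≠ i := by
      intro hcon
      rw [Equiv.swap_apply_eq_iff, Equiv.swap_apply_left] at hcon
      exact hj hcon
    refine iInf₂_le_of_le (Equiv.swap i s j) hj' ?_
    refine ENNReal.div_le_div_right (ENNReal.ofReal_le_ofReal ?_) _
    by_cases hji : j = i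
    · subst hji
      rw [Equiv.swap_apply_left]
      exact pow_le_pow_left₀ hi' (by nlinarith [hle j]) 2
    · rw [Equiv.swap_apply_of_ne_of_ne hji hj]
      exact pow_le_pow_left₀ (by nlinarith [hle j]) (by linarith [hle i]) 2

end CharTime

/-! ### Expected stopping time -/

section Expectation

variable {K : ℕ} {Ω : Type*} [mΩ : MeasurableSpace Ω] {ν : Fin K → Measure ℝ} {p : Proportions}
  {ε : ℝ} {P : Measure Ω} {ℱ : Filtration ℕ mΩ} {I B C : ℕ → Ω → Fin K} {X : ℕ → Ω → ℝ}

/-- The concentration events fail with summable probabilities: apply the two-arm bound with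
`x = 2 log n`, pairing each arm with another one. -/
lemma IsRun.exists_measure_not_concentrated_le [IsProbabilityMeasure P] (hK : 2 ≤ K)
    (hν : IsInstance ν) (h : IsRun ν p ε P ℱ I B C X) :
    ∃ A : ℝ, 0 < A ∧ ∀ n : ℕ, P {ω | ¬ Concentrated ν I X A n ω} ≤
      ENNReal.ofReal (9 * K * (1 / ((n : ℝ) + 1) ^ 2)) := by
  have hl : (3 / 4 : ℝ) ∈ Ioo (1 / 2 : ℝ) 1 := ⟨by norm_num, by norm_num⟩
  set g := gG (3 / 4) with hg
  have hK2 : (2 : ℝ) ≤ K := by exact_mod_cast hK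
  refine ⟨2 * (8 / 3 * (|g| + 1) + 16), by positivity, fun n => ?_⟩
  -- for `n < 3` the right-hand side is at least `1`
  rcases lt_or_ge n 3 with hn | hn
  · refine prob_le_one.trans ?_
    rw [← ENNReal.ofReal_one]
    apply ENNReal.ofReal_le_ofReal
    have : (n : ℝ) + 1 ≤ 3 := by
      have : (n : ℝ) ≤ 2 := by exact_mod_cast (by omega : n ≤ 2)
      linarith
    rw [mul_one_div, le_div_iff₀ (by positivity)]
    nlinarith
  have hlog := one_le_log hn
  have : Nontrivial (Fin K) := Fin.nontrivial_iff_two_le.2 hK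
  choose o ho using fun i : Fin K => exists_ne i
  have hsub : {ω | ¬ Concentrated ν I X (2 * (8 / 3 * (|g| + 1) + 16)) n ω} ⊆
      ⋃ i ∈ (Finset.univ : Finset (Fin K)), {ω | ∃ t, K < t ∧ 2 * g + 2 * Real.log n ≤
        3 / 4 * (deviation ν I X t i ω + deviation ν I X t (o i) ω)} := by
    intro ω hω
    by_contra hcon
    simp only [mem_iUnion, mem_ofPred_eq, not_exists, not_and, not_le] at hcon
    refine hω fun t ht htn i => ?_
    have h1 := hcon i (Finset.mem_univ i) t ht
    have hcorr : ∀ k, Real.log (4 + Real.log (numPulls I t k ω)) ≤ 3 + Real.log n := by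
      intro k
      have hN : (1 : ℝ) ≤ numPulls I t k ω := by exact_mod_cast h.one_le_numPulls ht k ω
      have hNn : (numPulls I t k ω : ℝ) ≤ n := by
        exact_mod_cast ((numPulls_le I t k ω).trans (by omega))
      have h2 := Real.log_nonneg hN
      have h3 := Real.log_le_log (by linarith) hNn
      have h4 := Real.log_le_sub_one_of_pos (show 0 < 4 + Real.log (numPulls I t k ω) by linarith)
      linarith
    have h5 := hcorr i
    have h6 := hcorr (o i)
    have h7 : 0 ≤ (numPulls I t (o i) ω : ℝ) * (empMean I X t (o i) ω - means ν (o i)) ^ 2 := by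
      positivity
    have h8 := le_abs_self g
    have h9 : |g| ≤ |g| * Real.log n := le_mul_of_one_le_right (abs_nonneg g) hlog
    simp only [deviation] at h1
    linarith
  calc P {ω | ¬ Concentrated ν I X (2 * (8 / 3 * (|g| + 1) + 16)) n ω}
      ≤ ∑ i : Fin K, P {ω | ∃ t, K < t ∧ 2 * g + 2 * Real.log n ≤
        3 / 4 * (deviation ν I X t i ω + deviation ν I X t (o i) ω)} :=
        (measure_mono hsub).trans (measure_biUnion_finset_le _ _)
    _ ≤ ∑ _i : Fin K, ENNReal.ofReal (Real.exp (-(2 * Real.log n))) :=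
        Finset.sum_le_sum fun i _ => h.concentration hν (ho i).symm hl _
    _ = ENNReal.ofReal (K * Real.exp (-(2 * Real.log n))) := by
        rw [Finset.sum_const, Finset.card_univ, Fintype.card_fin, nsmul_eq_mul,
          ENNReal.ofReal_mul (by positivity), ENNReal.ofReal_natCast]
    _ ≤ _ := by
        apply ENNReal.ofReal_le_ofReal
        have hn0 : (3 : ℝ) ≤ n := by exact_mod_cast hn
        have e : Real.exp (-(2 * Real.log n)) = 1 / (n : ℝ) ^ 2 := by
          rw [Real.exp_neg, show 2 * Real.log (n : ℝ) = Real.log ((n : ℝ) ^ 2) by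
            rw [Real.log_pow]; norm_num, Real.exp_log (by positivity), one_div]
        rw [e, mul_comm 9 (K : ℝ), mul_assoc]
        gcongr
        rw [mul_one_div, div_le_div_iff₀ (by positivity) (by positivity)]
        nlinarith

/-- If the algorithm has stopped by round `n` whenever `n ≥ m` and the event `G n` holds, then the
expected stopping time is at most `m` plus the sum of the probabilities of the complements. -/
lemma lintegral_le_of_forall_le {T : Ω → ℕ∞} {G : ℕ → Ω → Prop} {m : ℕ} [IsProbabilityMeasure P]
    (hT : ∀ n ω, m ≤ n → G n ω → T ω ≤ n) :
    ∫⁻ ω, (T ω : ℝ≥0∞) ∂P ≤ m + ∑' n, P {ω | ¬ G n ω} := by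
  classical
  set D : ℕ → Set Ω := fun n => toMeasurable P {ω | ¬ G n ω} with hD
  have hpt : ∀ ω, (T ω : ℝ≥0∞) ≤ m + ∑' n, (D n).indicator (fun _ => (1 : ℝ≥0∞)) ω := by
    intro ω
    -- the rounds from `m` to `N` all lie in the exceptional sets
    have hcount : ∀ N, (∀ n, m ≤ n → n < N → ¬ G n ω) →
        ((N - m : ℕ) : ℝ≥0∞) ≤ ∑' n, (D n).indicator (fun _ => (1 : ℝ≥0∞)) ω := by
      intro N hN
      calc ((N - m : ℕ) : ℝ≥0∞)
          = ∑ n ∈ Finset.Ico m N, (D n).indicator (fun _ => (1 : ℝ≥0∞)) ω := by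
            rw [Finset.sum_congr rfl (g := fun _ => (1 : ℝ≥0∞)) fun n hn => ?_]
            · simp
            · have hn' := Finset.mem_Ico.1 hn
              exact indicator_of_mem (subset_toMeasurable P _ (hN n hn'.1 hn'.2)) _
        _ ≤ _ := ENNReal.sum_le_tsum _
    by_cases hex : ∃ n, m ≤ n ∧ G n ω
    · set N := Nat.find hex with hNdef
      obtain ⟨hN1, hN2⟩ := Nat.find_spec hex
      have h1 := hcount N fun n hmn hn hG => Nat.find_min hex hn ⟨hmn, hG⟩
      have h2 : (T ω : ℝ≥0∞) ≤ ((N : ℕ∞) : ℝ≥0∞) := by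
        exact_mod_cast hT N ω hN1 hN2
      calc (T ω : ℝ≥0∞) ≤ (N : ℝ≥0∞) := by simpa using h2
        _ = m + ((N - m : ℕ) : ℝ≥0∞) := by
          rw [← Nat.cast_add]; congr 1; omega
        _ ≤ _ := by gcongr
    · push Not at hex
      have htop : ∑' n, (D n).indicator (fun _ => (1 : ℝ≥0∞)) ω = ⊤ := by
        refine ENNReal.eq_top_of_forall_nnreal_le fun r => ?_
        obtain ⟨N, hN⟩ := exists_nat_ge r
        refine le_trans ?_ (hcount (m + N) fun n hmn _ => hex n hmn)
        rw [Nat.add_sub_cancel_left]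
        exact_mod_cast hN
      rw [htop, add_top]
      exact le_top
  calc ∫⁻ ω, (T ω : ℝ≥0∞) ∂P
      ≤ ∫⁻ ω, (m + ∑' n, (D n).indicator (fun _ => (1 : ℝ≥0∞)) ω) ∂P := lintegral_mono hpt
    _ = m + ∑' n, P {ω | ¬ G n ω} := by
      rw [lintegral_add_left measurable_const, lintegral_const, measure_univ, mul_one,
        lintegral_tsum fun n =>
          (measurable_const.indicator (measurableSet_toMeasurable _ _)).aemeasurable]
      congr 1
      refine tsum_congr fun n => ?_
      rw [lintegral_indicator (measurableSet_toMeasurable _ _), setLIntegral_const, one_mul,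
        measure_toMeasurable]

/-- As `δ → 0` the threshold is `log (1 / δ)` to first order: `l < 1` can be taken arbitrarily close
to `1`. -/
lemma eventually_threshold_le (hK : 2 ≤ K) {l : ℝ} (hl : l ∈ Ioo (1 / 2 : ℝ) 1) {η : ℝ}
    (hη : 0 < η) : ∃ m : ℕ, ∀ n, m ≤ n → ∀ δ ∈ Ioo (0 : ℝ) 1,
      2 * threshold K (n - 1) δ ≤ 2 / l * Real.log (1 / δ) + η * n := by
  have hK1 : (1 : ℝ) ≤ (K : ℝ) - 1 := by
    have : (2 : ℝ) ≤ K := by exact_mod_cast hK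
    linarith
  have hl0 : 0 < l := by linarith [hl.1]
  set c := (4 * gG l + 2 * Real.log ((K : ℝ) - 1)) / l + 24 with hc
  have hlim : Tendsto (fun n : ℕ => c * ((n : ℝ))⁻¹ + 8 * (Real.log n / n)) atTop
      (𝓝 (c * 0 + 8 * 0)) :=
    ((tendsto_inv_atTop_zero.comp tendsto_natCast_atTop_atTop).const_mul c).add
      (((Real.isLittleO_log_id_atTop.tendsto_div_nhds_zero).comp
        tendsto_natCast_atTop_atTop).const_mul 8)
  obtain ⟨m, hm⟩ := eventually_atTop.1 (hlim.eventually_lt_const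
    (show c * 0 + 8 * 0 < η by linarith))
  refine ⟨max m 3, fun n hn δ hδ => ?_⟩
  have hn3 : 3 ≤ n := (le_max_right _ _).trans hn
  have h1 := hm n ((le_max_left _ _).trans hn)
  have hnpos : (0 : ℝ) < n := by positivity
  have h2 : c + 8 * Real.log n ≤ η * n := by
    have e : c * ((n : ℝ))⁻¹ + 8 * (Real.log n / n) = (c + 8 * Real.log n) / n := by
      field_simp
    rw [e, div_lt_iff₀ hnpos] at h1
    exact h1.le
  have h3 := CG_le hl (Real.log (((K : ℝ) - 1) / δ) / 2)
  have h4 : Real.log (((K : ℝ) - 1) / δ) = Real.log ((K : ℝ) - 1) + Real.log (1 / δ) := by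
    rw [← Real.log_mul (by linarith) (one_div_pos.2 hδ.1).ne', mul_one_div]
  have h5 : Real.log (4 + Real.log (((n - 1 : ℕ) : ℝ) / 2)) ≤ 3 + Real.log n := by
    have hcast : ((n - 1 : ℕ) : ℝ) = n - 1 := by rw [Nat.cast_sub (by omega)]; simp
    have hn3' : (3 : ℝ) ≤ n := by exact_mod_cast hn3
    have h6 : 0 ≤ Real.log (((n - 1 : ℕ) : ℝ) / 2) :=
      Real.log_nonneg (by rw [hcast]; linarith)
    have h7 : Real.log (((n - 1 : ℕ) : ℝ) / 2) ≤ Real.log n :=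
      Real.log_le_log (by rw [hcast]; linarith) (by rw [hcast]; linarith)
    have h8 := Real.log_le_sub_one_of_pos
      (show 0 < 4 + Real.log (((n - 1 : ℕ) : ℝ) / 2) by linarith)
    linarith
  have h9 : 4 * ((gG l + Real.log (((K : ℝ) - 1) / δ) / 2) / l) =
      (c - 24) + 2 / l * Real.log (1 / δ) := by
    rw [hc, h4]; field_simp; ring
  rw [threshold]
  linarith

/-- On the concentration event of a large round `n`, the algorithm has stopped as soon as
`n ≥ a log (1 / δ)`, where `a` is any constant above `2 / V`. -/
lemma IsRun.exists_stoppingTime_le (hK : 2 ≤ K) (hν : IsInstance ν) (hε : ε ∈ Ioo (0 : ℝ) 1)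
    (hp : p.Valid) (h : IsRun ν p ε P ℱ I B C X) {s : Fin K}
    (hs : ∀ i, i ≠ s → means ν i < means ν s) {x : Fin K → ℝ} {v : ℝ}
    (hx : IsBalanced ε p (means ν) s x v) {A : ℝ} (hA : 0 < A) {a : ℝ} (ha : 0 < a)
    (hav : 2 < a * (v / (1 + ∑ k ∈ Finset.univ.erase s, x k))) :
    ∃ m : ℕ, ∀ n ω, ∀ δ ∈ Ioo (0 : ℝ) 1, m ≤ n → a * Real.log (1 / δ) ≤ n →
      Concentrated ν I X A n ω → stoppingTime ε δ I B X ω ≤ n := by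
  set V := v / (1 + ∑ k ∈ Finset.univ.erase s, x k) with hV
  -- one small `η` serves as the loss in the threshold, in the cost and in the exponent `l = 1 - η`
  have ht : Tendsto (fun η : ℝ => a * ((V - 2 * η) * (1 - η))) (𝓝[>] 0)
      (𝓝 (a * ((V - 2 * 0) * (1 - 0)))) :=
    (Continuous.tendsto (by fun_prop) 0).mono_left nhdsWithin_le_nhds
  have hsmall : ∀ᶠ η in 𝓝[>] (0 : ℝ), η < 1 / 2 :=
    nhdsWithin_le_nhds (eventually_lt_nhds (by norm_num))
  obtain ⟨η, ⟨hη1, hη2⟩, hη0⟩ := ((ht.eventually_const_lt (show 2 < a * ((V - 2 * 0) * (1 - 0)) by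
    simpa using hav)).and hsmall |>.and self_mem_nhdsWithin).exists
  replace hη0 : 0 < η := hη0
  have hl : 1 - η ∈ Ioo (1 / 2 : ℝ) 1 := ⟨by linarith, by linarith⟩
  obtain ⟨m1, hm1⟩ := eventually_threshold_le hK hl hη0
  obtain ⟨m2, hm2⟩ := h.eventually_sq_cost_ge (by omega) hν hε hp hs hx hA
    (V := V - η) (by linarith)
  refine ⟨max m1 m2, fun n ω δ hδ hn hLn hc => ?_⟩
  obtain ⟨hKn, hB, hcost⟩ := hm2 n ω ((le_max_right _ _).trans hn) hc
  refine sInf_le ⟨n, ⟨hKn, fun j hj => ?_⟩, rfl⟩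
  rw [hB] at hj ⊢
  obtain ⟨h1, h2⟩ := hcost j hj
  apply Real.sqrt_le_iff.2 ⟨h1, ?_⟩
  refine (hm1 n ((le_max_left _ _).trans hn) δ hδ).trans (le_trans ?_ h2)
  have hL : 0 ≤ Real.log (1 / δ) := Real.log_nonneg (by
    rw [le_div_iff₀ hδ.1]; linarith [hδ.2])
  have h3 : 2 / (1 - η) ≤ (V - 2 * η) * a := by
    rw [div_le_iff₀ (by linarith)]
    linarith
  have hpos : 0 < V - 2 * η := by
    by_contra hcon
    push Not at hcon
    have h4 : a * ((V - 2 * η) * (1 - η)) ≤ 0 :=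
      mul_nonpos_of_nonneg_of_nonpos ha.le (mul_nonpos_of_nonpos_of_nonneg hcon (by linarith))
    linarith
  calc 2 / (1 - η) * Real.log (1 / δ) + η * n
      ≤ (V - 2 * η) * a * Real.log (1 / δ) + η * n := by gcongr
    _ = (V - 2 * η) * (a * Real.log (1 / δ)) + η * n := by ring
    _ ≤ (V - 2 * η) * n + η * n := by gcongr
    _ = (V - η) * n := by ring

/-- The expected stopping time divided by `log (1 / δ)` is asymptotically at most `2 / V`: it is at
most a constant plus `a log (1 / δ)`, for every `a > 2 / V`. -/
lemma IsRun.limsup_le [IsProbabilityMeasure P] (hK : 2 ≤ K) (hν : IsInstance ν)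
    (hε : ε ∈ Ioo (0 : ℝ) 1) (hp : p.Valid) (h : IsRun ν p ε P ℱ I B C X) {s : Fin K}
    (hs : ∀ i, i ≠ s → means ν i < means ν s) {x : Fin K → ℝ} {v : ℝ} (hv : 0 < v)
    (hx : IsBalanced ε p (means ν) s x v) :
    limsupSampleComplexity P ε I B X ≤
      2 / ENNReal.ofReal (v / (1 + ∑ k ∈ Finset.univ.erase s, x k)) := by
  have hS : 0 ≤ ∑ k ∈ Finset.univ.erase s, x k :=
    Finset.sum_nonneg fun k hk => (hx.pos k (Finset.mem_erase.1 hk).1).le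
  set V := v / (1 + ∑ k ∈ Finset.univ.erase s, x k) with hV
  have hVpos : 0 < V := by positivity
  obtain ⟨A, hA, hconc⟩ := h.exists_measure_not_concentrated_le hK hν
  have hfin : ∑' n, P {ω | ¬ Concentrated ν I X A n ω} ≠ ⊤ := by
    have hsm : Summable (fun n : ℕ => 9 * (K : ℝ) * (1 / ((n : ℝ) + 1) ^ 2)) := by
      refine Summable.mul_left _ ?_
      have := (summable_nat_add_iff 1).2 (Real.summable_one_div_nat_pow.2 one_lt_two)
      simpa using this
    refine ne_top_of_le_ne_top ?_ (ENNReal.tsum_le_tsum hconc)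
    rw [← ENNReal.ofReal_tsum_of_nonneg (fun n => by positivity) hsm]
    exact ENNReal.ofReal_ne_top
  have hmain : ∀ a : ℝ, 2 / V < a → limsupSampleComplexity P ε I B X ≤ ENNReal.ofReal a := by
    intro a ha
    have ha0 : 0 < a := lt_trans (by positivity) ha
    have hav : 2 < a * V := by rwa [div_lt_iff₀ hVpos] at ha
    obtain ⟨m, hm⟩ := h.exists_stoppingTime_le hK hν hε hp hs hx hA ha0 hav
    set c : ℝ≥0∞ := m + 1 + ∑' n, P {ω | ¬ Concentrated ν I X A n ω} with hc
    have hcfin : c ≠ ⊤ := by simp [hc, hfin]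
    have hbound : ∀ δ ∈ Ioo (0 : ℝ) 1, ∫⁻ ω, (stoppingTime ε δ I B X ω : ℝ≥0∞) ∂P ≤
        c + ENNReal.ofReal (a * Real.log (1 / δ)) := by
      intro δ hδ
      have hL : 0 ≤ Real.log (1 / δ) := Real.log_nonneg (by
        rw [le_div_iff₀ hδ.1]; linarith [hδ.2])
      have haL : 0 ≤ a * Real.log (1 / δ) := by positivity
      have h1 := lintegral_le_of_forall_le (P := P) (T := stoppingTime ε δ I B X)
        (G := fun n ω => Concentrated ν I X A n ω) (m := m + ⌈a * Real.log (1 / δ)⌉₊)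
        (fun n ω hn hG => hm n ω δ hδ (by omega)
          ((Nat.le_ceil _).trans (by exact_mod_cast (by omega : ⌈a * Real.log (1 / δ)⌉₊ ≤ n))) hG)
      refine h1.trans ?_
      have h2 : ((⌈a * Real.log (1 / δ)⌉₊ : ℕ) : ℝ≥0∞) ≤
          1 + ENNReal.ofReal (a * Real.log (1 / δ)) := by
        rw [← ENNReal.ofReal_natCast, ← ENNReal.ofReal_one, ← ENNReal.ofReal_add zero_le_one haL]
        apply ENNReal.ofReal_le_ofReal
        linarith [Nat.ceil_lt_add_one haL]
      push_cast
      calc _ ≤ (m : ℝ≥0∞) + (1 + ENNReal.ofReal (a * Real.log (1 / δ))) +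
            ∑' n, P {ω | ¬ Concentrated ν I X A n ω} := by gcongr
        _ = _ := by rw [hc]; ring
    have hlog : Tendsto (fun δ : ℝ => Real.log (1 / δ)) (𝓝[>] 0) atTop := by
      simp only [one_div]
      exact Real.tendsto_log_atTop.comp tendsto_inv_nhdsGT_zero
    have hlim : Tendsto (fun δ : ℝ => c / ENNReal.ofReal (Real.log (1 / δ)) + ENNReal.ofReal a)
        (𝓝[>] 0) (𝓝 (ENNReal.ofReal a)) := by
      have h1 : Tendsto (fun δ : ℝ => c / ENNReal.ofReal (Real.log (1 / δ))) (𝓝[>] 0) (𝓝 0) := by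
        rw [← ENNReal.div_top (a := c)]
        exact ENNReal.Tendsto.const_div (ENNReal.tendsto_ofReal_atTop.comp hlog) (.inr hcfin)
      simpa using h1.add_const (ENNReal.ofReal a)
    have hδ1 : ∀ᶠ δ in 𝓝[>] (0 : ℝ), δ ∈ Ioo (0 : ℝ) 1 := Ioo_mem_nhdsGT one_pos
    rw [limsupSampleComplexity, ← hlim.limsup_eq]
    refine limsup_le_limsup ?_
    filter_upwards [hδ1] with δ hδ
    have hL : 0 < Real.log (1 / δ) := Real.log_pos (by
      rw [lt_div_iff₀ hδ.1]; linarith [hδ.2])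
    have hL0 : ENNReal.ofReal (Real.log (1 / δ)) ≠ 0 := by simpa using hL
    calc _ ≤ (c + ENNReal.ofReal (a * Real.log (1 / δ))) / ENNReal.ofReal (Real.log (1 / δ)) :=
          ENNReal.div_le_div_right (hbound δ hδ) _
      _ = _ := by
        rw [ENNReal.add_div, ENNReal.ofReal_mul ha0.le,
          ENNReal.mul_div_cancel_right hL0 ENNReal.ofReal_ne_top]
  have e : (2 : ℝ≥0∞) / ENNReal.ofReal V = ENNReal.ofReal (2 / V) := by
    rw [ENNReal.ofReal_div_of_pos hVpos]; simp
  rw [e]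
  have ht : Tendsto (fun a : ℝ => ENNReal.ofReal a) (𝓝[>] (2 / V)) (𝓝 (ENNReal.ofReal (2 / V))) :=
    (ENNReal.continuous_ofReal.tendsto _).mono_left nhdsWithin_le_nhds
  exact ge_of_tendsto ht (by filter_upwards [self_mem_nhdsWithin] with a ha using hmain a ha)

end Expectation
end EBTC

theorem mainTheorem7 {K : ℕ} (hK : 2 ≤ K) {ε₀ : ℝ} (hε₀ : ε₀ ∈ Set.Ioo (0 : ℝ) 1)
    {ν : Fin K → Measure ℝ} (hν : EBTC.IsInstance ν)
    {Ω : Type*} [MeasurableSpace Ω] {P : Measure Ω} [IsProbabilityMeasure P]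
    {ℱ : Filtration ℕ ‹MeasurableSpace Ω›} {I B C : ℕ → Ω → Fin K} {X : ℕ → Ω → ℝ} :
    (∀ p : EBTC.Proportions, p.Valid → EBTC.IsRun ν p ε₀ P ℱ I B C X →
      ∀ δ ∈ Set.Ioo (0 : ℝ) 1, P (EBTC.errorEvent ν ε₀ δ I B X) ≤ ENNReal.ofReal δ) ∧
    ((EBTC.bestArms (EBTC.means ν)).ncard = 1 →
      (EBTC.IsRun ν EBTC.Proportions.ids ε₀ P ℱ I B C X →
        EBTC.limsupSampleComplexity P ε₀ I B X ≤ EBTC.charTime ε₀ (EBTC.means ν)) ∧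
      (∀ β ∈ Set.Ioo (0 : ℝ) 1, EBTC.IsRun ν (EBTC.Proportions.fixed β) ε₀ P ℱ I B C X →
        EBTC.limsupSampleComplexity P ε₀ I B X ≤
          EBTC.charTimeBeta ε₀ β (EBTC.means ν))) := by
  refine ⟨fun p _ h δ hδ => h.measure_errorEvent_le hK hν hε₀ hδ, fun hbest => ?_⟩
  obtain ⟨s, hs, hlt⟩ := EBTC.bestArms_unique hbest
  have hμ : ∀ i, 0 < EBTC.means ν i := fun i => (hν i).2
  have hle : ∀ i, EBTC.means ν i ≤ EBTC.means ν s := fun i => hs ▸ EBTC.le_muStar _ i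
  refine ⟨fun h => ?_, fun β hβ h => ?_⟩
  · have hp : EBTC.Proportions.ids.Valid := trivial
    obtain ⟨x, v, hv, hx⟩ := EBTC.exists_isBalanced (s := s) hK hε₀ hp hμ hle
    refine (h.limsup_le hK hν hε₀ hp hlt hv hx).trans ?_
    refine le_iInf₂ fun i hi => le_iInf₂ fun β hβ => ?_
    exact ENNReal.div_le_div_left ((EBTC.armValue_le_armValue_best hε₀ hs hi).trans
      (EBTC.armValue_le_ids hK hε₀ hβ hx)) _
  · have hp : (EBTC.Proportions.fixed β).Valid := hβ
    obtain ⟨x, v, hv, hx⟩ := EBTC.exists_isBalanced (s := s) hK hε₀ hp hμ hle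
    refine (h.limsup_le hK hν hε₀ hp hlt hv hx).trans ?_
    refine le_iInf₂ fun i hi => ?_
    exact ENNReal.div_le_div_left ((EBTC.armValue_le_armValue_best hε₀ hs hi).trans
      (EBTC.armValue_le_fixed hK hε₀ hβ hx)) _
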